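/- Let $k\ge 1$ be an integer, let $\alpha$ be the positive root of $\mathfrak{sl}_2$, $\langle\alpha,\alpha\rangle=2$, and let $X,Y,H$ be the Chevalley basis of $\mathfrak{sl}_2(\mathbb C)$. The affine Lie algebra $A_1^{(1)}=\widehat{\mathfrak{sl}}_2=\mathfrak{sl}_2\otimes\mathbb C[t,t^{-1}]\oplus\mathbb Cc\oplus\mathbb Cd$ has the brackets $[a(m),b(n)]=[a,b](m+n)+m\,\delta_{m+n,0}\mathrm{Tr}(ab)\,c$, $[d,a(m)]=m\,a(m)$, with $c$ central; put $a(z)=\sum_{m\in\mathbb Z}a(m)z^{-m}$. **Fock space.** On $S(\mathfrak h'^-)=\mathbb C[H(-1),H(-2),\dots]$ let $H(m)$ act as multiplication by $H(m)$ for $m<0$, as $0$ for $m=0$, and as $-2mk\,\partial/\partial H(-m)$ for $m>0$. Put $E_+^{\pm}(z)=\exp\big(\mp\sum_{n>0}\tfrac{H(-n)}{kn}z^{n}\big)$ and $E_-^{\pm}(z)=\exp\big(\pm\sum_{n>0}\tfrac{H(n)}{kn}z^{-n}\big)$. **Group algebra.** On $\mathbb C(\mathbb Z\alpha)$ let $e^{\pm\alpha}$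 act by multiplication, and let $\alpha(0)e^{n\alpha}=2n\,e^{n\alpha}$, $z^{q\alpha}e^{n\alpha}=z^{2qn}e^{n\alpha}$ ($q\in\mathbb Q$). **Parafermions.** Let $W$ be a space of parafermions at level $-k$ (in the paper $W=\langle\Phi_{\alpha,0}\rangle$, generated by a field of charge $\alpha$; the generation is not needed). That is, $W$ is a complex vector space spanned by subspaces $W_n$, $n\in\mathbb Z$ (states of charge $n\alpha$; they need not be independent, so that charges may also be taken modulo $k\alpha$), with operator series $A_\alpha(z),A^*_{-\alpha}(z)\in \mathrm{End}(W)\{z\}$ with rational exponents, such that: 1. on each vector the powers of $z$ in $A_\alpha(z)$ and $A^*_{-\alpha}(z)$ are bounded below; $A_\alpha(z)$ maps $W_n$ to $W_{n+1}$ with exponents in $\tfrac{2n}{k}+\mathbb Z$, and $A^*_{-\alpha}(z)$ maps $W_n$ to $W_{n-1}$ with exponents in $-\tfrac{2n}{k}+\mathbb Z$; 2. $A_\alpha(z)A_\alpha(w)(z-w)^{-2/k}=A_\alpha(w)A_\alpha(z)(w-z)^{-2/k}$, and the same for $A^*_{-\alpha}$; 3. $A_\alpha(z)A^*_{-\alpha}(w)(z-w)^{2/k}$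 and $A^*_{-\alpha}(w)A_\alpha(z)(w-z)^{2/k}$ become equal after multiplication by $(z-w)^2$, and the common series $P(z,w)$ is $-kzw+O((z-w)^2)$, that is, $P(z,w)|_{z=w}=-kw^2$ and $(z\partial_zP)(z,w)|_{z=w}=-kw^2$ (these specializations are well defined); in other words the contraction of $A_\alpha(z)A^*_{-\alpha}(w)$ is $\frac{-kzw}{(z-w)^2}$; 4. $W$ has a degree operator (minus the conformal weight) that preserves each $W_n$ and for which $z^{-1}A_\alpha(z)$ and $z^{-1}A^*_{-\alpha}(z)$ have conformal dimension $1+\tfrac1k$: the commutator of the degree operator with the coefficient of $z^{-r}$ of either field is $r-\tfrac1k$ times that coefficient. Here $(z-w)^a=z^a(1-w/z)^a$ is expanded in nonnegative powers of $w/z$ and $(w-z)^a=w^a(1-z/w)^a$ in nonnegative powers of $z/w$. **The module.** Let $V$ be the charge-matched part of $S(\mathfrak h'^-)\otimes W\otimes\mathbb C(\mathbb Z\alpha)$, that is, the span of all $s\otimes w\otimes e^{n\alpha}$ with $s\in S(\mathfrak h'^-)$, $n\in\mathbb Z$, $w\in W_n$. **Theorem.** The series $E^+_+(z)E^+_-(z)\otimes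 A_\alpha(z)e^{\alpha}z^{-\alpha/k}$ and $E^-_+(z)E^-_-(z)\otimes A^*_{-\alpha}(z)e^{-\alpha}z^{\alpha/k}$ have only integral powers of $z$ on $V$, and there is exactly one representation $\pi$ of the Lie algebra $A_1^{(1)}$ on $V$ with $$X(z)\mapsto E^+_+(z)E^+_-(z)\otimes A_\alpha(z)e^{\alpha}z^{-\alpha/k},\qquad Y(z)\mapsto E^-_+(z)E^-_-(z)\otimes A^*_{-\alpha}(z)e^{-\alpha}z^{\alpha/k},$$ $$H(z)\mapsto \sum_{m\ne0}H(m)z^{-m}\otimes1\otimes 1+1\otimes1\otimes\alpha(0),\qquad c\mapsto -k,\qquad d\mapsto \deg,$$ where $\deg$ is the sum of the degree operators of the three factors: the derivation $H(-n)\mapsto -nH(-n)$ on $S(\mathfrak h'^-)$, the degree operator of $W$, and $e^{n\alpha}\mapsto\frac{n^2}{k}e^{n\alpha}$ on $\mathbb C(\mathbb Z\alpha)$. In particular this is a representation of level $-k$. -/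

import Mathlib

open scoped TensorProduct
noncomputable section

/-- `sl₂(ℂ)`: the trace-zero complex `2 × 2` matrices. -/
abbrev Sl2 : Type := LieAlgebra.SpecialLinear.sl (Fin 2) ℂ

namespace Sl2

/-- `H = diag(1, -1)`. -/
def H : Sl2 := ⟨!![1, 0; 0, -1], by simp [LieAlgebra.SpecialLinear.sl, Matrix.trace_fin_two]⟩
/-- The upper triangular matrix unit. -/
def X : Sl2 := ⟨!![0, 1; 0, 0], by simp [LieAlgebra.SpecialLinear.sl, Matrix.trace_fin_two]⟩
/-- The lower triangular matrix unit. -/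
def Y : Sl2 := ⟨!![0, 0; 1, 0], by simp [LieAlgebra.SpecialLinear.sl, Matrix.trace_fin_two]⟩

/-- The invariant form `(a, b) ↦ Tr(ab)`. -/
def trForm : LinearMap.BilinForm ℂ Sl2 :=
  LinearMap.mk₂ ℂ (fun a b => Matrix.trace (a.1 * b.1))
    (by intros; simp [add_mul]) (by intros; simp)
    (by intros; simp [mul_add]) (by intros; simp)

theorem trForm_symm : trForm.IsSymm := ⟨fun a b => by
  simp [trForm, Matrix.trace_mul_comm a.1 b.1]⟩

theorem trForm_inv : trForm.lieInvariant Sl2 := fun x y z => by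
  simp only [trForm, LinearMap.mk₂_apply, LieAlgebra.SpecialLinear.sl_bracket, sub_mul, mul_sub,
    Matrix.trace_sub]
  have := Matrix.trace_mul_cycle y.1 z.1 x.1
  simp only [Matrix.mul_assoc] at this ⊢
  rw [this]; ring_nf

end Sl2

/-- The group algebra `ℂ(ℤα)` of the root lattice of `sl₂`; `e^{nα}` is `AddMonoidAlgebra.single n 1`,
and `⟨α, α⟩ = 2`. -/
abbrev LatticeAlg : Type := AddMonoidAlgebra ℂ ℤ

namespace LatticeAlg

/-- The diagonal operator `e^{nα} ↦ c n • e^{nα}`. -/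
def diag (c : ℤ → ℂ) : Module.End ℂ LatticeAlg :=
  (AddMonoidAlgebra.basis ℤ ℂ).constr ℂ fun n => c n • AddMonoidAlgebra.single n (1 : ℂ)

theorem diag_single (c : ℤ → ℂ) (n : ℤ) :
    diag c (AddMonoidAlgebra.single n 1) = c n • AddMonoidAlgebra.single n (1 : ℂ) := by
  have := (AddMonoidAlgebra.basis ℤ ℂ).constr_basis ℂ
    (fun n => c n • AddMonoidAlgebra.single n (1 : ℂ)) n
  simpa [diag] using this
end LatticeAlg

/-- The loop algebra `sl₂(ℂ) ⊗ ℂ[t, t⁻¹]`. -/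
def LoopSl2 : Type := LieAlgebra.loopAlgebra ℂ ℤ Sl2

namespace LoopSl2

instance : LieRing LoopSl2 := inferInstanceAs (LieRing (LieAlgebra.loopAlgebra ℂ ℤ Sl2))

instance : LieAlgebra ℂ LoopSl2 :=
  inferInstanceAs (LieAlgebra ℂ (LieAlgebra.loopAlgebra ℂ ℤ Sl2))

/-- `a ⊗ t^m`. -/
def mono (a : Sl2) (m : ℤ) : LoopSl2 := AddMonoidAlgebra.single m (1 : ℂ) ⊗ₜ[ℂ] a

theorem tmul_induction {p : LieAlgebra.loopAlgebra ℂ ℤ Sl2 → Prop} (h0 : p 0)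
    (hadd : ∀ f g, p f → p g → p (f + g))
    (hm : ∀ (a : Sl2) (m : ℤ), p (AddMonoidAlgebra.single m (1 : ℂ) ⊗ₜ[ℂ] a))
    (f : LieAlgebra.loopAlgebra ℂ ℤ Sl2) : p f := by
  induction f using TensorProduct.induction_on with
  | zero => exact h0
  | add f g hf hg => exact hadd f g hf hg
  | tmul x a =>
    have hx : x ∈ Submodule.span ℂ (Set.range (AddMonoidAlgebra.basis ℤ ℂ)) := by
      rw [(AddMonoidAlgebra.basis ℤ ℂ).span_eq]; trivial
    induction hx using Submodule.span_induction generalizing a with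
    | zero => simpa using h0
    | add x y _ _ hx hy => rw [TensorProduct.add_tmul]; exact hadd _ _ (hx a) (hy a)
    | smul c x _ hx => rw [TensorProduct.smul_tmul]; exact hx _
    | mem x hx =>
      obtain ⟨m, rfl⟩ := hx
      rw [AddMonoidAlgebra.basis_apply]; exact hm a m

theorem mono_induction {p : LoopSl2 → Prop} (h0 : p 0) (hadd : ∀ f g, p f → p g → p (f + g))
    (hm : ∀ a m, p (mono a m)) (f : LoopSl2) : p f :=
  tmul_induction (p := p) h0 hadd hm f

/-- The derivation `t d/dt`, `a ⊗ t^m ↦ m (a ⊗ t^m)`. -/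
def euler : LoopSl2 →ₗ[ℂ] LoopSl2 := (LatticeAlg.diag fun n => (n : ℂ)).rTensor Sl2

theorem euler_mono (a : Sl2) (m : ℤ) : euler (mono a m) = (m : ℂ) • mono a m := by
  have h : (LatticeAlg.diag fun n => (n : ℂ)).rTensor Sl2
      (AddMonoidAlgebra.single m (1 : ℂ) ⊗ₜ[ℂ] a) =
      (m : ℂ) • (AddMonoidAlgebra.single m (1 : ℂ) ⊗ₜ[ℂ] a) := by
    rw [LinearMap.rTensor_tmul, LatticeAlg.diag_single, TensorProduct.smul_tmul']
  exact h

theorem lie_mono (a b : Sl2) (m n : ℤ) : ⁅mono a m, mono b n⁆ = mono ⁅a, b⁆ (m + n) := by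
  have h : ⁅mono a m, mono b n⁆ = (AddMonoidAlgebra.single m (1 : ℂ) *
      AddMonoidAlgebra.single n (1 : ℂ)) ⊗ₜ[ℂ] ⁅a, b⁆ := rfl
  rw [h, AddMonoidAlgebra.single_mul_single, one_mul, mono]

/-- The cocycle determined by `(a ⊗ t^m, b ⊗ t^n) ↦ m δ_{m+n,0} Tr(ab)`. -/
def cocycle : LinearMap.BilinForm ℂ LoopSl2 :=
  -LieAlgebra.LoopAlgebra.residuePairing ℂ ℤ Sl2 Sl2.trForm

theorem cocycle_mono (a b : Sl2) (m n : ℤ) :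
    cocycle (mono a m) (mono b n) = if m + n = 0 then (m : ℂ) * Sl2.trForm a b else 0 := by
  have key : -LieAlgebra.LoopAlgebra.residuePairing ℂ ℤ Sl2 Sl2.trForm
      (AddMonoidAlgebra.single m (1 : ℂ) ⊗ₜ[ℂ] a) (AddMonoidAlgebra.single n (1 : ℂ) ⊗ₜ[ℂ] b) =
      if m + n = 0 then (m : ℂ) * Sl2.trForm a b else 0 := by
    simp only [LieAlgebra.LoopAlgebra.residuePairing_apply_apply,
      LieAlgebra.LoopAlgebra.toFinsupp_single_tmul]
    rw [Finsupp.sum_single_index (by simp)]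
    split_ifs with h
    · obtain rfl : n = -m := by omega
      simp
    · rw [Finsupp.single_eq_of_ne (by omega)]; simp
  exact key

theorem euler_lie (f g : LoopSl2) : euler ⁅f, g⁆ = ⁅euler f, g⁆ + ⁅f, euler g⁆ := by
  induction f using mono_induction with
  | h0 => simp only [zero_lie, map_zero, add_zero]
  | hadd f f' hf hf' => simp only [add_lie, map_add, hf, hf']; abel
  | hm a m =>
    induction g using mono_induction with
    | h0 => simp only [lie_zero, map_zero, add_zero]
    | hadd g g' hg hg' => simp only [lie_add, map_add, hg, hg']; abel
    | hm b n =>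
      simp only [euler_mono, lie_mono, smul_lie, lie_smul]
      rw [← add_smul]; push_cast; rfl

theorem cocycle_euler (f g : LoopSl2) : cocycle (euler f) g + cocycle f (euler g) = 0 := by
  induction f using mono_induction with
  | h0 => simp only [map_zero, LinearMap.zero_apply, add_zero]
  | hadd f f' hf hf' =>
    simp only [map_add, LinearMap.add_apply]
    linear_combination hf + hf'
  | hm a m =>
    induction g using mono_induction with
    | h0 => simp only [map_zero, add_zero]
    | hadd g g' hg hg' => simp only [map_add]; linear_combination hg + hg'
    | hm b n =>
      simp only [euler_mono, map_smul, LinearMap.smul_apply, cocycle_mono, smul_eq_mul]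
      split_ifs with h
      · obtain rfl : n = -m := by omega
        push_cast; ring
      · simp

theorem cocycle_skew (f g : LoopSl2) : cocycle f g = -cocycle g f := by
  induction f using mono_induction with
  | h0 => simp only [map_zero, LinearMap.zero_apply, neg_zero]
  | hadd f f' hf hf' =>
    simp only [map_add, LinearMap.add_apply, hf, hf']; ring
  | hm a m =>
    induction g using mono_induction with
    | h0 => simp only [map_zero, LinearMap.zero_apply, neg_zero]
    | hadd g g' hg hg' => simp only [map_add, LinearMap.add_apply, hg, hg']; ring
    | hm b n =>
      have hs : Sl2.trForm a b = Sl2.trForm b a := Sl2.trForm_symm.eq a b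
      rw [cocycle_mono, cocycle_mono, add_comm n m, hs]
      split_ifs with h
      · obtain rfl : n = -m := by omega
        push_cast; ring
      · simp

theorem cocycle_lie (f g h : LoopSl2) :
    cocycle f ⁅g, h⁆ = cocycle ⁅f, g⁆ h + cocycle g ⁅f, h⁆ := by
  induction f using mono_induction with
  | h0 => simp only [map_zero, LinearMap.zero_apply, zero_lie, add_zero]
  | hadd f f' hf hf' =>
    simp only [map_add, LinearMap.add_apply, add_lie, hf, hf']; ring
  | hm a m =>
    induction g using mono_induction with
    | h0 => simp only [map_zero, LinearMap.zero_apply, zero_lie, lie_zero, add_zero]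
    | hadd g g' hg hg' =>
      simp only [map_add, LinearMap.add_apply, add_lie, lie_add, hg, hg']; ring
    | hm b n =>
      induction h using mono_induction with
      | h0 => simp only [map_zero, lie_zero, add_zero]
      | hadd h h' hh hh' => simp only [map_add, lie_add, hh, hh']; ring
      | hm c q =>
        have h1 : Sl2.trForm ⁅a, b⁆ c = -Sl2.trForm b ⁅a, c⁆ := Sl2.trForm_inv a b c
        have h2 : Sl2.trForm ⁅b, a⁆ c = -Sl2.trForm a ⁅b, c⁆ := Sl2.trForm_inv b a c
        have h3 : Sl2.trForm ⁅b, a⁆ c = -Sl2.trForm ⁅a, b⁆ c := by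
          rw [← lie_skew, map_neg, LinearMap.neg_apply]
        simp only [lie_mono, cocycle_mono]
        have e1 : m + (n + q) = m + n + q := by ring
        have e2 : n + (m + q) = m + n + q := by ring
        rw [e1, e2]
        split_ifs
        · push_cast
          linear_combination (m : ℂ) * h2 - (m : ℂ) * h3 - (n : ℂ) * h1
        · simp

end LoopSl2

/-- The affine Lie algebra `A₁⁽¹⁾ = sl₂(ℂ) ⊗ ℂ[t, t⁻¹] ⊕ ℂc ⊕ ℂd`. -/
@[ext]
structure AffineSl2 where
  /-- The component in the loop algebra. -/
  loop : LoopSl2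
  /-- The coefficient of the central element `c`. -/
  central : ℂ
  /-- The coefficient of the degree derivation `d = t d/dt`. -/
  der : ℂ

namespace AffineSl2

/-- The underlying vector space is a direct sum. -/
def toProd : AffineSl2 ≃ LoopSl2 × ℂ × ℂ where
  toFun x := (x.loop, x.central, x.der)
  invFun p := ⟨p.1, p.2.1, p.2.2⟩
  left_inv _ := rfl
  right_inv _ := rfl

instance : AddCommGroup AffineSl2 := toProd.addCommGroup

instance : Module ℂ AffineSl2 := toProd.module ℂ

@[simp] theorem loop_add (x y : AffineSl2) : (x + y).loop = x.loop + y.loop := rfl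
@[simp] theorem central_add (x y : AffineSl2) : (x + y).central = x.central + y.central := rfl
@[simp] theorem der_add (x y : AffineSl2) : (x + y).der = x.der + y.der := rfl
@[simp] theorem loop_smul (a : ℂ) (x : AffineSl2) : (a • x).loop = a • x.loop := rfl
@[simp] theorem central_smul (a : ℂ) (x : AffineSl2) : (a • x).central = a * x.central := rfl
@[simp] theorem der_smul (a : ℂ) (x : AffineSl2) : (a • x).der = a * x.der := rfl
@[simp] theorem loop_zero : (0 : AffineSl2).loop = 0 := rfl
@[simp] theorem central_zero : (0 : AffineSl2).central = 0 := rfl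
@[simp] theorem der_zero : (0 : AffineSl2).der = 0 := rfl

/-- `c` is central, `[d, f] = t f'(t)` and `[f, g]` is the loop bracket plus `cocycle f g • c`. -/
instance : Bracket AffineSl2 AffineSl2 where
  bracket x y := ⟨⁅x.loop, y.loop⁆ + x.der • LoopSl2.euler y.loop - y.der • LoopSl2.euler x.loop,
    LoopSl2.cocycle x.loop y.loop, 0⟩

theorem lie_def (x y : AffineSl2) : ⁅x, y⁆ =
    ⟨⁅x.loop, y.loop⁆ + x.der • LoopSl2.euler y.loop - y.der • LoopSl2.euler x.loop,
      LoopSl2.cocycle x.loop y.loop, 0⟩ := rfl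

instance : LieRing AffineSl2 where
  add_lie x y z := by
    ext1 <;> simp only [lie_def, loop_add, central_add, der_add, add_lie, map_add, add_smul,
      smul_add, LinearMap.add_apply, add_zero]
    abel
  lie_add x y z := by
    ext1 <;> simp only [lie_def, loop_add, central_add, der_add, lie_add, map_add, add_smul,
      smul_add, add_zero]
    abel
  lie_self x := by
    ext1
    · simp only [lie_def, lie_self, zero_add, sub_self, loop_zero]
    · have := LoopSl2.cocycle_skew x.loop x.loop
      simp only [lie_def, central_zero]
      linear_combination this / 2
    · rfl
  leibniz_lie x y z := by
    ext1
    · simp only [lie_def, loop_add, lie_add, lie_sub, add_lie, sub_lie, map_add, map_sub, map_smul,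
        LoopSl2.euler_lie, smul_add, smul_sub, lie_smul, smul_lie, zero_smul, sub_zero]
      rw [leibniz_lie x.loop y.loop z.loop,
        smul_comm x.der y.der, smul_comm x.der z.der, smul_comm y.der z.der,
        ← lie_skew (LoopSl2.euler x.loop) y.loop]
      simp only [smul_neg]
      abel
    · have h1 := LoopSl2.cocycle_lie x.loop y.loop z.loop
      have h2 := LoopSl2.cocycle_euler y.loop z.loop
      have h3 := LoopSl2.cocycle_euler x.loop z.loop
      have h4 := LoopSl2.cocycle_euler x.loop y.loop
      have h5 := LoopSl2.cocycle_skew y.loop (LoopSl2.euler x.loop)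
      simp only [lie_def, central_add, map_add, map_sub, map_smul, LinearMap.add_apply,
        LinearMap.sub_apply, LinearMap.smul_apply, smul_eq_mul]
      linear_combination h1 - x.der * h2 + y.der * h3 - z.der * h4 + z.der * h5
    · simp only [lie_def, der_add, add_zero]

instance : LieAlgebra ℂ AffineSl2 where
  lie_smul a x y := by
    ext1
    · simp only [lie_def, loop_smul, der_smul, lie_smul, map_smul, smul_sub, smul_add, mul_smul]
      rw [smul_comm x.der a]
    · simp only [lie_def, loop_smul, central_smul, map_smul, smul_eq_mul]
    · simp only [lie_def, der_smul, mul_zero]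

/-- `a(m) = a ⊗ t^m`. -/
def mode (a : Sl2) (m : ℤ) : AffineSl2 := ⟨LoopSl2.mono a m, 0, 0⟩

/-- The central element. -/
def c : AffineSl2 := ⟨0, 1, 0⟩

/-- The degree derivation. -/
def d : AffineSl2 := ⟨0, 0, 1⟩

theorem lie_mode (a b : Sl2) (m n : ℤ) : ⁅mode a m, mode b n⁆ =
    mode ⁅a, b⁆ (m + n) + (if m + n = 0 then (m : ℂ) * Matrix.trace (a.1 * b.1) else 0) • c := by
  ext1
  · simp only [lie_def, mode, c, LoopSl2.lie_mono, loop_add, loop_smul, smul_zero, zero_smul,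
      add_zero, sub_zero]
  · simp only [lie_def, mode, c, LoopSl2.cocycle_mono, central_add, central_smul, mul_one, zero_add]
    rfl
  · simp only [lie_def, mode, c, der_add, der_smul, mul_zero, add_zero]

theorem lie_d_mode (a : Sl2) (m : ℤ) : ⁅d, mode a m⁆ = (m : ℂ) • mode a m := by
  ext1
  · simp [lie_def, mode, d, LoopSl2.euler_mono]
  · simp [lie_def, mode, d]
  · simp [lie_def, mode, d]

theorem lie_c (x : AffineSl2) : ⁅c, x⁆ = 0 := by
  ext1 <;> simp [lie_def, c]

end AffineSl2

namespace LatticeAlg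

/-- Multiplication by `e^{nα}`. -/
def shift (n : ℤ) : Module.End ℂ LatticeAlg :=
  LinearMap.mulLeft ℂ (AddMonoidAlgebra.single n (1 : ℂ))

/-- The operator `α(0)`: `e^{nα} ↦ ⟨α, nα⟩ e^{nα} = 2n e^{nα}`. -/
def alphaZero : Module.End ℂ LatticeAlg := diag fun n => 2 * (n : ℂ)

/-- The coefficient of `z^u` in the operator series `z^{qα}`, where
`z^{qα} e^{nα} = z^{⟨qα, nα⟩} e^{nα} = z^{2qn} e^{nα}`. -/
def zPow (q u : ℚ) : Module.End ℂ LatticeAlg := diag fun n => if 2 * q * n = u then 1 else 0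

/-- The degree operator on the group algebra at level `-k`:
`e^{nα} ↦ -⟨nα, nα⟩ / (2 (-k)) e^{nα} = (n² / k) e^{nα}`. -/
def degree (k : ℕ) : Module.End ℂ LatticeAlg := diag fun n => (n : ℂ) ^ 2 / k

end LatticeAlg

/-- The symmetric algebra `S(𝔥'⁻)`, with the variable `X n` standing for `H(-n)`, `n ≥ 1`. -/
abbrev Fock : Type := MvPolynomial ℕ+ ℂ

namespace Fock

/-- The action of `H(m)` on `S(𝔥'⁻)` at level `-k`: multiplication by `H(m)` for `m < 0`, zero for
`m = 0`, and `-2mk ∂/∂H(-m)` for `m > 0`. -/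
def heis (k : ℕ) : ℤ → Module.End ℂ Fock
  | .ofNat 0 => 0
  | .ofNat (n + 1) => (-2 * ((n : ℂ) + 1) * k) • (MvPolynomial.pderiv n.succPNat).toLinearMap
  | .negSucc n => LinearMap.mulLeft ℂ (MvPolynomial.X n.succPNat)

/-- The degree operator on `S(𝔥'⁻)`: the derivation with `H(-n) ↦ -n H(-n)`. -/
def degree : Module.End ℂ Fock :=
  (MvPolynomial.mkDerivation ℂ fun n : ℕ+ => (-(n : ℕ) : ℂ) • (MvPolynomial.X n : Fock)).toLinearMap

/-- The exponential `∑_j f^j / j!` of an operator valued power series `f` without constant term;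
then `f^j` starts in order `j`, so only `j ≤ p` contribute to the coefficient of order `p`. -/
def expSeries (f : PowerSeries (Module.End ℂ Fock)) : PowerSeries (Module.End ℂ Fock) :=
  PowerSeries.mk fun p => ∑ j ∈ Finset.range (p + 1),
    ((j.factorial : ℂ)⁻¹) • PowerSeries.coeff p (f ^ j)

/-- `E₊^±(z) = exp(∓ ∑_{n>0} H(-n) z^n / (k n))` as a power series in `z`, with `ε = ±1`. -/
def Eplus (k : ℕ) (ε : ℤ) : PowerSeries (Module.End ℂ Fock) :=
  expSeries (PowerSeries.mk fun n => if n = 0 then 0 else (-(ε : ℂ) / (k * n)) • heis k (-n))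

/-- `E₋^±(z) = exp(± ∑_{n>0} H(n) z^{-n} / (k n))` as a power series in `z⁻¹`, with `ε = ±1`. -/
def Eminus (k : ℕ) (ε : ℤ) : PowerSeries (Module.End ℂ Fock) :=
  expSeries (PowerSeries.mk fun n => if n = 0 then 0 else ((ε : ℂ) / (k * n)) • heis k n)

/-- The weight of a monomial, where `X n` has weight `n`. -/
def wt (d : ℕ+ →₀ ℕ) : ℕ := d.sum fun n e => e * n

/-- Polynomials all of whose monomials have weight at most `N`. -/
def bounded (N : ℤ) : Submodule ℂ Fock where
  carrier := {p | ∀ d, MvPolynomial.coeff d p ≠ 0 → (wt d : ℤ) ≤ N}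
  zero_mem' d h := by simp at h
  add_mem' {p q} hp hq d h := by
    by_contra hc
    have h1 : MvPolynomial.coeff d p = 0 := by by_contra h'; exact hc (hp d h')
    have h2 : MvPolynomial.coeff d q = 0 := by by_contra h'; exact hc (hq d h')
    exact h (by rw [MvPolynomial.coeff_add, h1, h2, add_zero])
  smul_mem' a p hp d h := hp d fun h' => h (by rw [MvPolynomial.coeff_smul, h', smul_zero])

theorem exists_bounded (p : Fock) : ∃ N : ℕ, p ∈ bounded N := by
  refine ⟨p.support.sup wt, fun d hd => ?_⟩
  exact_mod_cast Finset.le_sup (f := wt) (MvPolynomial.mem_support_iff.mpr hd)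

theorem eq_zero_of_bounded {N : ℤ} (hN : N < 0) {p : Fock} (hp : p ∈ bounded N) : p = 0 := by
  ext d
  by_contra h
  have := hp d (by simpa using h)
  omega

theorem heis_bounded (k n : ℕ) (N : ℤ) {p : Fock} (hp : p ∈ bounded N) :
    heis k n p ∈ bounded (N - n) := by
  cases n with
  | zero => exact (bounded _).zero_mem
  | succ n =>
    refine (bounded _).smul_mem _ fun d hd => ?_
    have h1 : MvPolynomial.coeff (d + Finsupp.single n.succPNat 1) p ≠ 0 := by
      intro h
      apply hd
      change MvPolynomial.coeff d (MvPolynomial.pderiv n.succPNat p) = 0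
      rw [MvPolynomial.coeff_pderiv, h]
      simp
    have h2 := hp _ h1
    have h3 : wt (d + Finsupp.single n.succPNat 1) = wt d + (n + 1) := by
      rw [wt, Finsupp.sum_add_index' (by simp) (by intros; ring), Finsupp.sum_single_index (by simp)]
      simp [wt]
    rw [h3] at h2
    push_cast at h2 ⊢
    omega

/-- The coefficient of order `n` lowers the weight by at least `n`. -/
def Lowering (f : PowerSeries (Module.End ℂ Fock)) : Prop :=
  ∀ (n : ℕ) (N : ℤ) (p : Fock), p ∈ bounded N → PowerSeries.coeff n f p ∈ bounded (N - n)

theorem Lowering.pow {f : PowerSeries (Module.End ℂ Fock)} (hf : Lowering f) (j : ℕ) :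
    Lowering (f ^ j) := by
  induction j with
  | zero =>
    intro n N p hp
    rw [pow_zero, PowerSeries.coeff_one]
    split_ifs with h
    · subst h; simpa using hp
    · exact (bounded _).zero_mem
  | succ j ih =>
    intro n N p hp
    rw [pow_succ, PowerSeries.coeff_mul, LinearMap.sum_apply]
    refine Submodule.sum_mem _ fun x hx => ?_
    have := ih x.1 _ _ (hf x.2 N p hp)
    have hx' : (x.1 : ℤ) + x.2 = n := by
      exact_mod_cast Finset.HasAntidiagonal.mem_antidiagonal.mp hx
    rwa [show N - (x.2 : ℤ) - x.1 = N - n by omega] at this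

theorem Eminus_lowering (k : ℕ) (ε : ℤ) : Lowering (Eminus k ε) := by
  intro n N p hp
  rw [Eminus, expSeries, PowerSeries.coeff_mk, LinearMap.sum_apply]
  refine Submodule.sum_mem _ fun j _ => (bounded _).smul_mem _ ?_
  refine Lowering.pow ?_ j n N p hp
  intro m M q hq
  rw [PowerSeries.coeff_mk]
  split_ifs with h
  · exact (bounded _).zero_mem
  · exact (bounded _).smul_mem _ (heis_bounded k m M hq)

theorem Eminus_locally_nilpotent (k : ℕ) (ε : ℤ) (p : Fock) :
    ∃ N : ℕ, ∀ n > N, PowerSeries.coeff n (Eminus k ε) p = 0 := by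
  obtain ⟨N, hN⟩ := exists_bounded p
  exact ⟨N, fun n hn => eq_zero_of_bounded (by omega) (Eminus_lowering k ε n N p hN)⟩

end Fock

/-- A family of operators is locally finite if only finitely many members are nonzero on each
vector. -/
def LocallyFiniteFamily {ι M : Type*} [AddCommGroup M] [Module ℂ M] (f : ι → Module.End ℂ M) :
    Prop :=
  ∀ v, (Function.support fun i => f i v).Finite

/-- The sum of a locally finite family of operators. -/
def LocallyFiniteFamily.sum {ι M : Type*} [AddCommGroup M] [Module ℂ M]
    {f : ι → Module.End ℂ M} (hf : LocallyFiniteFamily f) : Module.End ℂ M where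
  toFun v := ∑ᶠ i, f i v
  map_add' v w := by
    simp only [map_add]
    exact finsum_add_distrib (hf v) (hf w)
  map_smul' a v := by
    simp only [map_smul, RingHom.id_apply]
    exact (smul_finsum' a (hf v)).symm

/-- An operator series `A(z) = ∑_{r ∈ ℚ} A_r z^{-r}` is a field if the powers of `z` in `A(z) w` are
bounded below, for each vector `w`. -/
def IsFieldSeries {W : Type*} [AddCommGroup W] [Module ℂ W] (A : ℚ → Module.End ℂ W) : Prop :=
  ∀ w, ∃ N : ℚ, ∀ r > N, A r w = 0

/-- The coefficient of `z^{-r} w^{-t}` in `(z - w)^a A(z) B(w) v`, where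
`(z - w)^a = z^a (1 - w/z)^a` is expanded in nonnegative powers of `w`. -/
def opeCoeff {W : Type*} [AddCommGroup W] [Module ℂ W] (a : ℚ) (A B : ℚ → Module.End ℂ W)
    (r t : ℚ) (v : W) : W :=
  ∑ᶠ l : ℕ, (((-1) ^ l * Ring.choose a l : ℚ) : ℂ) • A (r + a - l) (B (t + l) v)

/-- The coefficient of `z^{-r} w^{-t}` in `(z - w)² G(z, w)`, given the coefficients `G r t` of
`z^{-r} w^{-t}` in `G(z, w)`. -/
def mulSqSub {W : Type*} [AddCommGroup W] [Module ℂ W] (G : ℚ → ℚ → W) (r t : ℚ) : W :=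
  G (r + 2) t - (2 : ℂ) • G (r + 1) (t + 1) + G r (t + 2)

/-- A space `W` of parafermions of `sl₂` at level `-k`: a space of states carrying charges in `ℤα`,
with the two parafermion fields `A(z) = A_α(z)` and `A*(z) = A*_{-α}(z)`, which are subject to the
operator product expansions
* `A(z) A(w) (z-w)^{-2/k} = :A(z) A(w):`, and the same for `A*`,
* `A(z) A*(w) (z-w)^{2/k} = -k z w / (z-w)² + :A(z) A*(w):`,

where the normal ordered products are regular at `z = w` and do not depend on the order of the two
fields. The products of fields are formal series with rational exponents. The product with `z` on
the left is expanded in nonnegative powers of `w/z` (the region `|z| > |w|`), the product with `w` on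
the left in nonnegative powers of `z/w` (the region `|w| > |z|`). Fractional powers of `w - z` are
written `(w-z)^a = w^a (1 - z/w)^a` in the latter. -/
structure ParafermionSpace (k : ℕ) (W : Type*) [AddCommGroup W] [Module ℂ W] where
  /-- The states of charge `nα`. Only `nα` modulo `kα` is visible to the fields, so that the charge
  subspaces need not be independent: both a grading by `ℤ` and one by `ℤ/k` (that is, a `k`-periodic
  family) are allowed. -/
  charge : ℤ → Submodule ℂ W
  charge_span : ⨆ n, charge n = ⊤
  /-- `A r` is the coefficient of `z^{-r}` in the parafermion field `A_α(z)`. -/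
  A : ℚ → Module.End ℂ W
  /-- `Astar r` is the coefficient of `z^{-r}` in the parafermion field `A*_{-α}(z)`. -/
  Astar : ℚ → Module.End ℂ W
  A_field : IsFieldSeries A
  Astar_field : IsFieldSeries Astar
  /-- `A_α(z)` has charge `α`. -/
  A_charge : ∀ (n : ℤ) (r : ℚ), ∀ w ∈ charge n, A r w ∈ charge (n + 1)
  /-- `A*_{-α}(z)` has charge `-α`. -/
  Astar_charge : ∀ (n : ℤ) (r : ℚ), ∀ w ∈ charge n, Astar r w ∈ charge (n - 1)
  /-- On states of charge `λ = nα`, the exponents of `z` in `A_α(z)` lie in `⟨α, λ⟩/k + ℤ`. -/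
  A_exponent : ∀ (n : ℤ) (r : ℚ), ∀ w ∈ charge n,
    A r w ≠ 0 → ∃ i : ℤ, -r = 2 * n / k + i
  /-- On states of charge `λ = nα`, the exponents of `z` in `A*_{-α}(z)` lie in `⟨-α, λ⟩/k + ℤ`. -/
  Astar_exponent : ∀ (n : ℤ) (r : ℚ), ∀ w ∈ charge n,
    Astar r w ≠ 0 → ∃ i : ℤ, -r = -(2 * n / k) + i
  /-- `A(z) A(w) (z-w)^{-2/k} = A(w) A(z) (w-z)^{-2/k}`: there is no contraction, and the normal
  ordered product is symmetric. -/
  A_A : ∀ (r t : ℚ) (w : W),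
    opeCoeff (-2 / k) A A r t w = opeCoeff (-2 / k) A A t r w
  /-- `A*(z) A*(w) (z-w)^{-2/k} = A*(w) A*(z) (w-z)^{-2/k}`. -/
  Astar_Astar : ∀ (r t : ℚ) (w : W),
    opeCoeff (-2 / k) Astar Astar r t w = opeCoeff (-2 / k) Astar Astar t r w
  /-- Both `A(z) A*(w) (z-w)^{2/k}` and `A*(w) A(z) (w-z)^{2/k}` are expansions of one function
  with at most a double pole at `z = w`: they agree after multiplication by `(z-w)²`. -/
  A_Astar : ∀ (r t : ℚ) (w : W),
    mulSqSub (fun r t => opeCoeff (2 / k) A Astar r t w) r t =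
      mulSqSub (fun r t => opeCoeff (2 / k) Astar A t r w) r t
  /-- The contraction is `-k z w / (z-w)²`, that is
  `P(z, w) := (z-w)² A(z) A*(w) (z-w)^{2/k} = -k z w + O((z-w)²)`: here the value at `z = w`,
  `P(w, w) = -k w²`. (The sum over `r` is finite, by `A_field`, `Astar_field`, `A_Astar`.) -/
  contraction : ∀ (m : ℚ) (w : W),
    ∑ᶠ r : ℚ, mulSqSub (fun r t => opeCoeff (2 / k) A Astar r t w) r (m - r) =
      if m = -2 then (-(k : ℂ)) • w else 0
  /-- The first order part of `P(z, w) = -k z w + O((z-w)²)`: `(z ∂_z P)(w, w) = -k w²`. -/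
  contraction_deriv : ∀ (m : ℚ) (w : W),
    ∑ᶠ r : ℚ, (-(r : ℂ)) • mulSqSub (fun r t => opeCoeff (2 / k) A Astar r t w) r (m - r) =
      if m = -2 then (-(k : ℂ)) • w else 0
  /-- The degree operator of `W` (minus the conformal weight). -/
  degree : Module.End ℂ W
  degree_charge : ∀ (n : ℤ), ∀ w ∈ charge n, degree w ∈ charge n
  /-- The field `z⁻¹ A_α(z)` is homogeneous of conformal dimension `⟨α, α⟩/(2k) + 1 = 1/k + 1`. -/
  degree_A : ∀ (r : ℚ) (w : W),
    degree (A r w) - A r (degree w) = ((r : ℂ) - 1 / k) • A r w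
  /-- The field `z⁻¹ A*_{-α}(z)` is homogeneous of conformal dimension `1/k + 1`. -/
  degree_Astar : ∀ (r : ℚ) (w : W),
    degree (Astar r w) - Astar r (degree w) = ((r : ℂ) - 1 / k) • Astar r w

/-- The tensor product `S(𝔥'⁻) ⊗ W ⊗ ℂ(ℤα)`. -/
def TriTensor (W : Type*) [AddCommGroup W] [Module ℂ W] : Type _ :=
  Fock ⊗[ℂ] (W ⊗[ℂ] LatticeAlg)

namespace TriTensor

variable {W : Type*} [AddCommGroup W] [Module ℂ W]

instance : AddCommGroup (TriTensor W) :=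
  inferInstanceAs (AddCommGroup (Fock ⊗[ℂ] (W ⊗[ℂ] LatticeAlg)))

instance : Module ℂ (TriTensor W) :=
  inferInstanceAs (Module ℂ (Fock ⊗[ℂ] (W ⊗[ℂ] LatticeAlg)))

/-- The vector `s ⊗ w ⊗ e^{nα}`. -/
def tmul (s : Fock) (w : W) (n : ℤ) : TriTensor W :=
  s ⊗ₜ[ℂ] (w ⊗ₜ[ℂ] (AddMonoidAlgebra.single n (1 : ℂ) : LatticeAlg))

theorem raw_induction {p : Fock ⊗[ℂ] (W ⊗[ℂ] LatticeAlg) → Prop} (h0 : p 0)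
    (hadd : ∀ x y, p x → p y → p (x + y))
    (ht : ∀ (s : Fock) (w : W) (n : ℤ),
      p (s ⊗ₜ[ℂ] (w ⊗ₜ[ℂ] (AddMonoidAlgebra.single n (1 : ℂ) : LatticeAlg))))
    (x : Fock ⊗[ℂ] (W ⊗[ℂ] LatticeAlg)) : p x := by
  induction x using TensorProduct.induction_on with
  | zero => exact h0
  | add x y hx hy => exact hadd x y hx hy
  | tmul s y =>
    induction y using TensorProduct.induction_on with
    | zero => rw [TensorProduct.tmul_zero]; exact h0
    | add x y hx hy => rw [TensorProduct.tmul_add]; exact hadd _ _ hx hy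
    | tmul w g =>
      have hg : g ∈ Submodule.span ℂ (Set.range (AddMonoidAlgebra.basis ℤ ℂ)) := by
        rw [(AddMonoidAlgebra.basis ℤ ℂ).span_eq]; trivial
      induction hg using Submodule.span_induction generalizing w with
      | zero => rw [TensorProduct.tmul_zero, TensorProduct.tmul_zero]; exact h0
      | add x y _ _ hx hy =>
        rw [TensorProduct.tmul_add, TensorProduct.tmul_add]; exact hadd _ _ (hx w) (hy w)
      | smul c x _ hx => rw [← TensorProduct.smul_tmul]; exact hx _
      | mem g hg =>
        obtain ⟨n, rfl⟩ := hg
        rw [AddMonoidAlgebra.basis_apply]; exact ht s w n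

theorem tensor_induction {p : TriTensor W → Prop} (h0 : p 0) (hadd : ∀ x y, p x → p y → p (x + y))
    (ht : ∀ s w n, p (tmul s w n)) (x : TriTensor W) : p x :=
  raw_induction (p := p) h0 hadd ht x

/-- The operator `f ⊗ g ⊗ h`. -/
def op (f : Module.End ℂ Fock) (g : Module.End ℂ W) (h : Module.End ℂ LatticeAlg) :
    Module.End ℂ (TriTensor W) :=
  TensorProduct.map f (TensorProduct.map g h)

theorem op_tmul (f : Module.End ℂ Fock) (g : Module.End ℂ W) (h : Module.End ℂ LatticeAlg)
    (s : Fock) (w : W) (n : ℤ) : op f g h (tmul s w n) =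
      (f s ⊗ₜ[ℂ] (g w ⊗ₜ[ℂ] h (AddMonoidAlgebra.single n 1)) :
        Fock ⊗[ℂ] (W ⊗[ℂ] LatticeAlg)) := rfl

theorem op_tmul_eq_zero (f : Module.End ℂ Fock) (g : Module.End ℂ W) (h : Module.End ℂ LatticeAlg)
    (s : Fock) (w : W) (n : ℤ)
    (H : f s = 0 ∨ g w = 0 ∨ h (AddMonoidAlgebra.single n 1) = 0) : op f g h (tmul s w n) = 0 := by
  rw [op_tmul]
  rcases H with H | H | H <;> rw [H]
  · exact TensorProduct.zero_tmul _ _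
  · rw [TensorProduct.zero_tmul]; exact TensorProduct.tmul_zero _ _
  · rw [TensorProduct.tmul_zero]; exact TensorProduct.tmul_zero _ _

/-- The summands of the coefficient of `z^{-r}` in
`E₊^±(z) E₋^±(z) ⊗ A(z) ⊗ e^{±α} z^{∓α/k}`: the powers `z^p`, `z^{-q}`, `z^{-(r+p-q+u)}`, `z^u` are
taken from `E₊^±(z)`, `E₋^±(z)`, `A(z)`, `z^{∓α/k}`, respectively. -/
def summand (k : ℕ) (ε : ℤ) (A : ℚ → Module.End ℂ W) (r : ℚ) (x : ℕ × ℕ × ℚ) :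
    Module.End ℂ (TriTensor W) :=
  op (PowerSeries.coeff x.1 (Fock.Eplus k ε) * PowerSeries.coeff x.2.1 (Fock.Eminus k ε))
    (A (r + x.1 - x.2.1 + x.2.2)) (LatticeAlg.shift ε * LatticeAlg.zPow (-ε / k) x.2.2)

theorem summand_locallyFinite (k : ℕ) (ε : ℤ) {A : ℚ → Module.End ℂ W} (hA : IsFieldSeries A) (r : ℚ) :
    LocallyFiniteFamily (summand k ε A r) := by
  intro v
  induction v using tensor_induction with
  | h0 => simp
  | hadd x y hx hy =>
    simp only [map_add]
    exact (hx.union hy).subset (Function.support_add _ _)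
  | ht s w n =>
    obtain ⟨Q, hQ⟩ := Fock.Eminus_locally_nilpotent k ε s
    obtain ⟨N, hN⟩ := hA w
    set u₀ : ℚ := 2 * (-ε / k) * n with hu
    obtain ⟨M, hM⟩ := exists_nat_gt (N - r + Q - u₀)
    refine ((Set.finite_Iic M).prod ((Set.finite_Iic Q).prod
      (Set.finite_singleton u₀))).subset ?_
    rintro ⟨p, q, u⟩ hx
    have hu' : u = u₀ := by
      by_contra h
      refine hx (op_tmul_eq_zero _ _ _ _ _ _ (Or.inr (Or.inr ?_)))
      rw [Module.End.mul_apply, LatticeAlg.zPow, LatticeAlg.diag_single,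
        if_neg (fun h' => h (Eq.trans (Eq.symm h') (Eq.symm hu))), zero_smul, map_zero]
    have hq : q ≤ Q := by
      by_contra h
      refine hx (op_tmul_eq_zero _ _ _ _ _ _ (Or.inl ?_))
      rw [Module.End.mul_apply, hQ q (by omega), map_zero]
    have hp : p ≤ M := by
      by_contra h
      refine hx (op_tmul_eq_zero _ _ _ _ _ _ (Or.inr (Or.inl ?_)))
      have h1 : (M : ℚ) ≤ p := by exact_mod_cast (by omega : M ≤ p)
      have h2 : (q : ℚ) ≤ Q := by exact_mod_cast hq
      exact hN _ (by subst hu'; simp only; linarith)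
    exact ⟨hp, hq, hu'⟩

/-- The coefficient of `z^{-r}` in `E₊^±(z) E₋^±(z) ⊗ A(z) ⊗ e^{±α} z^{∓α/k}`, with `ε = ±1`. -/
def vertex (k : ℕ) (ε : ℤ) {A : ℚ → Module.End ℂ W} (hA : IsFieldSeries A) (r : ℚ) :
    Module.End ℂ (TriTensor W) :=
  (summand_locallyFinite k ε hA r).sum

/-- The coefficient of `z^{-m}` in `H(z)`: the Heisenberg operator `H(m) ⊗ 1 ⊗ 1` for `m ≠ 0`, and
`H(0) = 1 ⊗ 1 ⊗ α(0)`. -/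
def H (k : ℕ) (m : ℤ) : Module.End ℂ (TriTensor W) :=
  op (Fock.heis k m) 1 1 + if m = 0 then op 1 1 LatticeAlg.alphaZero else 0

end TriTensor

namespace ParafermionSpace

variable {k : ℕ} {W : Type*} [AddCommGroup W] [Module ℂ W] (P : ParafermionSpace k W)

/-- The space `V`: the span of the vectors `s ⊗ w ⊗ e^{nα}` in `S(𝔥'⁻) ⊗ W ⊗ ℂ(ℤα)` for which `w`
has charge `nα`. -/
def V : Submodule ℂ (TriTensor W) :=
  Submodule.span ℂ {x | ∃ (s : Fock) (n : ℤ), ∃ w ∈ P.charge n,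
    x = TriTensor.tmul s w n}

/-- The coefficient of `z^{-r}` in `E₊⁺(z) E₋⁺(z) ⊗ A_α(z) e^α z^{-α/k}`. -/
def X (r : ℚ) : Module.End ℂ (TriTensor W) := TriTensor.vertex k 1 P.A_field r

/-- The coefficient of `z^{-r}` in `E₊⁻(z) E₋⁻(z) ⊗ A*_{-α}(z) e^{-α} z^{α/k}`. -/
def Y (r : ℚ) : Module.End ℂ (TriTensor W) := TriTensor.vertex k (-1) P.Astar_field r

/-- The degree operator `deg` on `S(𝔥'⁻) ⊗ W ⊗ ℂ(ℤα)`. -/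
def totalDegree : Module.End ℂ (TriTensor W) :=
  TriTensor.op Fock.degree 1 1 + TriTensor.op 1 P.degree 1 +
    TriTensor.op 1 1 (LatticeAlg.degree k)

end ParafermionSpace
end

-- The commutator bracket on an associative ring, here on `Module.End ℂ V`.
attribute [local instance] LieRing.ofAssociativeRing

/-! The parafermion fields fail to be local only by a fractional power of z - w, and the Heisenberg
exponentials and the lattice factor supply the missing power. Take two vertex operators with signs
ε, δ. Moving E₋^ε(z) to the right past E₊^δ(w) produces (1 - w/z)^a with a = -2εδ/k, and z^{-εα/k}
acting after e^{δα} produces z^a. Together they give (z - w)^a, exactly the factor by which the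
axioms multiply a product of two parafermions. `vertex_vertex_tmul` is this statement for
coefficients: the product of two vertex operators is a finite sum of normally ordered exponentials
tensored with values of `opeCoeff`.

For equal signs the axioms make `opeCoeff` symmetric, so X(z) commutes with X(w) and Y(z) with Y(w)
(`vertex_comm_apply`). For opposite signs, two series that agree after multiplication by (z - w)²
differ by a combination of the delta function and its derivative, fixed by the value and the first
derivative of -kzw on the diagonal; `contraction_apply` evaluates this difference as -kR on the
antidiagonal R + T = 0. Weighted by this linear function, the normally ordered product of E⁺(z) and
E⁻(w) contributes its value at z = w, which is 1, and its logarithmic derivative, which is the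
nonzero part of H(z). With the lattice exponent 2n/k supplying α(0), this yields [X(r), Y(t)] = H(r
+ t) - k r δ_{r+t,0} (`finsum_normalOrdered`, `X_lie_Y_apply_tmul`).

The commutators with H(m) and with the degree operator follow from those of the exponentials. All
identities between exponentials are proved by one device: the coefficients satisfy the recursion
coming from zE' = (zf')E, and a solution of this recursion is determined by its values at
nonpositive indices (`ExpRecursion.eq_zero`).

Finally, operators obeying the mode relations define a representation (`AffineModes.toLieHom`). It
is unique already as a linear map, because the modes of X, Y, H together with c and d span the
affine algebra. -/

namespace PowerSeries

/-! ### Power series over a noncommutative ring -/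

variable {R : Type*} [Ring R]

/-- The Euler derivation `z d/dz` on power series over a ring that need not be commutative. -/
noncomputable def eulerDeriv (f : PowerSeries R) : PowerSeries R := mk fun n => n • coeff n f

theorem eulerDeriv_mul (f g : PowerSeries R) :
    eulerDeriv (f * g) = eulerDeriv f * g + f * eulerDeriv g := by
  ext n
  simp only [eulerDeriv, coeff_mk, coeff_mul, map_add, Finset.smul_sum, ← Finset.sum_add_distrib]
  refine Finset.sum_congr rfl fun x hx => ?_
  rw [← Finset.HasAntidiagonal.mem_antidiagonal.mp hx, add_smul, smul_mul_assoc, mul_smul_comm]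

theorem commute_of_coeff {f g : PowerSeries R} (h : ∀ i j, Commute (coeff i f) (coeff j g)) :
    Commute f g := by
  ext n
  rw [coeff_mul, coeff_mul, ← Finset.Nat.sum_antidiagonal_swap]
  exact Finset.sum_congr rfl fun x _ => h _ _

/-- The Leibniz rule holds over any ring; commuting coefficients are what allows the differentiated
factor to be moved to the front of each term. -/
theorem eulerDeriv_pow_succ {f : PowerSeries R} (h : ∀ i j, Commute (coeff i f) (coeff j f))
    (j : ℕ) : eulerDeriv (f ^ (j + 1)) = (j + 1) • (eulerDeriv f * f ^ j) := by
  have hc : Commute f (eulerDeriv f) := commute_of_coeff fun i j => by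
    rw [eulerDeriv, coeff_mk]
    exact (h i j).smul_right j
  induction j with
  | zero => simp
  | succ j ih =>
    rw [pow_succ' f (j + 1), eulerDeriv_mul, ih, mul_smul_comm, ← mul_assoc, hc.eq, mul_assoc,
      ← pow_succ' f j, succ_nsmul' _ (j + 1)]

theorem coeff_pow_eq_zero {f : PowerSeries R} (h0 : coeff 0 f = 0) (j b : ℕ) (hb : b < j) :
    coeff b (f ^ j) = 0 := by
  induction j generalizing b with
  | zero => omega
  | succ j ih =>
    rw [pow_succ', coeff_mul]
    refine Finset.sum_eq_zero fun x hx => ?_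
    have hx' := Finset.HasAntidiagonal.mem_antidiagonal.mp hx
    rcases Nat.eq_zero_or_pos x.1 with h | h
    · rw [h, h0, zero_mul]
    · rw [ih x.2 (by omega), mul_zero]

/-- The coefficients of a power series, extended by zero to negative indices. -/
noncomputable def coeffInt (f : PowerSeries R) (n : ℤ) : R := if 0 ≤ n then coeff n.toNat f else 0

theorem coeffInt_natCast (f : PowerSeries R) (n : ℕ) : coeffInt f n = coeff n f := by
  simp [coeffInt]

theorem coeffInt_of_neg (f : PowerSeries R) {n : ℤ} (hn : n < 0) : coeffInt f n = 0 := by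
  rw [coeffInt, if_neg (by omega)]

end PowerSeries

/-! ### The recursion characterising an exponential series -/

/-- The recursion `n Eₙ = ∑_{i>0} gᵢ Eₙ₋ᵢ` (with `g i` standing for the coefficient of order `i + 1`)
satisfied by the coefficients of the exponential of `∑_{i>0} gᵢ zⁱ / i`. -/
def ExpRecursion {R : Type*} [Ring R] [Algebra ℂ R] (g : ℕ → R) (E : ℤ → R) : Prop :=
  ∀ (N : ℕ) (n : ℤ), n ≤ N → (n : ℂ) • E n = ∑ i ∈ Finset.range N, g i * E (n - (i + 1))

namespace ExpRecursion

variable {R : Type*} [Ring R] [Algebra ℂ R] {g : ℕ → R} {E : ℤ → R}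

/-- Uniqueness of solutions: for n > 0 the recursion expresses n · E n through earlier values, and n
is invertible in ℂ. As the recursion is linear in `E`, two expressions agree once both satisfy it
and they coincide at indices n ≤ 0. -/
theorem eq_zero (h : ExpRecursion g E) (h0 : ∀ n ≤ 0, E n = 0) (n : ℤ) : E n = 0 := by
  suffices H : ∀ N : ℕ, ∀ n : ℤ, n ≤ N → E n = 0 from H n.toNat n (by omega)
  intro N
  induction N with
  | zero => intro n hn; exact h0 n (by simpa using hn)
  | succ N ih =>
    intro n hn
    by_cases hn0 : n ≤ 0
    · exact h0 n hn0
    have h1 := h (N + 1) n (by exact_mod_cast hn)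
    rw [Finset.sum_eq_zero fun i _ => by rw [ih _ (by push_cast at hn; omega), mul_zero]] at h1
    exact (smul_eq_zero.mp h1).resolve_left (by exact_mod_cast (by omega : n ≠ 0))

theorem sub {E' : ℤ → R} (h : ExpRecursion g E) (h' : ExpRecursion g E') :
    ExpRecursion g (fun n => E n - E' n) := fun N n hn => by
  simp only [smul_sub, mul_sub, Finset.sum_sub_distrib, h N n hn, h' N n hn]

theorem mul_right (h : ExpRecursion g E) (T : R) : ExpRecursion g (fun n => E n * T) :=
  fun N n hn => by
    rw [← smul_mul_assoc, h N n hn, Finset.sum_mul]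
    exact Finset.sum_congr rfl fun _ _ => mul_assoc _ _ _

theorem mul_left (h : ExpRecursion g E) {T : R} (hT : ∀ i, Commute T (g i)) :
    ExpRecursion g (fun n => T * E n) :=
  fun N n hn => by
    rw [← mul_smul_comm, h N n hn, Finset.mul_sum]
    exact Finset.sum_congr rfl fun i _ => by rw [← mul_assoc, (hT i).eq, mul_assoc]

/-- An operator that commutes with the exponent commutes with the exponential. -/
theorem commute (h : ExpRecursion g E) (h0 : E 0 = 1) (hneg : ∀ n < 0, E n = 0) {T : R}
    (hT : ∀ i, Commute T (g i)) (n : ℤ) : Commute T (E n) := by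
  refine sub_eq_zero.mp (eq_zero ((h.mul_left hT).sub (h.mul_right T)) (fun n hn => ?_) n)
  rcases hn.lt_or_eq with hn | rfl
  · simp [hneg n hn]
  · simp [h0]

/-- If the commutator of `T` with the exponent is the monomial `c m zᵐ / m`, then `[T, E] = c zᵐ E`. -/
theorem commutator (h : ExpRecursion g E) (h0 : E 0 = 1) (hneg : ∀ n < 0, E n = 0) {T : R} (m : ℕ)
    (c : ℂ) (hT : ∀ i, T * g i - g i * T = if i = m then (c * (m + 1)) • (1 : R) else 0) (n : ℤ) :
    T * E n - E n * T = c • E (n - (m + 1)) := by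
  refine sub_eq_zero.mp (eq_zero (g := g)
    (E := fun n => T * E n - E n * T - c • E (n - (m + 1))) (fun N n hn => ?_) (fun n hn => ?_) n)
  -- The truncation bound in `ExpRecursion` is arbitrary above n. The choice N + m + 1 serves the
  -- recursions at n and at n - (m + 1) alike and makes the index i = m occur in the sum, where the
  -- commutator with the exponent is nonzero.
  · have h1 := h (N + m + 1) n (by push_cast; omega)
    have h2 := h (N + m + 1) (n - (m + 1)) (by push_cast; omega)
    have hext : ∑ i ∈ Finset.range N, g i * (T * E (n - (i + 1)) - E (n - (i + 1)) * T
        - c • E (n - (i + 1) - (m + 1))) =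
        ∑ i ∈ Finset.range (N + m + 1), g i * (T * E (n - (i + 1)) - E (n - (i + 1)) * T
        - c • E (n - (i + 1) - (m + 1))) := by
      refine Finset.sum_subset (Finset.range_mono (by omega)) fun i _ hi => ?_
      rw [Finset.mem_range, not_lt] at hi
      have hi' : n - ((i : ℤ) + 1) < 0 := by omega
      rw [hneg _ hi', hneg _ (by omega)]; simp
    have h3 : (n : ℂ) • (T * E n - E n * T) = ∑ i ∈ Finset.range (N + m + 1),
        (g i * (T * E (n - (i + 1)) - E (n - (i + 1)) * T) +
          (if i = m then (c * (m + 1)) • (1 : R) else 0) * E (n - (i + 1))) := by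
      rw [smul_sub, ← mul_smul_comm, ← smul_mul_assoc, h1, Finset.mul_sum, Finset.sum_mul,
        ← Finset.sum_sub_distrib]
      refine Finset.sum_congr rfl fun i _ => ?_
      rw [← hT i]; noncomm_ring
    rw [hext, smul_sub, h3, Finset.sum_add_distrib]
    simp only [ite_mul, zero_mul, Finset.sum_ite_eq', smul_one_mul]
    rw [if_pos (Finset.mem_range.mpr (by omega)), smul_comm,
      show (n : ℂ) • E (n - (m + 1)) = ((n - (m + 1) : ℤ) : ℂ) • E (n - (m + 1)) +
        ((m : ℂ) + 1) • E (n - (m + 1)) by rw [← add_smul]; push_cast; ring_nf, h2]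
    simp only [mul_sub, Finset.sum_sub_distrib, mul_smul_comm, ← Finset.smul_sum, smul_add, mul_smul,
      sub_right_comm n]
    abel
  · have : E (n - (m + 1)) = 0 := hneg _ (by omega)
    rcases hn.lt_or_eq with hn | rfl
    · simp [hneg n hn, this]
    · rw [this]; simp [h0]

/-- If `T` is a derivation for the exponent then it is one for the exponential. -/
theorem derivation (h : ExpRecursion g E) (h0 : E 0 = 1) (hneg : ∀ n < 0, E n = 0) {T : R}
    (c : ℂ) (hT : ∀ i : ℕ, T * g i - g i * T = (c * (i + 1)) • g i) (n : ℤ) :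
    T * E n - E n * T = (c * n) • E n := by
  refine sub_eq_zero.mp (eq_zero (g := g)
    (E := fun n => T * E n - E n * T - (c * n) • E n) (fun N n hn => ?_) (fun n hn => ?_) n)
  · rw [smul_sub, smul_sub, ← mul_smul_comm, ← smul_mul_assoc, smul_comm (n : ℂ), h N n hn,
      Finset.mul_sum, Finset.sum_mul, Finset.smul_sum, ← Finset.sum_sub_distrib,
      ← Finset.sum_sub_distrib]
    refine Finset.sum_congr rfl fun i _ => ?_
    rw [← mul_assoc T, eq_add_of_sub_eq (hT i)]
    push_cast
    simp only [mul_sub, add_mul, smul_mul_assoc, mul_smul_comm, mul_assoc]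
    module
  · rcases hn.lt_or_eq with hn | rfl
    · simp [hneg n hn]
    · simp [h0]

end ExpRecursion

/-! ### The recursion for `expSeries` and the Heisenberg operators on Fock space -/

namespace Fock

open PowerSeries in
-- The coefficient form of zE' = (zf')E, obtained by differentiating f^{j+1}/(j+1)! termwise. The
-- work lies in the truncations of the exponential sum, which depend on the order of the
-- coefficient.
theorem coeff_expSeries_succ {f : PowerSeries (Module.End ℂ Fock)} (h0 : coeff 0 f = 0)
    (hc : ∀ i j, Commute (coeff i f) (coeff j f)) (n : ℕ) :
    (n : ℂ) • coeff n (expSeries f) =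
      ∑ x ∈ Finset.HasAntidiagonal.antidiagonal n, ((x.1 : ℂ) • coeff x.1 f) * coeff x.2 (expSeries f) := by
  have key : ∀ j : ℕ, (n : ℂ) • coeff n (f ^ (j + 1)) = ((j : ℂ) + 1) •
      ∑ x ∈ Finset.HasAntidiagonal.antidiagonal n, ((x.1 : ℂ) • coeff x.1 f) * coeff x.2 (f ^ j) := by
    intro j
    have h := congrArg (coeff n) (eulerDeriv_pow_succ hc j)
    rw [map_nsmul, coeff_mul] at h
    simp only [eulerDeriv, coeff_mk, ← Nat.cast_smul_eq_nsmul ℂ] at h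
    push_cast at h
    exact h
  -- Since f^j has no terms below order j, all coefficients up to order n can be computed with the
  -- same truncation.
  have hext : ∀ b ≤ n, coeff b (expSeries f) =
      ∑ j ∈ Finset.range (n + 1), ((j.factorial : ℂ)⁻¹) • coeff b (f ^ j) := by
    intro b hb
    rw [expSeries, coeff_mk]
    refine Finset.sum_subset (Finset.range_mono (by omega)) fun j _ hj => ?_
    rw [coeff_pow_eq_zero h0 j b (by simpa using hj), smul_zero]
  -- Here j = n can be dropped: if x.1 = 0 the factor x.1 kills the term, and otherwise x.2 < n, so
  -- f^n has no coefficient of order x.2. The remaining range matches the j ≥ 1 terms of the left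
  -- side after the shift j ↦ j + 1.
  have hr : ∀ x ∈ Finset.HasAntidiagonal.antidiagonal n, ((x.1 : ℂ) • coeff x.1 f) * coeff x.2 (expSeries f) =
      ∑ j ∈ Finset.range n, ((j.factorial : ℂ)⁻¹) •
        (((x.1 : ℂ) • coeff x.1 f) * coeff x.2 (f ^ j)) := by
    intro x hx
    have hx' := Finset.HasAntidiagonal.mem_antidiagonal.mp hx
    rcases Nat.eq_zero_or_pos x.1 with h | h
    · simp [h]
    · rw [hext _ (by omega), Finset.sum_range_succ, coeff_pow_eq_zero h0 n x.2 (by omega), smul_zero,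
        add_zero, Finset.mul_sum]
      simp only [mul_smul_comm]
  rw [Finset.sum_congr rfl hr, Finset.sum_comm, hext n le_rfl, Finset.sum_range_succ', smul_add,
    Finset.smul_sum]
  have hz : (n : ℂ) • ((Nat.factorial 0 : ℂ)⁻¹) • coeff n (f ^ 0) = 0 := by
    rw [pow_zero, PowerSeries.coeff_one]
    split_ifs with h <;> simp [h]
  rw [hz, add_zero]
  refine Finset.sum_congr rfl fun j _ => ?_
  rw [smul_comm, key, smul_smul, ← Finset.smul_sum]
  congr 1
  rw [Nat.factorial_succ]
  push_cast
  have : (j : ℂ) + 1 ≠ 0 := by exact_mod_cast j.succ_ne_zero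
  field_simp

open PowerSeries in
theorem expRecursion_expSeries {f : PowerSeries (Module.End ℂ Fock)} (h0 : coeff 0 f = 0)
    (hc : ∀ i j, Commute (coeff i f) (coeff j f)) :
    ExpRecursion (fun i => ((i : ℂ) + 1) • coeff (i + 1) f) (coeffInt (expSeries f)) := by
  intro N n hn
  rcases lt_or_ge n 0 with hn0 | hn0
  · rw [coeffInt_of_neg _ hn0, smul_zero, Finset.sum_eq_zero]
    intro i _
    rw [coeffInt_of_neg _ (by omega), mul_zero]
  lift n to ℕ using hn0
  have hn' : n ≤ N := by exact_mod_cast hn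
  have h := coeff_expSeries_succ h0 hc n
  rw [Finset.Nat.sum_antidiagonal_eq_sum_range_succ_mk, Finset.sum_range_succ'] at h
  rw [coeffInt_natCast, Int.cast_natCast, h]
  simp only [Nat.cast_zero, zero_smul, zero_mul, add_zero]
  rw [← Finset.sum_subset (Finset.range_mono hn')]
  · refine Finset.sum_congr rfl fun i hi => ?_
    have hi' := Finset.mem_range.mp hi
    rw [show (n : ℤ) - (i + 1) = ((n - (i + 1) : ℕ) : ℤ) by omega, coeffInt_natCast]
    push_cast; rfl
  · intro i _ hi
    rw [Finset.mem_range, not_lt] at hi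
    rw [coeffInt_of_neg _ (by omega), mul_zero]

theorem heis_succ (k n : ℕ) : heis k ((n : ℤ) + 1) =
    (-2 * ((n : ℂ) + 1) * k) • (MvPolynomial.pderiv n.succPNat).toLinearMap := rfl

theorem heis_neg_succ (k n : ℕ) : heis k (-((n : ℤ) + 1)) =
    LinearMap.mulLeft ℂ (MvPolynomial.X n.succPNat) := by
  rw [← Int.negSucc_eq]; rfl

theorem heis_zero (k : ℕ) : heis k 0 = 0 := rfl

theorem heis_pos_commute (k m n : ℕ) :
    Commute (heis k ((m : ℤ) + 1)) (heis k ((n : ℤ) + 1)) := by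
  rw [heis_succ, heis_succ]
  refine Commute.smul_left (Commute.smul_right ?_ _) _
  refine LinearMap.ext fun p => ?_
  -- The commutator of two derivations is a derivation, so it suffices to evaluate it on the
  -- variables.
  have h : ⁅MvPolynomial.pderiv (R := ℂ) m.succPNat, MvPolynomial.pderiv (R := ℂ) n.succPNat⁆ = 0 := by
    refine MvPolynomial.derivation_ext fun i => ?_
    simp [Derivation.commutator_apply, MvPolynomial.pderiv_X, Pi.single_apply, apply_ite]
  have := congrArg (fun D => D p) h
  simp only [Derivation.commutator_apply, Derivation.zero_apply, sub_eq_zero] at this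
  exact this

theorem heis_neg_commute (k m n : ℕ) :
    Commute (heis k (-((m : ℤ) + 1))) (heis k (-((n : ℤ) + 1))) := by
  rw [heis_neg_succ, heis_neg_succ]
  refine LinearMap.ext fun p => ?_
  simp only [Module.End.mul_apply, LinearMap.mulLeft_apply]
  ring

theorem heis_commutator (k m n : ℕ) :
    heis k ((m : ℤ) + 1) * heis k (-((n : ℤ) + 1)) - heis k (-((n : ℤ) + 1)) * heis k ((m : ℤ) + 1) =
      if n = m then (-2 * ((m : ℂ) + 1) * k) • (1 : Module.End ℂ Fock) else 0 := by
  rw [heis_succ, heis_neg_succ]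
  refine LinearMap.ext fun p => ?_
  simp only [LinearMap.sub_apply, Module.End.mul_apply, LinearMap.mulLeft_apply,
    LinearMap.smul_apply, Derivation.coeFn_coe, Derivation.leibniz,
    MvPolynomial.pderiv_X, Pi.single_apply, smul_eq_mul, Nat.succPNat_inj]
  split_ifs with h
  · subst h
    simp only [LinearMap.smul_apply, Module.End.one_apply, mul_one, smul_add, mul_smul_comm]
    abel
  · simp only [mul_zero, add_zero, mul_smul_comm, sub_self, LinearMap.zero_apply]

theorem degree_heis_neg (k n : ℕ) :
    degree * heis k (-((n : ℤ) + 1)) - heis k (-((n : ℤ) + 1)) * degree =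
      (-1 * ((n : ℂ) + 1)) • heis k (-((n : ℤ) + 1)) := by
  rw [heis_neg_succ]
  refine LinearMap.ext fun p => ?_
  simp only [degree, LinearMap.sub_apply, Module.End.mul_apply, LinearMap.mulLeft_apply,
    LinearMap.smul_apply, Derivation.coeFn_coe, Derivation.leibniz,
    MvPolynomial.mkDerivation_X, smul_eq_mul, Nat.succPNat_coe]
  rw [add_sub_cancel_left, mul_smul_comm, mul_comm p]
  push_cast
  congr 1
  ring

theorem degree_heis_pos (k n : ℕ) :
    degree * heis k ((n : ℤ) + 1) - heis k ((n : ℤ) + 1) * degree =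
      (1 * ((n : ℂ) + 1)) • heis k ((n : ℤ) + 1) := by
  rw [heis_succ]
  have h : ⁅MvPolynomial.mkDerivation ℂ fun n : ℕ+ => (-(n : ℕ) : ℂ) • (MvPolynomial.X n : Fock),
      MvPolynomial.pderiv (R := ℂ) n.succPNat⁆ = ((n : ℂ) + 1) • MvPolynomial.pderiv n.succPNat := by
    refine MvPolynomial.derivation_ext fun i => ?_
    simp only [Derivation.commutator_apply, MvPolynomial.pderiv_X, MvPolynomial.mkDerivation_X,
      Derivation.smul_apply, Pi.single_apply]
    split_ifs with h
    · subst h; simp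
      rw [← sub_eq_zero]; simp [add_smul]
    · simp [h]
  refine LinearMap.ext fun p => ?_
  have := congrArg (fun D => D p) h
  simp only [Derivation.commutator_apply, Derivation.smul_apply] at this
  simp only [degree, LinearMap.sub_apply, Module.End.mul_apply,
    LinearMap.smul_apply, Derivation.coeFn_coe, map_smul, one_mul]
  rw [← smul_sub, this, smul_comm]

end Fock

/-! ### Products of two exponentials: inverse, logarithmic derivative, reordering -/

theorem mul_smul_sub_smul_mul {R : Type*} [Ring R] [Algebra ℂ R] (a : ℂ) (T x : R) :
    T * a • x - a • x * T = a • (T * x - x * T) := by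
  rw [mul_smul_comm, smul_mul_assoc, smul_sub]

/-- Summation over a triangle, along lines parallel to its sides. -/
theorem sum_range_sum_shift {R : Type*} [Ring R] [Algebra ℂ R] (c : ℕ → ℂ) (F : ℕ → R) (N M : ℕ)
    (hN : ∀ j, N < j → F j = 0) (hM : ∀ j, M < j → F j = 0) :
    ∑ l ∈ Finset.range (N + 1), c l • ∑ i ∈ Finset.range M, F (l + i + 1) =
      ∑ L ∈ Finset.range (N + 1), (∑ j ∈ Finset.range L, c j) • F L := by
  have h1 : ∀ l ∈ Finset.range (N + 1), ∑ i ∈ Finset.range M, F (l + i + 1) =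
      ∑ L ∈ Finset.Ico (l + 1) (N + 1), F L := by
    intro l hl
    rw [Finset.sum_Ico_eq_sum_range]
    rw [Finset.sum_subset (Finset.range_mono (le_max_left M (N + 1 - (l + 1)))),
      Finset.sum_subset (Finset.range_mono (le_max_right M (N + 1 - (l + 1))))]
    · exact Finset.sum_congr rfl fun i _ => by rw [add_right_comm]
    · intro i _ hi
      rw [Finset.mem_range, not_lt] at hi
      exact hN _ (by omega)
    · intro i _ hi
      rw [Finset.mem_range, not_lt] at hi
      exact hM _ (by omega)
  rw [Finset.sum_congr rfl fun l hl => by rw [h1 l hl]]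
  simp only [Finset.smul_sum, Finset.sum_smul]
  refine Finset.sum_comm' fun l L => ?_
  simp only [Finset.mem_range, Finset.mem_Ico]
  omega

namespace ExpRecursion

variable {R : Type*} [Ring R] [Algebra ℂ R] {g : ℕ → R} {E E' : ℤ → R}

theorem hasFiniteSupport_mul (hneg : ∀ n < 0, E n = 0) (hneg' : ∀ n < 0, E' n = 0) (a b : ℤ)
    (c : ℤ → ℂ) : Function.HasFiniteSupport fun p : ℤ => c p • (E (p - a) * E' (b - p)) := by
  refine (Set.finite_Icc a b).subset fun p hp => ?_
  by_contra h
  rw [Set.mem_Icc, not_and_or, not_le, not_le] at h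
  refine hp ?_
  rcases h with h | h
  · simp [hneg (p - a) (by omega)]
  · simp [hneg' (b - p) (by omega)]

/-- In terms of series this is (zE')·F = (zf')·(E·F), where F is the second exponential and zE' is
expanded by the recursion. It reduces the logarithmic derivative to the product E·F itself. -/
theorem finsum_smul_mul_left (h : ExpRecursion g E) (hneg : ∀ n < 0, E n = 0)
    (hneg' : ∀ n < 0, E' n = 0) (N : ℕ) (i : ℤ) (hi : i ≤ N) :
    ∑ᶠ p : ℤ, (p : ℂ) • (E p * E' (i - p)) =
      ∑ j ∈ Finset.range N, g j * ∑ᶠ p : ℤ, E p * E' (i - (j + 1) - p) := by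
  have h1 : ∀ p : ℤ, (p : ℂ) • (E p * E' (i - p)) =
      ∑ j ∈ Finset.range N, g j * ((1 : ℂ) • (E (p - (j + 1)) * E' (i - p))) := by
    intro p
    rcases lt_or_ge i p with hp | hp
    · simp [hneg' (i - p) (by omega)]
    · rw [← smul_mul_assoc, h N p (by omega), Finset.sum_mul]
      exact Finset.sum_congr rfl fun j _ => by rw [one_smul, mul_assoc]
  have hf : ∀ j : ℕ, Function.HasFiniteSupport fun p : ℤ =>
      (1 : ℂ) • (E (p - ((j : ℤ) + 1)) * E' (i - p)) :=
    fun j => hasFiniteSupport_mul hneg hneg' _ _ _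
  rw [finsum_congr h1, finsum_sum_comm]
  · refine Finset.sum_congr rfl fun j _ => ?_
    refine (map_finsum (AddMonoidHom.mulLeft (g j)) (hf j)).symm.trans ?_
    simp only [one_smul, AddMonoidHom.coe_mulLeft]
    congr 1
    rw [← finsum_comp_equiv (Equiv.addRight ((j : ℤ) + 1))]
    refine finsum_congr fun p => ?_
    simp only [Equiv.coe_addRight, add_sub_cancel_right]
    congr 2; ring
  · intro j _
    refine (hf j).subset fun p hp => ?_
    rw [Function.mem_support] at hp ⊢
    intro h0
    exact hp (by rw [h0, mul_zero])

theorem finsum_mul_comm (hcomm : ∀ i j, Commute (E i) (E' j)) (c : ℤ → ℂ) (i : ℤ) :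
    ∑ᶠ p : ℤ, c p • (E p * E' (i - p)) = ∑ᶠ p : ℤ, c (i - p) • (E' p * E (i - p)) := by
  rw [← finsum_comp_equiv (Equiv.subLeft i)]
  refine finsum_congr fun p => ?_
  simp only [Equiv.subLeft_apply, sub_sub_cancel, (hcomm _ _).eq]

/-- The exponentials of `f` and `-f` are inverse to each other. -/
theorem finsum_mul_inverse (h : ExpRecursion g E) (h' : ExpRecursion (fun i => -g i) E')
    (h0 : E 0 = 1) (h0' : E' 0 = 1) (hneg : ∀ n < 0, E n = 0) (hneg' : ∀ n < 0, E' n = 0)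
    (hcomm : ∀ i j, Commute (E i) (E' j)) (i : ℤ) :
    ∑ᶠ p : ℤ, E p * E' (i - p) = if i = 0 then 1 else 0 := by
  have hf := fun c => hasFiniteSupport_mul hneg hneg' 0 i c
  simp only [sub_zero] at hf
  split_ifs with hi
  · subst hi
    rw [finsum_eq_single _ 0]
    · simp [h0, h0']
    · intro p hp
      rcases lt_or_gt_of_ne hp with hp | hp
      · rw [hneg p hp, zero_mul]
      · rw [hneg' (0 - p) (by omega), mul_zero]
  · have h1 := h.finsum_smul_mul_left hneg hneg' i.toNat i (by omega)
    have h2 := h'.finsum_smul_mul_left hneg' hneg i.toNat i (by omega)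
    rw [finsum_mul_comm (fun i j => (hcomm j i).symm) (fun p => (p : ℂ))] at h2
    have h3 : ∀ j : ℕ, ∑ᶠ p : ℤ, E' p * E (i - (j + 1) - p) =
        ∑ᶠ p : ℤ, E p * E' (i - (j + 1) - p) := fun j => by
      have := finsum_mul_comm (fun i j => (hcomm j i).symm) (fun _ => 1) (i - ((j : ℤ) + 1))
      simpa only [one_smul] using this
    simp only [h3, neg_mul, Finset.sum_neg_distrib, ← h1] at h2
    -- Writing i = p + (i - p) is the Leibniz rule for the product; the two halves cancel because
    -- the exponents are opposite.
    have h4 : (i : ℂ) • ∑ᶠ p : ℤ, E p * E' (i - p) = 0 := by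
      rw [← sub_eq_zero.mpr h2, sub_neg_eq_add, ← finsum_add_distrib (hf _) (hf _), smul_finsum]
      refine finsum_congr fun p => ?_
      rw [← add_smul]; push_cast; congr 1; ring
    exact (smul_eq_zero.mp h4).resolve_left (by exact_mod_cast hi)

/-- The logarithmic derivative of an exponential. -/
theorem finsum_smul_mul_inverse (h : ExpRecursion g E) (h' : ExpRecursion (fun i => -g i) E')
    (h0 : E 0 = 1) (h0' : E' 0 = 1) (hneg : ∀ n < 0, E n = 0) (hneg' : ∀ n < 0, E' n = 0)
    (hcomm : ∀ i j, Commute (E i) (E' j)) (i : ℤ) :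
    ∑ᶠ p : ℤ, (p : ℂ) • (E p * E' (i - p)) = if 0 < i then g (i - 1).toNat else 0 := by
  rw [h.finsum_smul_mul_left hneg hneg' i.toNat i (by omega)]
  simp only [finsum_mul_inverse h h' h0 h0' hneg hneg' hcomm]
  split_ifs with hi
  · rw [Finset.sum_eq_single (i - 1).toNat]
    · rw [if_pos (by omega), mul_one]
    · intro j _ hj
      rw [if_neg (by omega), mul_zero]
    · intro hj
      exact absurd (Finset.mem_range.mpr (by omega)) hj
  · rw [Int.toNat_of_nonpos (by omega)]; rfl

/-- Reordering of two exponentials whose exponents commute up to scalars. -/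
theorem mul_eq_sum (h : ExpRecursion g E) (h0 : E 0 = 1) (hneg : ∀ n < 0, E n = 0)
    (hneg' : ∀ n < 0, E' n = 0) {b : ℂ}
    (hg : ∀ (i : ℕ) (n : ℤ), g i * E' n = E' n * g i + b • E' (n - (i + 1)))
    {c : ℕ → ℂ} (hc0 : c 0 = 1) (hc : ∀ L : ℕ, (L : ℂ) * c L = b * ∑ l ∈ Finset.range L, c l)
    (N : ℕ) (p : ℤ) (hp : p ≤ N) (q : ℤ) :
    E q * E' p = ∑ l ∈ Finset.range (N + 1), c l • (E' (p - l) * E (q - l)) := by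
  -- With p fixed, both sides are sequences in q to be compared by uniqueness. Passing `g i` through
  -- `E' (p - l)` leaves an extra b · `E' (p - (l + i + 1))`; collecting these terms by L = l + i +
  -- 1 produces b times the partial sums of `c`, which `hc` turns into L · `c L`.
  have hR : ExpRecursion g fun q => ∑ l ∈ Finset.range (N + 1), c l • (E' (p - l) * E (q - l)) := by
    intro M q hq
    have e1 : ∀ i l : ℕ, g i * c l • (E' (p - l) * E (q - (i + 1) - l)) =
        c l • (E' (p - l) * (g i * E (q - l - (i + 1)))) +
          b • c l • (E' (p - (l + i + 1 : ℕ)) * E (q - (l + i + 1 : ℕ))) := by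
      intro i l
      rw [mul_smul_comm, ← mul_assoc, hg, add_mul, smul_add, mul_assoc, sub_right_comm q,
        smul_mul_assoc, smul_comm b]
      congr 5
      · push_cast; ring
      · push_cast; ring
    simp only [Finset.mul_sum, e1, Finset.sum_add_distrib, ← Finset.smul_sum]
    rw [Finset.sum_comm, Finset.sum_comm (s := Finset.range M)]
    simp only [← Finset.smul_sum, ← Finset.mul_sum]
    rw [sum_range_sum_shift c (fun j : ℕ => E' (p - j) * E (q - j)) N M
      (fun j hj => by rw [hneg' _ (by omega), zero_mul])
      (fun j hj => by rw [hneg _ (by omega), mul_zero])]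
    simp only [Finset.smul_sum, smul_smul, ← hc, ← Finset.sum_add_distrib]
    refine Finset.sum_congr rfl fun l _ => ?_
    rw [← h M (q - l) (by omega), mul_smul_comm, smul_smul, ← add_smul]
    push_cast; congr 1; ring
  refine sub_eq_zero.mp (eq_zero ((h.mul_right (E' p)).sub hR) (fun n hn => ?_) q)
  rcases hn.lt_or_eq with hn | rfl
  · rw [hneg n hn, zero_mul, Finset.sum_eq_zero, sub_zero]
    intro l _
    rw [hneg _ (by omega), mul_zero, smul_zero]
  · rw [Finset.sum_range_succ', Finset.sum_eq_zero]
    · simp [h0, hc0]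
    · intro l _
      rw [hneg _ (by push_cast; omega), mul_zero, smul_zero]

end ExpRecursion

/-! ### Binomial coefficients and the modes of E₊ and E₋ -/

/-- The coefficients of `(1 - x)^a`. -/
noncomputable def binomCoeff (a : ℚ) (l : ℕ) : ℂ := (((-1) ^ l * Ring.choose a l : ℚ) : ℂ)

theorem binomCoeff_zero (a : ℚ) : binomCoeff a 0 = 1 := by simp [binomCoeff]

theorem succ_mul_ringChoose (a : ℚ) (l : ℕ) :
    ((l : ℚ) + 1) * Ring.choose a (l + 1) = (a - l) * Ring.choose a l := by
  have h1 := Ring.descPochhammer_eq_factorial_smul_choose a (l + 1)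
  have h2 := Ring.descPochhammer_eq_factorial_smul_choose a l
  rw [descPochhammer_succ_right, Polynomial.smeval_mul, h2, Polynomial.smeval_sub,
    Polynomial.smeval_X, Polynomial.smeval_natCast, Nat.factorial_succ] at h1
  have hf : ((l.factorial : ℕ) : ℚ) ≠ 0 := by exact_mod_cast l.factorial_ne_zero
  simp only [nsmul_eq_mul, pow_one, pow_zero, mul_one] at h1
  push_cast at h1
  refine mul_left_cancel₀ hf ?_
  linear_combination -h1

/-- The differential equation x y' = -a · x/(1 - x) · y of y = (1 - x)^a, in the shape that
`mul_eq_sum` requires. It follows by induction from the two-term recursion for the binomial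
coefficients. -/
theorem binomCoeff_recursion (a : ℚ) (L : ℕ) :
    (L : ℂ) * binomCoeff a L = (-a) * ∑ l ∈ Finset.range L, binomCoeff a l := by
  have hs : ∀ L : ℕ, ((L : ℂ) + 1) * binomCoeff a (L + 1) = (L - a) * binomCoeff a L := by
    intro L
    have := congrArg (fun x : ℚ => (x : ℂ)) (succ_mul_ringChoose a L)
    simp only [binomCoeff]
    push_cast at this ⊢
    rw [pow_succ]
    linear_combination (-1) ^ (L + 1) * this
  induction L with
  | zero => simp
  | succ L ih =>
    rw [Finset.sum_range_succ, mul_add, ← ih]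
    push_cast
    rw [hs]; ring

namespace Fock

/-- The coefficient of `zⁿ` in `E₊^±(z)`, for an integer `n`. -/
noncomputable def plusMode (k : ℕ) (ε n : ℤ) : Module.End ℂ Fock := (Eplus k ε).coeffInt n

/-- The coefficient of `z⁻ⁿ` in `E₋^±(z)`, for an integer `n`. -/
noncomputable def minusMode (k : ℕ) (ε n : ℤ) : Module.End ℂ Fock := (Eminus k ε).coeffInt n

variable (k : ℕ) (ε δ : ℤ)

theorem plusMode_of_neg (n : ℤ) (hn : n < 0) : plusMode k ε n = 0 :=
  PowerSeries.coeffInt_of_neg _ hn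

theorem minusMode_of_neg (n : ℤ) (hn : n < 0) : minusMode k ε n = 0 :=
  PowerSeries.coeffInt_of_neg _ hn

theorem plusMode_natCast (n : ℕ) : plusMode k ε n = PowerSeries.coeff n (Eplus k ε) :=
  PowerSeries.coeffInt_natCast _ n

theorem minusMode_natCast (n : ℕ) : minusMode k ε n = PowerSeries.coeff n (Eminus k ε) :=
  PowerSeries.coeffInt_natCast _ n

theorem coeff_expSeries_zero (f : PowerSeries (Module.End ℂ Fock)) :
    PowerSeries.coeff 0 (expSeries f) = 1 := by
  simp [expSeries]

theorem plusMode_zero : plusMode k ε 0 = 1 :=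
  (plusMode_natCast k ε 0).trans (coeff_expSeries_zero _)

theorem minusMode_zero : minusMode k ε 0 = 1 :=
  (minusMode_natCast k ε 0).trans (coeff_expSeries_zero _)

theorem plusMode_recursion : ExpRecursion (fun i => (-(ε : ℂ) / k) • heis k (-((i : ℤ) + 1)))
    (plusMode k ε) := by
  have h := expRecursion_expSeries (f := PowerSeries.mk fun n => if n = 0 then 0 else
    (-(ε : ℂ) / (k * n)) • heis k (-n)) (by simp) (fun i j => by
      rcases i with - | i
      · simp
      rcases j with - | j
      · simp
      simp only [PowerSeries.coeff_mk, Nat.succ_ne_zero, if_false]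
      push_cast
      exact ((heis_neg_commute k i j).smul_left _).smul_right _)
  refine (congrArg (ExpRecursion · (plusMode k ε)) (funext fun i => ?_)).mp h
  rw [PowerSeries.coeff_mk, if_neg i.succ_ne_zero, smul_smul]
  have : (i : ℂ) + 1 ≠ 0 := by exact_mod_cast i.succ_ne_zero
  push_cast
  congr 1
  -- The recursion holds for k = 0 as well, since division by zero gives zero on both sides.
  rcases eq_or_ne (k : ℂ) 0 with hk | hk
  · simp [hk]
  · field_simp

theorem minusMode_recursion : ExpRecursion (fun i => ((ε : ℂ) / k) • heis k ((i : ℤ) + 1))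
    (minusMode k ε) := by
  have h := expRecursion_expSeries (f := PowerSeries.mk fun n => if n = 0 then 0 else
    ((ε : ℂ) / (k * n)) • heis k n) (by simp) (fun i j => by
      rcases i with - | i
      · simp
      rcases j with - | j
      · simp
      simp only [PowerSeries.coeff_mk, Nat.succ_ne_zero, if_false]
      push_cast
      exact ((heis_pos_commute k i j).smul_left _).smul_right _)
  refine (congrArg (ExpRecursion · (minusMode k ε)) (funext fun i => ?_)).mp h
  rw [PowerSeries.coeff_mk, if_neg i.succ_ne_zero, smul_smul]
  have : (i : ℂ) + 1 ≠ 0 := by exact_mod_cast i.succ_ne_zero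
  push_cast
  congr 1
  rcases eq_or_ne (k : ℂ) 0 with hk | hk
  · simp [hk]
  · field_simp

theorem heis_neg_commute_plusMode (m : ℕ) (n : ℤ) :
    Commute (heis k (-((m : ℤ) + 1))) (plusMode k ε n) :=
  (plusMode_recursion k ε).commute (plusMode_zero k ε) (plusMode_of_neg k ε)
    (fun i => (heis_neg_commute k m i).smul_right _) n

theorem heis_pos_commute_minusMode (m : ℕ) (n : ℤ) :
    Commute (heis k ((m : ℤ) + 1)) (minusMode k ε n) :=
  (minusMode_recursion k ε).commute (minusMode_zero k ε) (minusMode_of_neg k ε)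
    (fun i => (heis_pos_commute k m i).smul_right _) n

theorem plusMode_commute (m n : ℤ) : Commute (plusMode k ε m) (plusMode k δ n) :=
  (plusMode_recursion k δ).commute (plusMode_zero k δ) (plusMode_of_neg k δ)
    (fun i => ((heis_neg_commute_plusMode k ε i m).smul_left _).symm) n

theorem minusMode_commute (m n : ℤ) : Commute (minusMode k ε m) (minusMode k δ n) :=
  (minusMode_recursion k δ).commute (minusMode_zero k δ) (minusMode_of_neg k δ)
    (fun i => ((heis_pos_commute_minusMode k ε i m).smul_left _).symm) n

variable {k}

/-- The level cancels: the exponent carries -ε/k and the Heisenberg commutator -2(m + 1)k, whose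
product is 2ε(m + 1). -/
theorem heis_pos_plusMode (hk : k ≠ 0) (m : ℕ) (n : ℤ) :
    heis k ((m : ℤ) + 1) * plusMode k ε n - plusMode k ε n * heis k ((m : ℤ) + 1) =
      (2 * ε : ℂ) • plusMode k ε (n - (m + 1)) :=
  (plusMode_recursion k ε).commutator (plusMode_zero k ε) (plusMode_of_neg k ε) m _
    (fun i => by
      have hk' : (k : ℂ) ≠ 0 := by exact_mod_cast hk
      refine (mul_smul_sub_smul_mul (R := Module.End ℂ Fock) _ _ _).trans ?_
      rw [heis_commutator, smul_ite, smul_zero, smul_smul]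
      congr 2
      field_simp) n

theorem heis_neg_minusMode (hk : k ≠ 0) (m : ℕ) (n : ℤ) :
    heis k (-((m : ℤ) + 1)) * minusMode k ε n - minusMode k ε n * heis k (-((m : ℤ) + 1)) =
      (2 * ε : ℂ) • minusMode k ε (n - (m + 1)) :=
  (minusMode_recursion k ε).commutator (minusMode_zero k ε) (minusMode_of_neg k ε) m _
    (fun i => by
      have hk' : (k : ℂ) ≠ 0 := by exact_mod_cast hk
      refine (mul_smul_sub_smul_mul (R := Module.End ℂ Fock) _ _ _).trans ?_
      rw [← neg_sub, heis_commutator]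
      by_cases h : i = m
      · subst h
        rw [if_pos rfl, if_pos rfl, ← neg_one_smul ℂ, smul_smul,
          smul_smul]
        congr 1; field_simp
      · rw [if_neg h, if_neg (Ne.symm h), neg_zero, smul_zero]) n

variable (k)

theorem degree_plusMode (n : ℤ) :
    degree * plusMode k ε n - plusMode k ε n * degree = (-1 * n : ℂ) • plusMode k ε n :=
  (plusMode_recursion k ε).derivation (plusMode_zero k ε) (plusMode_of_neg k ε) _
    (fun i => by
      refine (mul_smul_sub_smul_mul (R := Module.End ℂ Fock) _ _ _).trans ?_
      rw [degree_heis_neg, smul_comm]) n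

theorem degree_minusMode (n : ℤ) :
    degree * minusMode k ε n - minusMode k ε n * degree = (1 * n : ℂ) • minusMode k ε n :=
  (minusMode_recursion k ε).derivation (minusMode_zero k ε) (minusMode_of_neg k ε) _
    (fun i => by
      refine (mul_smul_sub_smul_mul (R := Module.End ℂ Fock) _ _ _).trans ?_
      rw [degree_heis_pos, smul_comm]) n

variable {k}

/-- `E₋^ε(z) E₊^δ(w) = (1 - w/z)^a E₊^δ(w) E₋^ε(z)` with `a = -2εδ/k`. -/
theorem minusMode_mul_plusMode (hk : k ≠ 0) {a : ℚ} (ha : a = -2 * ε * δ / k) (N : ℕ) (p : ℤ)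
    (hp : p ≤ N) (q : ℤ) :
    minusMode k ε q * plusMode k δ p = ∑ l ∈ Finset.range (N + 1), binomCoeff a l •
      (plusMode k δ (p - l) * minusMode k ε (q - l)) := by
  refine (minusMode_recursion k ε).mul_eq_sum (minusMode_zero k ε) (minusMode_of_neg k ε)
    (plusMode_of_neg k δ) (b := -a) (fun i n => ?_) (binomCoeff_zero a) (binomCoeff_recursion a) N p
    hp q
  rw [smul_mul_assoc, eq_add_of_sub_eq (heis_pos_plusMode δ hk i n), smul_add, mul_smul_comm,
    smul_smul, add_comm]
  congr 2
  rw [ha]; push_cast; ring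

theorem finsum_plusMode_mul (i : ℤ) :
    ∑ᶠ p : ℤ, plusMode k 1 p * plusMode k (-1) (i - p) = if i = 0 then 1 else 0 := by
  have h' : ExpRecursion (fun i => -((-((1 : ℤ) : ℂ) / k) • heis k (-((i : ℤ) + 1))))
      (plusMode k (-1)) := by
    have := plusMode_recursion k (-1)
    refine (congrArg (ExpRecursion · _) (funext fun i => ?_)).mp this
    refine Eq.trans ?_ (neg_smul _ _)
    congr 1; push_cast; ring
  exact (plusMode_recursion k 1).finsum_mul_inverse h' (plusMode_zero k _) (plusMode_zero k _)
    (plusMode_of_neg k _) (plusMode_of_neg k _) (plusMode_commute k _ _) i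

/-- The logarithmic derivative of E₊⁺ recovers the creation part of H(z). The prefactor -k is the
coefficient of the contraction and cancels the -1/k in the exponent; for E₋⁺ below, the sign of the
exponent is opposite. -/
theorem finsum_smul_plusMode_mul (hk : k ≠ 0) (i : ℤ) :
    (-(k : ℂ)) • ∑ᶠ p : ℤ, (p : ℂ) • (plusMode k 1 p * plusMode k (-1) (i - p)) =
      if 0 < i then heis k (-i) else 0 := by
  have h' : ExpRecursion (fun i => -((-((1 : ℤ) : ℂ) / k) • heis k (-((i : ℤ) + 1))))
      (plusMode k (-1)) := by
    have := plusMode_recursion k (-1)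
    refine (congrArg (ExpRecursion · _) (funext fun i => ?_)).mp this
    refine Eq.trans ?_ (neg_smul _ _)
    congr 1; push_cast; ring
  rw [(plusMode_recursion k 1).finsum_smul_mul_inverse h' (plusMode_zero k _) (plusMode_zero k _)
    (plusMode_of_neg k _) (plusMode_of_neg k _) (plusMode_commute k _ _) i]
  split_ifs with hi
  · have hk' : (k : ℂ) ≠ 0 := by exact_mod_cast hk
    rw [smul_smul, show ((i - 1).toNat : ℤ) + 1 = i by omega, Int.cast_one,
      show -(k : ℂ) * (-1 / k) = 1 by field_simp, one_smul]
  · exact smul_zero _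

theorem finsum_minusMode_mul (i : ℤ) :
    ∑ᶠ p : ℤ, minusMode k 1 p * minusMode k (-1) (i - p) = if i = 0 then 1 else 0 := by
  have h' : ExpRecursion (fun i => -((((1 : ℤ) : ℂ) / k) • heis k ((i : ℤ) + 1)))
      (minusMode k (-1)) := by
    have := minusMode_recursion k (-1)
    refine (congrArg (ExpRecursion · _) (funext fun i => ?_)).mp this
    refine Eq.trans ?_ (neg_smul _ _)
    congr 1; push_cast; ring
  exact (minusMode_recursion k 1).finsum_mul_inverse h' (minusMode_zero k _) (minusMode_zero k _)
    (minusMode_of_neg k _) (minusMode_of_neg k _) (minusMode_commute k _ _) i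

theorem finsum_smul_minusMode_mul (hk : k ≠ 0) (i : ℤ) :
    (k : ℂ) • ∑ᶠ p : ℤ, (p : ℂ) • (minusMode k 1 p * minusMode k (-1) (i - p)) =
      if 0 < i then heis k i else 0 := by
  have h' : ExpRecursion (fun i => -((((1 : ℤ) : ℂ) / k) • heis k ((i : ℤ) + 1)))
      (minusMode k (-1)) := by
    have := minusMode_recursion k (-1)
    refine (congrArg (ExpRecursion · _) (funext fun i => ?_)).mp this
    refine Eq.trans ?_ (neg_smul _ _)
    congr 1; push_cast; ring
  rw [(minusMode_recursion k 1).finsum_smul_mul_inverse h' (minusMode_zero k _) (minusMode_zero k _)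
    (minusMode_of_neg k _) (minusMode_of_neg k _) (minusMode_commute k _ _) i]
  split_ifs with hi
  · have hk' : (k : ℂ) ≠ 0 := by exact_mod_cast hk
    rw [smul_smul, show ((i - 1).toNat : ℤ) + 1 = i by omega, Int.cast_one,
      show (k : ℂ) * (1 / k) = 1 by field_simp, one_smul]
  · exact smul_zero _

theorem minusMode_bounded (n : ℤ) (N : ℤ) {p : Fock} (hp : p ∈ bounded N) :
    minusMode k ε n p ∈ bounded (N - n) := by
  rcases lt_or_ge n 0 with hn | hn
  · rw [minusMode_of_neg k ε n hn]; exact (bounded _).zero_mem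
  · lift n to ℕ using hn
    rw [minusMode_natCast]
    exact Eminus_lowering k ε n N p hp

end Fock

/-! ### Vertex operators on pure tensors and the normal ordering of their products -/

theorem finsum_eq_of_injective {α β γ M : Type*} [AddCommMonoid M] {f : α → M} {g : β → M}
    {e : γ → α} {e' : γ → β} (he : Function.Injective e) (he' : Function.Injective e')
    (hf : ∀ a, f a ≠ 0 → a ∈ Set.range e) (hg : ∀ b, g b ≠ 0 → b ∈ Set.range e')
    (h : ∀ c, f (e c) = g (e' c)) : ∑ᶠ a, f a = ∑ᶠ b, g b := by
  rw [← finsum_mem_univ f, ← finsum_mem_univ g,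
    finsum_mem_inter_support_eq f Set.univ (Set.range e) (by ext a; simpa using hf a),
    finsum_mem_inter_support_eq g Set.univ (Set.range e') (by ext a; simpa using hg a),
    finsum_mem_range he, finsum_mem_range he', finsum_congr h]

theorem hasFiniteSupport_finsum_prod {α β M : Type*} [AddCommMonoid M] {f : α × β → M}
    (hf : Function.HasFiniteSupport f) : Function.HasFiniteSupport fun a => ∑ᶠ b, f (a, b) := by
  refine (hf.image Prod.fst).subset fun a ha => ?_
  by_contra h
  refine ha ((finsum_congr fun b => ?_).trans finsum_zero)
  by_contra hb
  exact h ⟨(a, b), hb, rfl⟩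

theorem hasFiniteSupport_prodMk {α β M : Type*} [AddCommMonoid M] {f : α × β → M}
    (hf : Function.HasFiniteSupport f) (a : α) : Function.HasFiniteSupport fun b => f (a, b) :=
  (hf.image Prod.snd).subset fun b hb => ⟨(a, b), hb, rfl⟩

namespace LatticeAlg

theorem shift_single (m n : ℤ) : shift m (AddMonoidAlgebra.single n 1) =
    AddMonoidAlgebra.single (n + m) (1 : ℂ) := by
  rw [shift, LinearMap.mulLeft_apply, AddMonoidAlgebra.single_mul_single, one_mul, add_comm]

end LatticeAlg

namespace TriTensor

variable {W : Type*} [AddCommGroup W] [Module ℂ W]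

/-- The bilinear map `(s, w) ↦ s ⊗ w ⊗ e^{nα}`. -/
noncomputable def tmulBilin (n : ℤ) : Fock →ₗ[ℂ] W →ₗ[ℂ] TriTensor W :=
  LinearMap.mk₂ ℂ (fun s w => tmul s w n)
    (fun s s' _ => TensorProduct.add_tmul s s' _)
    (fun c s _ => (TensorProduct.smul_tmul' c s _).symm)
    (fun s w w' => (congrArg (fun x => (s ⊗ₜ[ℂ] x : Fock ⊗[ℂ] (W ⊗[ℂ] LatticeAlg)))
      (TensorProduct.add_tmul w w' _)).trans (TensorProduct.tmul_add s _ _))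
    (fun c s w => (congrArg (fun x => (s ⊗ₜ[ℂ] x : Fock ⊗[ℂ] (W ⊗[ℂ] LatticeAlg)))
      (TensorProduct.smul_tmul' c w _).symm).trans (TensorProduct.tmul_smul c s _))

theorem tmulBilin_apply (n : ℤ) (s : Fock) (w : W) : tmulBilin n s w = tmul s w n := rfl

theorem tmul_zero_left (w : W) (n : ℤ) : tmul 0 w n = 0 := by
  rw [← tmulBilin_apply, map_zero, LinearMap.zero_apply]

theorem tmul_zero_right (s : Fock) (n : ℤ) : tmul s (0 : W) n = 0 := by
  rw [← tmulBilin_apply, map_zero]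

theorem tmul_sub_left (s s' : Fock) (w : W) (n : ℤ) :
    tmul (s - s') w n = tmul s w n - tmul s' w n := by
  simp only [← tmulBilin_apply, map_sub, LinearMap.sub_apply]

theorem tmul_sub_right (s : Fock) (w w' : W) (n : ℤ) :
    tmul s (w - w') n = tmul s w n - tmul s w' n := by
  simp only [← tmulBilin_apply, map_sub]

theorem tmul_smul_left (c : ℂ) (s : Fock) (w : W) (n : ℤ) : tmul (c • s) w n = c • tmul s w n := by
  simp only [← tmulBilin_apply, map_smul, LinearMap.smul_apply]

theorem tmul_smul_right (c : ℂ) (s : Fock) (w : W) (n : ℤ) : tmul s (c • w) n = c • tmul s w n := by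
  simp only [← tmulBilin_apply, map_smul]

theorem op_diag_tmul (f : Module.End ℂ Fock) (g : Module.End ℂ W) (c : ℤ → ℂ) (s : Fock) (w : W)
    (n : ℤ) : op f g (LatticeAlg.diag c) (tmul s w n) = c n • tmul (f s) (g w) n := by
  rw [op_tmul, LatticeAlg.diag_single, TensorProduct.tmul_smul, TensorProduct.tmul_smul]
  rfl

theorem op_one_tmul (f : Module.End ℂ Fock) (g : Module.End ℂ W) (s : Fock) (w : W) (n : ℤ) :
    op f g 1 (tmul s w n) = tmul (f s) (g w) n := rfl

open Fock in
-- E₋ lowers the weight of s, which bounds `x.2`; once `x.2` is bounded, the field property of `A`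
-- bounds `x.1`.
theorem hasFiniteSupport_vertexTerm (k : ℕ) (ε : ℤ) {A : ℚ → Module.End ℂ W} (hA : IsFieldSeries A)
    (r : ℚ) (s : Fock) (w : W) (n : ℤ) : Function.HasFiniteSupport fun x : ℤ × ℤ =>
      tmul (plusMode k ε x.1 (minusMode k ε x.2 s)) (A (r + x.1 - x.2) w) n := by
  obtain ⟨Q, hQ⟩ := exists_bounded s
  obtain ⟨N, hN⟩ := hA w
  obtain ⟨M, hM⟩ := exists_nat_gt (N - r + Q)
  refine ((Set.finite_Icc 0 (M : ℤ)).prod (Set.finite_Icc 0 (Q : ℤ))).subset ?_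
  rintro ⟨p, q⟩ hx
  rw [Function.mem_support] at hx
  have hp : 0 ≤ p := by
    by_contra h
    exact hx (by rw [plusMode_of_neg k ε p (by omega), LinearMap.zero_apply, tmul_zero_left])
  have hq : 0 ≤ q := by
    by_contra h
    exact hx (by rw [minusMode_of_neg k ε q (by omega), LinearMap.zero_apply, map_zero,
      tmul_zero_left])
  have hq' : q ≤ Q := by
    by_contra h
    exact hx (by rw [eq_zero_of_bounded (by omega) (minusMode_bounded ε q Q hQ), map_zero,
      tmul_zero_left])
  have hp' : p ≤ M := by
    by_contra h
    have h1 : (M : ℚ) ≤ p := by exact_mod_cast (by omega : (M : ℤ) ≤ p)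
    have h2 : (q : ℚ) ≤ Q := by exact_mod_cast hq'
    exact hx (by rw [hN _ (by linarith), tmul_zero_right])
  exact ⟨⟨hp, hp'⟩, hq, hq'⟩

open Fock in
-- On e^{nα} the factor z^{-εα/k} is the single power -2εn/k, so the summation over rational
-- exponents collapses. The orders of E₊ and E₋ now run over ℤ, which allows shifts of the summation
-- variables without boundary conditions.
theorem vertex_tmul (k : ℕ) (ε : ℤ) {A : ℚ → Module.End ℂ W} (hA : IsFieldSeries A)
    (r : ℚ) (s : Fock) (w : W) (n : ℤ) : vertex k ε hA r (tmul s w n) =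
      ∑ᶠ x : ℤ × ℤ, tmul (plusMode k ε x.1 (minusMode k ε x.2 s))
        (A (r - 2 * ε * n / k + x.1 - x.2) w) (n + ε) := by
  change ∑ᶠ x, summand k ε A r x (tmul s w n) = _
  set u₀ : ℚ := 2 * (-ε / k) * n with hu
  refine finsum_eq_of_injective (e := fun x : ℕ × ℕ => (x.1, x.2, u₀))
    (e' := fun x : ℕ × ℕ => ((x.1 : ℤ), (x.2 : ℤ))) ?_ ?_ ?_ ?_ ?_
  · rintro ⟨a, b⟩ ⟨c, d⟩ h
    simp only [Prod.mk.injEq] at h ⊢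
    exact ⟨h.1, h.2.1⟩
  · rintro ⟨a, b⟩ ⟨c, d⟩ h
    simp only [Prod.mk.injEq] at h ⊢
    omega
  · rintro ⟨p, q, u⟩ hx
    refine ⟨(p, q), ?_⟩
    have hu' : u = u₀ := by
      by_contra h
      refine hx (op_tmul_eq_zero _ _ _ _ _ _ (Or.inr (Or.inr ?_)))
      rw [Module.End.mul_apply, LatticeAlg.zPow, LatticeAlg.diag_single,
        if_neg (fun h' => h (Eq.trans (Eq.symm h') (Eq.symm hu))), zero_smul, map_zero]
    rw [hu']
  · rintro ⟨p, q⟩ hx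
    have hp : 0 ≤ p := by
      by_contra h
      exact hx (by rw [plusMode_of_neg k ε p (by omega), LinearMap.zero_apply, tmul_zero_left])
    have hq : 0 ≤ q := by
      by_contra h
      exact hx (by rw [minusMode_of_neg k ε q (by omega), LinearMap.zero_apply, map_zero,
        tmul_zero_left])
    lift p to ℕ using hp
    lift q to ℕ using hq
    exact ⟨(p, q), rfl⟩
  · rintro ⟨p, q⟩
    simp only [summand, op_tmul, Module.End.mul_apply, LatticeAlg.zPow, LatticeAlg.diag_single,
      ← hu, if_true, one_smul, LatticeAlg.shift_single, plusMode_natCast, minusMode_natCast]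
    rw [show r + (p : ℚ) - q + u₀ = r - 2 * ε * n / k + (p : ℤ) - (q : ℤ) by
      rw [hu]; push_cast; ring]
    rfl

open Fock in
/-- The terms of the product of two vertex operators, after the Heisenberg operators have been
brought into normal order. -/
theorem hasFiniteSupport_productTerm (k : ℕ) (ε δ : ℤ) {A B : ℚ → Module.End ℂ W}
    (hA : IsFieldSeries A) (hB : IsFieldSeries B) (c : ℕ → ℂ) (r t : ℚ) (s : Fock) (w : W) (n : ℤ) :
    Function.HasFiniteSupport fun z : ((ℤ × ℤ) × (ℤ × ℤ)) × ℕ =>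
      c z.2 • tmul (plusMode k ε z.1.2.1 (plusMode k δ z.1.1.1 (minusMode k ε z.1.2.2
        (minusMode k δ z.1.1.2 s)))) (A (r + z.1.2.1 - z.1.2.2 - z.2)
          (B (t + z.1.1.1 - z.1.1.2 + z.2) w)) n := by
  obtain ⟨Q, hQ⟩ := exists_bounded s
  obtain ⟨N, hN⟩ := hB w
  obtain ⟨M, hM⟩ := exists_nat_gt (N - t + Q)
  choose K hK using hA
  -- The field bound for `A` depends on the vector. Only finitely many vectors occur here, because B
  -- sees its indices only through p' + l and q', so a common bound exists.
  obtain ⟨K', hK'⟩ := Finset.exists_le ((Finset.Icc (0 : ℤ) M ×ˢ Finset.Icc (0 : ℤ) Q).image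
    fun x => K (B (t + x.1 - x.2) w))
  obtain ⟨L, hL⟩ := exists_nat_gt (K' - r + Q + M)
  refine ((((Set.finite_Icc 0 (M : ℤ)).prod (Set.finite_Icc 0 (Q : ℤ))).prod
    ((Set.finite_Icc 0 (L : ℤ)).prod (Set.finite_Icc 0 (Q : ℤ)))).prod (Set.finite_Iic M)).subset ?_
  rintro ⟨⟨⟨p', q'⟩, ⟨p, q⟩⟩, l⟩ hx
  rw [Function.mem_support] at hx
  simp only at hx
  have hp : 0 ≤ p := by
    by_contra h
    exact hx (by rw [plusMode_of_neg k ε p (by omega), LinearMap.zero_apply, tmul_zero_left,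
      smul_zero])
  have hp' : 0 ≤ p' := by
    by_contra h
    exact hx (by rw [plusMode_of_neg k δ p' (by omega), LinearMap.zero_apply, map_zero,
      tmul_zero_left, smul_zero])
  have hq : 0 ≤ q := by
    by_contra h
    exact hx (by rw [minusMode_of_neg k ε q (by omega), LinearMap.zero_apply, map_zero, map_zero,
      tmul_zero_left, smul_zero])
  have hq' : 0 ≤ q' := by
    by_contra h
    exact hx (by rw [minusMode_of_neg k δ q' (by omega), LinearMap.zero_apply, map_zero, map_zero,
      map_zero, tmul_zero_left, smul_zero])
  have hqQ : q + q' ≤ Q := by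
    by_contra h
    exact hx (by rw [eq_zero_of_bounded (by omega) (minusMode_bounded ε q _
      (minusMode_bounded δ q' Q hQ)), map_zero, map_zero, tmul_zero_left, smul_zero])
  have hlM : p' + l ≤ M := by
    by_contra h
    have h1 : (M : ℚ) ≤ p' + l := by exact_mod_cast (by omega : (M : ℤ) ≤ p' + l)
    have h2 : (q' : ℚ) ≤ Q := by exact_mod_cast (by omega : q' ≤ Q)
    exact hx (by rw [hN _ (by linarith), map_zero, tmul_zero_right, smul_zero])
  have hpL : p ≤ L := by
    by_contra h
    have h1 : (L : ℚ) ≤ p := by exact_mod_cast (by omega : (L : ℤ) ≤ p)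
    have h2 : (q : ℚ) ≤ Q := by exact_mod_cast (by omega : q ≤ Q)
    have h3 : (l : ℚ) ≤ M := by exact_mod_cast (by omega : l ≤ M)
    have h4 := hK' _ (Finset.mem_image_of_mem _ (Finset.mk_mem_product
      (Finset.mem_Icc.mpr ⟨(by omega : 0 ≤ p' + l), hlM⟩)
      (Finset.mem_Icc.mpr ⟨hq', (by omega : q' ≤ Q)⟩)))
    simp only at h4
    rw [show t + ((p' + l : ℤ) : ℚ) - q' = t + p' - q' + l by push_cast; ring] at h4
    exact hx (by rw [hK _ _ (by linarith), tmul_zero_right, smul_zero])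
  refine ⟨⟨⟨⟨?_, ?_⟩, ?_, ?_⟩, ⟨?_, ?_⟩, ?_, ?_⟩, ?_⟩ <;> simp only [Set.mem_Iic] <;> omega

/-- The relabelling `(p', q', p, q, l) ↦ (p' + l, q', p, q + l, l)`. -/
def contractionEquiv : ((ℤ × ℤ) × (ℤ × ℤ)) × ℕ ≃ (ℤ × ℤ) × ((ℤ × ℤ) × ℕ) where
  toFun z := ((z.1.1.1 + z.2, z.1.1.2), ((z.1.2.1, z.1.2.2 + z.2), z.2))
  invFun y := (((y.1.1 - y.2.2, y.1.2), (y.2.1.1, y.2.1.2 - y.2.2)), y.2.2)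
  left_inv z := by simp
  right_inv y := by simp

theorem hasFiniteSupport_opeCoeff (a : ℚ) (A : ℚ → Module.End ℂ W) {B : ℚ → Module.End ℂ W}
    (hB : IsFieldSeries B) (r t : ℚ) (w : W) : Function.HasFiniteSupport fun l : ℕ =>
      binomCoeff a l • A (r + a - l) (B (t + l) w) := by
  obtain ⟨N, hN⟩ := hB w
  obtain ⟨M, hM⟩ := exists_nat_gt (N - t)
  refine (Set.finite_Iic M).subset fun l hl => ?_
  by_contra h
  have h1 : (M : ℚ) ≤ l := by exact_mod_cast (by simpa using h : M < l).le
  exact hl (by simp only [hN (t + l) (by linarith), map_zero, smul_zero])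

open Fock in
/-- The normally ordered form of a product of two vertex operators. -/
theorem vertex_vertex_tmul {k : ℕ} (hk : k ≠ 0) (ε δ : ℤ) {a : ℚ} (ha : a = -2 * ε * δ / k)
    {A B : ℚ → Module.End ℂ W} (hA : IsFieldSeries A) (hB : IsFieldSeries B) (r t : ℚ) (s : Fock)
    (w : W) (n : ℤ) :
    (Function.HasFiniteSupport fun z : (ℤ × ℤ) × (ℤ × ℤ) =>
      tmul (plusMode k ε z.2.1 (plusMode k δ z.1.1 (minusMode k ε z.2.2 (minusMode k δ z.1.2 s))))
        (opeCoeff a A B (r - 2 * ε * n / k + z.2.1 - z.2.2) (t - 2 * δ * n / k + z.1.1 - z.1.2) w)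
        (n + δ + ε)) ∧
    vertex k ε hA r (vertex k δ hB t (tmul s w n)) = ∑ᶠ z : (ℤ × ℤ) × (ℤ × ℤ),
      tmul (plusMode k ε z.2.1 (plusMode k δ z.1.1 (minusMode k ε z.2.2 (minusMode k δ z.1.2 s))))
        (opeCoeff a A B (r - 2 * ε * n / k + z.2.1 - z.2.2) (t - 2 * δ * n / k + z.1.1 - z.1.2) w)
        (n + δ + ε) := by
  set r' : ℚ := r - 2 * ε * n / k with hr'
  set t' : ℚ := t - 2 * δ * n / k with ht'
  -- The terms as they arise from the product: `y.1` holds the orders of the inner operator, `y.2.1`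
  -- those of the outer one, and `y.2.2` the index of the binomial expansion. After
  -- `contractionEquiv`, summing over this last index alone gives `opeCoeff`; joint finiteness
  -- justifies exchanging the sums.
  let F : (ℤ × ℤ) × ((ℤ × ℤ) × ℕ) → TriTensor W := fun y => binomCoeff a y.2.2 •
    tmul (plusMode k ε y.2.1.1 (plusMode k δ (y.1.1 - y.2.2) (minusMode k ε (y.2.1.2 - y.2.2)
      (minusMode k δ y.1.2 s)))) (A (r' + a + y.2.1.1 - y.2.1.2) (B (t' + y.1.1 - y.1.2) w))
      (n + δ + ε)
  have hF : ∀ z, F (contractionEquiv z) = binomCoeff a z.2 • tmul (plusMode k ε z.1.2.1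
      (plusMode k δ z.1.1.1 (minusMode k ε z.1.2.2 (minusMode k δ z.1.1.2 s))))
      (A (r' + a + z.1.2.1 - z.1.2.2 - z.2) (B (t' + z.1.1.1 - z.1.1.2 + z.2) w)) (n + δ + ε) := by
    rintro ⟨⟨⟨p', q'⟩, ⟨p, q⟩⟩, l⟩
    simp only [F, contractionEquiv, Equiv.coe_fn_mk, add_sub_cancel_right]
    rw [show r' + a + p - ((q + l : ℤ) : ℚ) = r' + a + p - q - l by push_cast; ring,
      show t' + ((p' + l : ℤ) : ℚ) - q' = t' + p' - q' + l by push_cast; ring]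
  have hfin : Function.HasFiniteSupport fun z => F (contractionEquiv z) := by
    simp only [hF]
    exact hasFiniteSupport_productTerm k ε δ hA hB _ _ _ s w _
  have hfinF : Function.HasFiniteSupport F := by
    refine (hfin.image contractionEquiv).subset fun y hy => ⟨contractionEquiv.symm y, ?_, by simp⟩
    rw [Function.mem_support, Equiv.apply_symm_apply]
    exact hy
  have hope : ∀ z : (ℤ × ℤ) × (ℤ × ℤ), ∑ᶠ l, F (contractionEquiv (z, l)) =
      tmul (plusMode k ε z.2.1 (plusMode k δ z.1.1 (minusMode k ε z.2.2 (minusMode k δ z.1.2 s))))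
        (opeCoeff a A B (r' + z.2.1 - z.2.2) (t' + z.1.1 - z.1.2) w) (n + δ + ε) := by
    intro z
    simp only [hF]
    have h1 := hasFiniteSupport_opeCoeff a A hB (r' + z.2.1 - z.2.2) (t' + z.1.1 - z.1.2) w
    have h2 := map_finsum (tmulBilin (n + δ + ε) (plusMode k ε z.2.1 (plusMode k δ z.1.1
      (minusMode k ε z.2.2 (minusMode k δ z.1.2 s))))) h1
    refine (finsum_congr fun l => ?_).trans h2.symm
    rw [map_smul, tmulBilin_apply]
    congr 4; ring
  refine ⟨?_, ?_⟩
  · have := hasFiniteSupport_finsum_prod hfin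
    simpa only [hope] using this
  · rw [vertex_tmul, map_finsum _ (by
      have := hasFiniteSupport_vertexTerm k δ hB t' s w (n + δ)
      exact this)]
    -- The outer operator meets charge n + δ instead of n, which changes the index of `A` by -2εδ/k
    -- = a. This is the power z^a in (z - w)^a = z^a (1 - w/z)^a.
    have hx : ∀ y : ℤ × ℤ, ∀ x : ℤ × ℤ,
        tmul (plusMode k ε x.1 (minusMode k ε x.2 (plusMode k δ y.1 (minusMode k δ y.2 s))))
          (A (r - 2 * ε * (n + δ : ℤ) / k + x.1 - x.2) (B (t' + y.1 - y.2) w)) (n + δ + ε) =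
        ∑ᶠ l : ℕ, F (y, (x, l)) := by
      intro y x
      rw [finsum_eq_sum_of_support_subset (s := Finset.range (y.1.toNat + 1))]
      · rw [← Module.End.mul_apply (minusMode k ε x.2), minusMode_mul_plusMode ε δ hk ha y.1.toNat
          y.1 (by omega), LinearMap.sum_apply, map_sum, ← tmulBilin_apply, map_sum,
          LinearMap.sum_apply]
        refine Finset.sum_congr rfl fun l _ => ?_
        rw [LinearMap.smul_apply, map_smul, map_smul, LinearMap.smul_apply, tmulBilin_apply,
          Module.End.mul_apply]
        congr 4
        rw [hr', ha]; push_cast; ring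
      · intro l hl
        by_contra h
        rw [Finset.coe_range, Set.mem_Iio, not_lt] at h
        refine hl ?_
        simp only [F]
        rw [plusMode_of_neg k δ _ (by omega), LinearMap.zero_apply, map_zero, tmul_zero_left,
          smul_zero]
    refine (finsum_congr fun y => (vertex_tmul k ε hA r _ _ _).trans
      (finsum_congr fun x => hx y x)).trans ?_
    rw [← finsum_congr hope, ← finsum_curry _ hfin, finsum_comp_equiv contractionEquiv,
      finsum_curry _ hfinF]
    refine finsum_congr fun y => ?_
    rw [finsum_curry _ (hasFiniteSupport_prodMk hfinF y)]

end TriTensor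

/-! ### From the double pole to the commutator of the parafermion coefficients -/

/-- Two sequences with the same second difference, supported on opposite half lines, differ by an
affine function whose value is determined by the second difference. -/
theorem sub_eq_finsum_secondDifference {M : Type*} [AddCommGroup M] [Module ℂ M] {f g P : ℤ → M}
    (hf : ∀ j, f (j + 2) - (2 : ℂ) • f (j + 1) + f j = P j)
    (hg : ∀ j, g (j + 2) - (2 : ℂ) • g (j + 1) + g j = P j)
    {a b : ℤ} (ha : ∀ j < a, f j = 0) (hb : ∀ j > b, g j = 0) :
    (Function.HasFiniteSupport P) ∧ f 0 - g 0 = ∑ᶠ j : ℤ, (-1 - j : ℂ) • P j := by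
  have hPa : ∀ j < a - 2, P j = 0 := fun j hj => by
    rw [← hf, ha _ (by omega), ha _ (by omega), ha _ (by omega)]; simp
  have hPb : ∀ j > b, P j = 0 := fun j hj => by
    rw [← hg, hb _ (by omega), hb _ (by omega), hb _ (by omega)]; simp
  refine ⟨(Set.finite_Icc (a - 2) b).subset fun j hj => ?_, ?_⟩
  · by_contra h
    rw [Set.mem_Icc, not_and_or, not_le, not_le] at h
    exact hj (h.elim (hPa j) (hPb j))
  -- `τ u j` is the value at 0 of the affine function through the points of `u` at j and j + 1. Its
  -- increments involve only the second difference; it vanishes far to the left for `f` and far to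
  -- the right for `g`, and `τ f - τ g` is constant, equal to its value `f 0 - g 0` at j = 0.
  let τ : (ℤ → M) → ℤ → M := fun u j => (-j : ℂ) • (u (j + 1) - u j) + u j
  have hτ : ∀ (u : ℤ → M) j, τ u (j + 1) - τ u j =
      (-1 - j : ℂ) • (u (j + 2) - (2 : ℂ) • u (j + 1) + u j) := by
    intro u j
    simp only [τ, show j + 1 + 1 = j + 2 by ring]
    push_cast
    module
  obtain ⟨N, hN⟩ : ∃ N : ℕ, b < a - 2 + N := ⟨(b - (a - 2) + 1).toNat, by omega⟩
  have hsum : ∀ N : ℕ, ∑ i ∈ Finset.range N, (-1 - ((a - 2 + i : ℤ) : ℂ)) • P (a - 2 + i) =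
      τ f (a - 2 + N) := by
    intro N
    induction N with
    | zero => simp only [τ]; simp [ha (a - 2 + 1) (by omega), ha (a - 2) (by omega)]
    | succ N ih =>
      rw [Finset.sum_range_succ, ih, ← hf, ← hτ, Nat.cast_succ, ← add_assoc]
      abel
  have hconst : ∀ j : ℤ, τ f j - τ g j = f 0 - g 0 := by
    have hstep : ∀ j, τ f (j + 1) - τ g (j + 1) = τ f j - τ g j := fun j => by
      rw [sub_eq_sub_iff_sub_eq_sub, hτ, hτ, hf, hg]
    intro j
    induction j using Int.induction_on with
    | zero => simp [τ]
    | succ j ih => rw [hstep, ih]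
    | pred j ih => rw [← ih, ← hstep (-j - 1), sub_add_cancel]
  have hτg : τ g (a - 2 + N) = 0 := by
    simp only [τ]; rw [hb _ (by omega), hb _ (by omega)]; simp
  rw [← hconst (a - 2 + N), hτg, sub_zero, ← hsum]
  rw [finsum_eq_of_injective (f := fun j : ℤ => (-1 - j : ℂ) • P j)
    (g := fun i : ℕ => (-1 - ((a - 2 + i : ℤ) : ℂ)) • P (a - 2 + i))
    (e := fun i : ℕ => a - 2 + (i : ℤ)) (e' := id)]
  · refine (finsum_eq_sum_of_support_subset _ fun i hi => ?_).symm
    by_contra h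
    rw [Finset.coe_range, Set.mem_Iio, not_lt] at h
    refine hi ?_
    simp only
    rw [hPb _ (by omega), smul_zero]
  · intro i j h
    simpa using h
  · exact Function.injective_id
  · intro j hj
    by_contra h
    refine hj ?_
    rw [hPa j (by
      by_contra h'
      exact h ⟨(j - (a - 2)).toNat, by simp only; omega⟩), smul_zero]
  · exact fun b _ => ⟨b, rfl⟩
  · exact fun _ => rfl

namespace ParafermionSpace

variable {k : ℕ} {W : Type*} [AddCommGroup W] [Module ℂ W]

theorem opeCoeff_eq_zero_of_gt {A B : ℚ → Module.End ℂ W} {w : W} {N : ℚ}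
    (hN : ∀ r > N, B r w = 0) (a r : ℚ) {t : ℚ} (ht : N < t) : opeCoeff a A B r t w = 0 := by
  refine (finsum_congr fun l : ℕ => ?_).trans finsum_zero
  rw [hN (t + l) (by have : (0 : ℚ) ≤ l := l.cast_nonneg; linarith), map_zero, smul_zero]

variable (P : ParafermionSpace k W)

theorem exponent_opeCoeff {n : ℤ} {w : W} (hw : w ∈ P.charge n) (r t : ℚ)
    (h : opeCoeff (2 / k) P.A P.Astar r t w ≠ 0) : ∃ i : ℤ, r = -(2 * n / k) + i := by
  by_contra hc
  refine h ((finsum_congr fun l : ℕ => ?_).trans finsum_zero)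
  by_contra hl
  have h1 : P.A (r + 2 / k - l) (P.Astar (t + l) w) ≠ 0 := fun h0 => hl (by rw [h0, smul_zero])
  obtain ⟨i, hi⟩ := P.A_exponent (n - 1) _ _ (P.Astar_charge n _ w hw) h1
  refine hc ⟨l - i, ?_⟩
  push_cast at hi ⊢
  linear_combination -hi

/-- Along an antidiagonal, multiplication by (z - w)² is the second difference. The two expansions
vanish at opposite ends, since `Astar` kills w on one side and `A` on the other, so their difference
is a weighted sum of the coefficients of P(z, w). The two contraction axioms evaluate that sum. -/
theorem contraction_apply {n : ℤ} {w : W} (hw : w ∈ P.charge n) (i : ℤ) {R : ℚ}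
    (hR : R = -(2 * n / k) + i) (T : ℚ) :
    opeCoeff (2 / k) P.A P.Astar R T w - opeCoeff (2 / k) P.Astar P.A T R w =
      (if R + T = 0 then (-(k : ℂ)) * R else 0) • w := by
  obtain ⟨N, hN⟩ := P.Astar_field w
  obtain ⟨N', hN'⟩ := P.A_field w
  obtain ⟨a, ha⟩ := exists_int_lt (T - N)
  obtain ⟨b, hb⟩ := exists_int_gt (N' - R)
  set f : ℤ → W := fun j => opeCoeff (2 / k) P.A P.Astar (R + j) (T - j) w with hf
  set g : ℤ → W := fun j => opeCoeff (2 / k) P.Astar P.A (T - j) (R + j) w with hg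
  set Q : ℚ → W := fun r => mulSqSub (fun r t => opeCoeff (2 / k) P.A P.Astar r t w) r
    (R + T - 2 - r) with hQ
  have hfQ : ∀ j, f (j + 2) - (2 : ℂ) • f (j + 1) + f j = Q (R + j) := by
    intro j
    simp only [hf, hQ, mulSqSub]
    push_cast
    rw [show R + ((j : ℚ) + 2) = R + j + 2 by ring, show R + ((j : ℚ) + 1) = R + j + 1 by ring,
      show R + T - 2 - (R + (j : ℚ)) + 2 = T - j by ring,
      show R + T - 2 - (R + (j : ℚ)) + 1 = T - (j + 1) by ring,
      show R + T - 2 - (R + (j : ℚ)) = T - (j + 2) by ring]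
  have hgQ : ∀ j, g (j + 2) - (2 : ℂ) • g (j + 1) + g j = Q (R + j) := by
    intro j
    simp only [hg, hQ]
    rw [P.A_Astar]
    simp only [mulSqSub]
    push_cast
    rw [show R + ((j : ℚ) + 2) = R + j + 2 by ring, show R + ((j : ℚ) + 1) = R + j + 1 by ring,
      show R + T - 2 - (R + (j : ℚ)) + 2 = T - j by ring,
      show R + T - 2 - (R + (j : ℚ)) + 1 = T - (j + 1) by ring,
      show R + T - 2 - (R + (j : ℚ)) = T - (j + 2) by ring]
  obtain ⟨hfin, key⟩ := sub_eq_finsum_secondDifference hfQ hgQ (a := a) (b := b)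
    (fun j hj => opeCoeff_eq_zero_of_gt hN _ _ (by
      have : (j : ℚ) ≤ a := by exact_mod_cast hj.le
      linarith))
    (fun j hj => opeCoeff_eq_zero_of_gt hN' _ _ (by
      have : (b : ℚ) ≤ j := by exact_mod_cast hj.le
      linarith))
  -- The contraction axioms sum over all rational r. On a vector of charge nα only the coset -2n/k +
  -- ℤ contributes, and it contains R.
  have hsupp : ∀ r, Q r ≠ 0 → r ∈ Set.range fun j : ℤ => R + (j : ℚ) := by
    intro r hr
    have : ∃ i : ℤ, r = -(2 * n / k) + i := by
      by_contra hc
      refine hr ?_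
      have h0 : ∀ (d : ℤ) (t : ℚ), opeCoeff (2 / k) P.A P.Astar (r + d) t w = 0 := by
        intro d t
        by_contra h
        obtain ⟨i, hi⟩ := P.exponent_opeCoeff hw _ _ h
        exact hc ⟨i - d, by push_cast; linear_combination hi⟩
      have h1 := h0 1
      have h2 := h0 2
      have h3 := h0 0
      push_cast at h1 h2 h3
      rw [add_zero] at h3
      simp only [hQ, mulSqSub]
      rw [h1, h2, h3]; simp
    obtain ⟨i', hi'⟩ := this
    exact ⟨i' - i, by push_cast; rw [hR, hi']; ring⟩
  have hinj : Function.Injective fun j : ℤ => R + (j : ℚ) := fun i j h => by simpa using h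
  have h1 : ∑ᶠ j : ℤ, Q (R + j) = if R + T - 2 = -2 then (-(k : ℂ)) • w else 0 := by
    rw [← P.contraction (R + T - 2) w]
    exact (finsum_eq_of_injective hinj Function.injective_id hsupp (fun b _ => ⟨b, rfl⟩)
      fun _ => rfl).symm
  have h2 : ∑ᶠ j : ℤ, (-((R + j : ℚ) : ℂ)) • Q (R + j) =
      if R + T - 2 = -2 then (-(k : ℂ)) • w else 0 := by
    rw [← P.contraction_deriv (R + T - 2) w]
    exact (finsum_eq_of_injective (f := fun r : ℚ => (-(r : ℂ)) • Q r) hinj Function.injective_id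
      (fun r hr => hsupp r fun h => hr (by simp only [h, smul_zero])) (fun b _ => ⟨b, rfl⟩)
      fun _ => rfl).symm
  -- The weight splits as -1 - j = (R - 1) - (R + j). Value and derivative on the diagonal both
  -- equal -k, so the total is (R - 1)(-k) - k = -kR.
  have h3 : ∑ᶠ j : ℤ, (-1 - j : ℂ) • Q (R + j) = (R - 1 : ℂ) • ∑ᶠ j : ℤ, Q (R + j) +
      ∑ᶠ j : ℤ, (-((R + j : ℚ) : ℂ)) • Q (R + j) := by
    rw [smul_finsum, ← finsum_add_distrib]
    · refine finsum_congr fun j => ?_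
      rw [← add_smul]; push_cast; congr 1; ring
    · exact hfin.subset fun j hj h => hj (by simp only [h, smul_zero])
    · exact hfin.subset fun j hj h => hj (by simp only [h, smul_zero])
  have hc : R + T - 2 = -2 ↔ R + T = 0 := by constructor <;> intro h <;> linarith
  simp only [hf, hg, Int.cast_zero, add_zero, sub_zero] at key
  rw [key, h3, h1, h2]
  simp only [hc]
  split_ifs
  · module
  · simp

end ParafermionSpace

/-! ### Heisenberg relations and the normally ordered sum that yields H -/

namespace Fock

theorem heis_commutator_int (k : ℕ) (m n : ℤ) : heis k m * heis k n - heis k n * heis k m =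
    if m + n = 0 then (-2 * (m : ℂ) * k) • (1 : Module.End ℂ Fock) else 0 := by
  have hcases : ∀ m : ℤ, m = 0 ∨ (∃ i : ℕ, m = i + 1) ∨ ∃ i : ℕ, m = -((i : ℤ) + 1) := by
    intro m
    rcases lt_trichotomy m 0 with h | h | h
    · exact Or.inr (Or.inr ⟨(-m - 1).toNat, by omega⟩)
    · exact Or.inl h
    · exact Or.inr (Or.inl ⟨(m - 1).toNat, by omega⟩)
  rcases hcases m with rfl | ⟨i, rfl⟩ | ⟨i, rfl⟩
  · rw [heis_zero, zero_mul, mul_zero, sub_zero]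
    split_ifs with h
    · rw [Int.cast_zero, mul_zero, zero_mul, zero_smul]
    · rfl
  · rcases hcases n with rfl | ⟨j, rfl⟩ | ⟨j, rfl⟩
    · rw [heis_zero, zero_mul, mul_zero, sub_zero, if_neg (by omega)]
    · rw [(heis_pos_commute k i j).eq, sub_self, if_neg (by omega)]
    · rw [heis_commutator]
      push_cast
      exact if_congr (by omega) rfl rfl
  · rcases hcases n with rfl | ⟨j, rfl⟩ | ⟨j, rfl⟩
    · rw [heis_zero, zero_mul, mul_zero, sub_zero, if_neg (by omega)]
    · rw [← neg_sub, heis_commutator]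
      by_cases h : i = j
      · subst h
        rw [if_pos rfl, if_pos (by omega)]
        refine (neg_smul _ _).symm.trans ?_
        congr 1; push_cast; ring
      · rw [if_neg h, if_neg (by omega), neg_zero]
    · rw [(heis_neg_commute k i j).eq, sub_self, if_neg (by omega)]

theorem degree_heis (k : ℕ) (m : ℤ) :
    degree * heis k m - heis k m * degree = (m : ℂ) • heis k m := by
  rcases lt_trichotomy m 0 with h | rfl | h
  · obtain ⟨i, rfl⟩ : ∃ i : ℕ, m = -((i : ℤ) + 1) := ⟨(-m - 1).toNat, by omega⟩
    rw [degree_heis_neg]; push_cast; congr 1; ring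
  · rw [heis_zero, zero_mul, mul_zero, sub_zero, smul_zero]
  · obtain ⟨i, rfl⟩ : ∃ i : ℕ, m = (i : ℤ) + 1 := ⟨(m - 1).toNat, by omega⟩
    rw [degree_heis_pos]; push_cast; congr 1; ring

variable {k : ℕ}

/-- The weight is affine in p and q, so the sum separates: the ρ part gives the product of the
exponentials with their inverses, the p part the logarithmic derivative of E₊⁺, and the q part that
of E₋⁺. In the last two, the factor that is not differentiated is trivial and forces j = 0 or i = 0.
-/
theorem finsum_finsum_normalOrdered (hk : k ≠ 0) (ρ : ℂ) (i j : ℤ) (s : Fock) :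
    ∑ᶠ (p : ℤ) (q : ℤ), (-(k : ℂ) * (ρ + p - q)) • (plusMode k 1 p * plusMode k (-1) (i - p))
        ((minusMode k 1 q * minusMode k (-1) (j - q)) s) =
      (if i = 0 ∧ j = 0 then (-(k : ℂ) * ρ) • s else 0) +
        (if 0 < i ∧ j = 0 then heis k (-i) s else 0) +
        (if i = 0 ∧ 0 < j then heis k j s else 0) := by
  have hfm : ∀ c : ℤ → ℂ, Function.HasFiniteSupport fun q : ℤ =>
      c q • (minusMode k 1 q * minusMode k (-1) (j - q)) := fun c => by
    have := ExpRecursion.hasFiniteSupport_mul (minusMode_of_neg k 1) (minusMode_of_neg k (-1)) 0 j c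
    simpa only [sub_zero] using this
  have hfp : ∀ c : ℤ → ℂ, Function.HasFiniteSupport fun q : ℤ =>
      c q • (plusMode k 1 q * plusMode k (-1) (i - q)) := fun c => by
    have := ExpRecursion.hasFiniteSupport_mul (plusMode_of_neg k 1) (plusMode_of_neg k (-1)) 0 i c
    simpa only [sub_zero] using this
  have hq : ∀ c : ℂ, ∑ᶠ q : ℤ, (-(k : ℂ) * (c - q)) •
      (minusMode k 1 q * minusMode k (-1) (j - q)) =
      (-(k : ℂ) * c) • (if j = 0 then 1 else 0) + if 0 < j then heis k j else 0 := by
    intro c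
    rw [← finsum_minusMode_mul, ← finsum_smul_minusMode_mul hk, smul_finsum, smul_finsum,
      ← finsum_add_distrib]
    · refine finsum_congr fun q => ?_
      refine Eq.trans ?_ (congrArg (_ + ·) (smul_smul _ _ _).symm)
      refine Eq.trans ?_ (add_smul _ _ _)
      congr 1; ring
    · exact hfm _
    · have := hfm fun q => (k : ℂ) * q
      simpa only [mul_smul] using this
  have hp : ∑ᶠ p : ℤ, (-(k : ℂ) * (ρ + p)) • (plusMode k 1 p * plusMode k (-1) (i - p)) =
      (-(k : ℂ) * ρ) • (if i = 0 then 1 else 0) + if 0 < i then heis k (-i) else 0 := by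
    rw [← finsum_plusMode_mul, ← finsum_smul_plusMode_mul hk, smul_finsum, smul_finsum,
      ← finsum_add_distrib]
    · refine finsum_congr fun q => ?_
      refine Eq.trans ?_ (congrArg (_ + ·) (smul_smul _ _ _).symm)
      refine Eq.trans ?_ (add_smul _ _ _)
      congr 1; ring
    · exact hfp _
    · have := hfp fun q => (-k : ℂ) * q
      simpa only [mul_smul] using this
  have hin : ∀ p : ℤ, ∑ᶠ q : ℤ, (-(k : ℂ) * (ρ + p - q)) •
      (plusMode k 1 p * plusMode k (-1) (i - p))
        ((minusMode k 1 q * minusMode k (-1) (j - q)) s) =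
      ((-(k : ℂ) * (ρ + p)) • (plusMode k 1 p * plusMode k (-1) (i - p)))
        ((if j = 0 then (1 : Module.End ℂ Fock) else 0) s) +
      ((1 : ℂ) • (plusMode k 1 p * plusMode k (-1) (i - p)))
        ((if 0 < j then heis k j else 0) s) := by
    intro p
    have h1 := congrArg (fun T : Module.End ℂ Fock =>
      (plusMode k 1 p * plusMode k (-1) (i - p)) (T s)) (hq (ρ + p))
    rw [LinearMap.add_apply, map_add, LinearMap.smul_apply, map_smul] at h1
    rw [one_smul, LinearMap.smul_apply, ← h1]
    refine ((map_finsum ((plusMode k 1 p * plusMode k (-1) (i - p)).comp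
      (LinearMap.applyₗ s)) (hfm _)).trans (finsum_congr fun q => ?_)).symm
    exact map_smul ((plusMode k 1 p * plusMode k (-1) (i - p)).comp (LinearMap.applyₗ s)) _ _
  rw [finsum_congr hin, finsum_add_distrib]
  · have e1 := (map_finsum (LinearMap.applyₗ ((if j = 0 then (1 : Module.End ℂ Fock) else 0) s) :
      Module.End ℂ Fock →ₗ[ℂ] Fock) (hfp fun p => -(k : ℂ) * (ρ + p))).symm
    have e2 := (map_finsum (LinearMap.applyₗ ((if 0 < j then heis k j else 0) s) :
      Module.End ℂ Fock →ₗ[ℂ] Fock) (hfp fun p => 1)).symm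
    refine (congrArg₂ (· + ·) e1 e2).trans ?_
    simp only [one_smul]
    rw [hp, finsum_plusMode_mul]
    simp only [LinearMap.applyₗ_apply_apply, LinearMap.add_apply, LinearMap.smul_apply]
    by_cases hi : i = 0 <;> by_cases hj : j = 0
    · subst hi; subst hj; simp
    · subst hi; simp [hj, apply_ite (fun T : Module.End ℂ Fock => T s)]
    · subst hj; simp [hi, apply_ite (fun T : Module.End ℂ Fock => T s)]
    · simp [hi, hj]
  · exact (hfp _).subset fun p hp h => hp (by simp only at h ⊢; rw [h, LinearMap.zero_apply])
  · exact (hfp _).subset fun p hp h => hp (by simp only at h ⊢; rw [h, LinearMap.zero_apply])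

/-- The relabelling `(j, i, p, q) ↦ (i - p, j - q, p, q)`. -/
def antidiagonalEquiv : ℤ × ℤ × ℤ × ℤ ≃ (ℤ × ℤ) × (ℤ × ℤ) where
  toFun x := ((x.2.1 - x.2.2.1, x.1 - x.2.2.2), (x.2.2.1, x.2.2.2))
  invFun z := (z.1.2 + z.2.2, z.1.1 + z.2.1, z.2.1, z.2.2)
  left_inv x := by simp
  right_inv z := by simp

theorem hasFiniteSupport_normalOrdered (m : ℤ) (c : ℤ × ℤ × ℤ × ℤ → ℂ) (s : Fock) :
    Function.HasFiniteSupport fun x : ℤ × ℤ × ℤ × ℤ =>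
      if m + x.2.1 - x.1 = 0 then c x • (plusMode k 1 x.2.2.1 * plusMode k (-1) (x.2.1 - x.2.2.1))
        ((minusMode k 1 x.2.2.2 * minusMode k (-1) (x.1 - x.2.2.2)) s) else 0 := by
  obtain ⟨Q, hQ⟩ := exists_bounded s
  refine ((Set.finite_Icc 0 (Q : ℤ)).prod ((Set.finite_Icc 0 (Q - m : ℤ)).prod
    ((Set.finite_Icc 0 (Q - m : ℤ)).prod (Set.finite_Icc 0 (Q : ℤ))))).subset ?_
  rintro ⟨j, i, p, q⟩ hx
  rw [Function.mem_support] at hx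
  simp only [Module.End.mul_apply] at hx
  have hij : m + i - j = 0 := by
    by_contra h
    exact hx (if_neg h)
  rw [if_pos hij] at hx
  have hp : 0 ≤ p := by
    by_contra h
    exact hx (by rw [plusMode_of_neg k 1 p (by omega), LinearMap.zero_apply, smul_zero])
  have hp' : 0 ≤ i - p := by
    by_contra h
    exact hx (by rw [plusMode_of_neg k (-1) (i - p) (by omega), LinearMap.zero_apply, map_zero,
      smul_zero])
  have hq : 0 ≤ q := by
    by_contra h
    exact hx (by rw [minusMode_of_neg k 1 q (by omega), LinearMap.zero_apply, map_zero, map_zero,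
      smul_zero])
  have hq' : 0 ≤ j - q := by
    by_contra h
    exact hx (by rw [minusMode_of_neg k (-1) (j - q) (by omega), LinearMap.zero_apply, map_zero,
      map_zero, map_zero, smul_zero])
  have hjQ : j ≤ Q := by
    by_contra h
    exact hx (by rw [eq_zero_of_bounded (by omega) (minusMode_bounded 1 q _
      (minusMode_bounded (-1) (j - q) Q hQ)), map_zero, map_zero, smul_zero])
  refine ⟨⟨?_, ?_⟩, ⟨?_, ?_⟩, ⟨?_, ?_⟩, ?_, ?_⟩ <;> simp only <;> omega

/-- The weight is the value of `contraction_apply` at the indices occurring in [X, Y]. Grouping by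
the total orders i of E₊ and j of E₋ reduces the sum to the previous lemma on the line j - i = m. -/
theorem finsum_normalOrdered (hk : k ≠ 0) (ρ : ℂ) (m : ℤ) (s : Fock) :
    ∑ᶠ z : (ℤ × ℤ) × (ℤ × ℤ), (if m + z.2.1 - z.2.2 + z.1.1 - z.1.2 = 0 then
        -(k : ℂ) * (ρ + z.2.1 - z.2.2) else 0) •
      plusMode k 1 z.2.1 (plusMode k (-1) z.1.1 (minusMode k 1 z.2.2 (minusMode k (-1) z.1.2 s))) =
      heis k m s + (if m = 0 then -(k : ℂ) * ρ else 0) • s := by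
  have hfin := hasFiniteSupport_normalOrdered (k := k) m
    (fun x => -(k : ℂ) * (ρ + x.2.2.1 - x.2.2.2)) s
  rw [← finsum_comp_equiv antidiagonalEquiv]
  have h1 : ∀ x, (if m + (antidiagonalEquiv x).2.1 - (antidiagonalEquiv x).2.2 +
      (antidiagonalEquiv x).1.1 - (antidiagonalEquiv x).1.2 = 0 then
        -(k : ℂ) * (ρ + (antidiagonalEquiv x).2.1 - (antidiagonalEquiv x).2.2) else 0) •
      plusMode k 1 (antidiagonalEquiv x).2.1 (plusMode k (-1) (antidiagonalEquiv x).1.1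
        (minusMode k 1 (antidiagonalEquiv x).2.2 (minusMode k (-1) (antidiagonalEquiv x).1.2 s))) =
      if m + x.2.1 - x.1 = 0 then (-(k : ℂ) * (ρ + x.2.2.1 - x.2.2.2)) •
        (plusMode k 1 x.2.2.1 * plusMode k (-1) (x.2.1 - x.2.2.1))
        ((minusMode k 1 x.2.2.2 * minusMode k (-1) (x.1 - x.2.2.2)) s) else 0 := by
    rintro ⟨j, i, p, q⟩
    change (if m + p - q + (i - p) - (j - q) = 0 then -(k : ℂ) * (ρ + p - q) else 0) •
      plusMode k 1 p (plusMode k (-1) (i - p) (minusMode k 1 q (minusMode k (-1) (j - q) s))) =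
      if m + i - j = 0 then (-(k : ℂ) * (ρ + p - q)) • plusMode k 1 p (plusMode k (-1) (i - p)
        (minusMode k 1 q (minusMode k (-1) (j - q) s))) else 0
    by_cases h : m + i - j = 0
    · rw [if_pos h, if_pos (by omega)]
    · rw [if_neg h, if_neg (by omega), zero_smul]
  rw [finsum_congr h1, finsum_curry₃ _ hfin]
  have h2 : ∀ j i : ℤ, (∑ᶠ c : ℤ × ℤ, if m + i - j = 0 then (-(k : ℂ) * (ρ + c.1 - c.2)) •
        (plusMode k 1 c.1 * plusMode k (-1) (i - c.1))
        ((minusMode k 1 c.2 * minusMode k (-1) (j - c.2)) s) else 0) =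
      if i = j - m then (if i = 0 ∧ j = 0 then (-(k : ℂ) * ρ) • s else 0) +
        (if 0 < i ∧ j = 0 then heis k (-i) s else 0) +
        (if i = 0 ∧ 0 < j then heis k j s else 0) else 0 := by
    intro j i
    rw [finsum_curry _ (hasFiniteSupport_prodMk (hasFiniteSupport_prodMk hfin j) i)]
    by_cases h : i = j - m
    · have h' : m + i - j = 0 := by omega
      simp only [if_pos h, if_pos h']
      exact finsum_finsum_normalOrdered hk ρ i j s
    · have h' : ¬ m + i - j = 0 := by omega
      simp only [if_neg h, if_neg h', finsum_zero]
  refine (finsum_congr fun j => finsum_congr fun i => h2 j i).trans ?_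
  have h3 : ∀ j : ℤ, (∑ᶠ i : ℤ, if i = j - m then
        (if i = 0 ∧ j = 0 then (-(k : ℂ) * ρ) • s else 0) +
        (if 0 < i ∧ j = 0 then heis k (-i) s else 0) +
        (if i = 0 ∧ 0 < j then heis k j s else 0) else 0) =
      (if j - m = 0 ∧ j = 0 then (-(k : ℂ) * ρ) • s else 0) +
        (if 0 < j - m ∧ j = 0 then heis k (-(j - m)) s else 0) +
        (if j - m = 0 ∧ 0 < j then heis k j s else 0) := by
    intro j
    rw [finsum_eq_single _ (j - m) fun i hi => if_neg hi, if_pos rfl]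
  rw [finsum_congr h3]
  -- One pair (i, j) survives in each case: (-m, 0) for m < 0, (0, 0) for m = 0 and (0, m) for m >
  -- 0.
  rcases lt_trichotomy m 0 with hm | rfl | hm
  · rw [finsum_eq_single _ 0]
    · rw [if_neg (by omega), if_pos (by omega), if_neg (by omega), if_neg (by omega)]
      simp
    · intro j hj
      rw [if_neg (by omega), if_neg (by omega), if_neg (by omega)]
      simp
  · rw [finsum_eq_single _ 0]
    · simp [heis_zero]
    · intro j hj
      rw [if_neg (by omega), if_neg (by omega), if_neg (by omega)]
      simp
  · rw [finsum_eq_single _ m]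
    · rw [if_neg (by omega), if_neg (by omega), if_pos (by omega), if_neg (by omega)]
      simp
    · intro j hj
      rw [if_neg (by omega), if_neg (by omega), if_neg (by omega)]
      simp

end Fock

/-! ### Commutators with H and with the degree; vertex operators of equal charge -/

namespace TriTensor

variable {W : Type*} [AddCommGroup W] [Module ℂ W]

theorem H_tmul (k : ℕ) (m : ℤ) (s : Fock) (w : W) (n : ℤ) :
    H k m (tmul s w n) = tmul (Fock.heis k m s) w n +
      (if m = 0 then (2 * n : ℂ) else 0) • tmul s w n := by
  rw [H, LinearMap.add_apply, op_one_tmul, Module.End.one_apply]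
  congr 1
  split_ifs
  · rw [LatticeAlg.alphaZero, op_diag_tmul]; rfl
  · rw [LinearMap.zero_apply, zero_smul]

theorem H_lie_H_apply (k : ℕ) (m n : ℤ) (v : TriTensor W) :
    H k m (H k n v) - H k n (H k m v) = (if m + n = 0 then -2 * (m : ℂ) * k else 0) • v := by
  induction v using tensor_induction with
  | h0 => simp
  | hadd x y hx hy =>
    rw [smul_add, ← hx, ← hy]
    simp only [map_add]; abel
  | ht s w l =>
    have h := congrArg (fun T => tmul (T s) w l) (Fock.heis_commutator_int k m n)
    simp only [LinearMap.sub_apply, Module.End.mul_apply, tmul_sub_left] at h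
    have h' : tmul ((if m + n = 0 then (-2 * (m : ℂ) * k) • (1 : Module.End ℂ Fock) else 0) s) w l =
        (if m + n = 0 then -2 * (m : ℂ) * k else 0) • tmul s w l := by
      split_ifs
      · rw [LinearMap.smul_apply, Module.End.one_apply, tmul_smul_left]
      · rw [LinearMap.zero_apply, tmul_zero_left, zero_smul]
    rw [← h', ← h]
    simp only [H_tmul, map_add, map_smul]
    module

theorem hasFiniteSupport_vertexTerm' (k : ℕ) (ε : ℤ) {A : ℚ → Module.End ℂ W}
    (hA : IsFieldSeries A) (r : ℚ) (s : Fock) (w : W) (n : ℤ) (T : Module.End ℂ (TriTensor W)) :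
    Function.HasFiniteSupport fun x : ℤ × ℤ =>
      T (tmul (Fock.plusMode k ε x.1 (Fock.minusMode k ε x.2 s)) (A (r + x.1 - x.2) w) n) :=
  (hasFiniteSupport_vertexTerm k ε hA r s w n).subset fun x hx h => hx
    (by simp only at h ⊢; rw [h, map_zero])

open Fock in
theorem H_lie_vertex_apply {k : ℕ} (hk : k ≠ 0) (ε : ℤ) {A : ℚ → Module.End ℂ W}
    (hA : IsFieldSeries A) (m : ℤ) (r : ℚ) (v : TriTensor W) :
    H k m (vertex k ε hA r v) - vertex k ε hA r (H k m v) =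
      (2 * ε : ℂ) • vertex k ε hA (r + m) v := by
  induction v using tensor_induction with
  | h0 => simp
  | hadd x y hx hy =>
    rw [map_add (vertex k ε hA (r + m)), smul_add, ← hx, ← hy]
    simp only [map_add]; abel
  | ht s w n =>
    rcases eq_or_ne m 0 with rfl | hm
    · simp only [H_tmul, heis_zero, LinearMap.zero_apply, tmul_zero_left, if_true, zero_add, map_smul,
        vertex_tmul, Int.cast_zero, add_zero]
      rw [map_finsum _ (hasFiniteSupport_vertexTerm k ε hA _ s w _), smul_finsum, smul_finsum,
        ← finsum_sub_distrib]
      · refine finsum_congr fun x => ?_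
        rw [H_tmul, heis_zero, LinearMap.zero_apply, tmul_zero_left, zero_add, if_pos rfl, ← sub_smul]
        push_cast; congr 1; ring
      · exact hasFiniteSupport_vertexTerm' k ε hA _ s w _ _
      · exact hasFiniteSupport_vertexTerm' k ε hA _ s w _ ((2 * n : ℂ) • 1)
    -- A positive mode commutes with E₋ and shifts the order in E₊ by m; a negative mode commutes
    -- with E₊ and shifts the order in E₋ by -m. The two maxima treat both signs at once, and their
    -- difference m is the shift of the index of `A`.
    · have hx : ∀ x : ℤ × ℤ, heis k m (plusMode k ε x.1 (minusMode k ε x.2 s)) -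
          plusMode k ε x.1 (minusMode k ε x.2 (heis k m s)) =
          (2 * ε : ℂ) • plusMode k ε (x.1 - max m 0) (minusMode k ε (x.2 - max (-m) 0) s) := by
        rintro ⟨p, q⟩
        simp only
        rcases lt_or_gt_of_ne hm with h | h
        · obtain ⟨i, rfl⟩ : ∃ i : ℕ, m = -((i : ℤ) + 1) := ⟨(-m - 1).toNat, by omega⟩
          have h1 := congrArg (fun T => T (minusMode k ε q s)) (heis_neg_commute_plusMode k ε i p).eq
          have h2 := congrArg (fun T => plusMode k ε p (T s)) (heis_neg_minusMode ε hk i q)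
          simp only [Module.End.mul_apply, LinearMap.sub_apply, LinearMap.smul_apply, map_sub,
            map_smul] at h1 h2
          rw [h1, h2, max_eq_right (by omega), max_eq_left (by omega), sub_zero, neg_neg]
        · obtain ⟨i, rfl⟩ : ∃ i : ℕ, m = (i : ℤ) + 1 := ⟨(m - 1).toNat, by omega⟩
          have h1 := congrArg (fun T => plusMode k ε p (T s)) (heis_pos_commute_minusMode k ε i q).eq
          have h2 := congrArg (fun T => T (minusMode k ε q s)) (heis_pos_plusMode ε hk i p)
          simp only [Module.End.mul_apply, LinearMap.sub_apply, LinearMap.smul_apply] at h1 h2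
          rw [← h1, h2, max_eq_left (by omega), max_eq_right (by omega), sub_zero]
      simp only [H_tmul, if_neg hm, zero_smul, add_zero, vertex_tmul]
      rw [map_finsum _ (hasFiniteSupport_vertexTerm k ε hA _ s w _), ← finsum_sub_distrib
        (hasFiniteSupport_vertexTerm' k ε hA _ s w _ _) (hasFiniteSupport_vertexTerm k ε hA _ _ w _),
        ← finsum_comp_equiv ((Equiv.addRight (max m 0)).prodCongr (Equiv.addRight (max (-m) 0))),
        smul_finsum]
      refine finsum_congr fun x => ?_
      rw [H_tmul, if_neg hm, zero_smul, add_zero, ← tmul_sub_left, hx, tmul_smul_left]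
      simp only [Equiv.prodCongr_apply, Prod.map, Equiv.coe_addRight, add_sub_cancel_right]
      have hmax : max m 0 - max (-m) 0 = m := by omega
      rw [show r - 2 * ε * n / k + ((x.1 + max m 0 : ℤ) : ℚ) - ((x.2 + max (-m) 0 : ℤ) : ℚ) =
        r + (m : ℚ) - 2 * ε * n / k + x.1 - x.2 by
          have := congrArg (fun z : ℤ => (z : ℚ)) hmax
          simp only [Int.cast_sub] at this
          rw [Int.cast_add, Int.cast_add]
          linear_combination this]

/-- The sum of the degree operators of the three factors. -/
noncomputable def degreeOp (k : ℕ) (D : Module.End ℂ W) : Module.End ℂ (TriTensor W) :=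
  op Fock.degree 1 1 + op 1 D 1 + op 1 1 (LatticeAlg.degree k)

theorem degreeOp_tmul (k : ℕ) (D : Module.End ℂ W) (s : Fock) (w : W) (n : ℤ) :
    degreeOp k D (tmul s w n) = tmul (Fock.degree s) w n + tmul s (D w) n +
      ((n : ℂ) ^ 2 / k) • tmul s w n := by
  rw [degreeOp, LinearMap.add_apply, LinearMap.add_apply, op_one_tmul, op_one_tmul,
    LatticeAlg.degree, op_diag_tmul]
  rfl

theorem degreeOp_lie_H_apply (k : ℕ) (D : Module.End ℂ W) (m : ℤ) (v : TriTensor W) :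
    degreeOp k D (H k m v) - H k m (degreeOp k D v) = (m : ℂ) • H k m v := by
  induction v using tensor_induction with
  | h0 => simp
  | hadd x y hx hy =>
    rw [map_add (H k m) x y, smul_add, ← hx, ← hy]
    simp only [map_add]; abel
  | ht s w n =>
    have h := congrArg (fun T => tmul (T s) w n) (Fock.degree_heis k m)
    simp only [LinearMap.sub_apply, Module.End.mul_apply, LinearMap.smul_apply, tmul_sub_left,
      tmul_smul_left] at h
    have h0 : (m : ℂ) • (if m = 0 then (2 * n : ℂ) else 0) • tmul s w n = 0 := by
      split_ifs with hm
      · rw [hm, Int.cast_zero, zero_smul]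
      · rw [zero_smul, smul_zero]
    rw [H_tmul, smul_add, h0, add_zero, ← h]
    simp only [map_add, map_smul, degreeOp_tmul, H_tmul]
    module

open Fock in
theorem degreeOp_lie_vertex_apply {k : ℕ} {ε : ℤ} (hε : ε * ε = 1) {A : ℚ → Module.End ℂ W}
    (hA : IsFieldSeries A) {D : Module.End ℂ W}
    (hD : ∀ (r : ℚ) (w : W), D (A r w) - A r (D w) = ((r : ℂ) - 1 / k) • A r w) (r : ℚ)
    (v : TriTensor W) :
    degreeOp k D (vertex k ε hA r v) - vertex k ε hA r (degreeOp k D v) =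
      (r : ℂ) • vertex k ε hA r v := by
  induction v using tensor_induction with
  | h0 => simp
  | hadd x y hx hy =>
    rw [map_add (vertex k ε hA r) x y, smul_add, ← hx, ← hy]
    simp only [map_add]; abel
  | ht s w n =>
    have hf := fun s w => hasFiniteSupport_vertexTerm k ε hA (r - 2 * ε * n / k) s w (n + ε)
    have hs : Function.HasFiniteSupport fun x : ℤ × ℤ => ((n : ℂ) ^ 2 / k) •
        tmul (plusMode k ε x.1 (minusMode k ε x.2 s)) (A (r - 2 * ε * n / k + x.1 - x.2) w)
          (n + ε) :=
      hasFiniteSupport_vertexTerm' k ε hA _ s w _ (((n : ℂ) ^ 2 / k) • 1)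
    have h12 : Function.HasFiniteSupport fun x : ℤ × ℤ =>
        tmul (plusMode k ε x.1 (minusMode k ε x.2 (degree s)))
          (A (r - 2 * ε * n / k + x.1 - x.2) w) (n + ε) +
        tmul (plusMode k ε x.1 (minusMode k ε x.2 s))
          (A (r - 2 * ε * n / k + x.1 - x.2) (D w)) (n + ε) :=
      ((hf _ _).union (hf _ _)).subset (Function.support_add _ _)
    simp only [degreeOp_tmul, map_add, map_smul, vertex_tmul]
    rw [map_finsum _ (hf s w), smul_finsum, smul_finsum, ← finsum_add_distrib (hf _ _) (hf _ _),
      ← finsum_add_distrib h12 hs,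
      ← finsum_sub_distrib (hasFiniteSupport_vertexTerm' k ε hA _ s w _ _)]
    · refine finsum_congr fun x => ?_
      have h1 := congrArg (fun T => T (minusMode k ε x.2 s)) (degree_plusMode k ε x.1)
      have h2 := congrArg (fun T => plusMode k ε x.1 (T s)) (degree_minusMode k ε x.2)
      simp only [Module.End.mul_apply, LinearMap.sub_apply, LinearMap.smul_apply, map_sub,
        map_smul] at h1 h2
      rw [degreeOp_tmul, eq_add_of_sub_eq h1, eq_add_of_sub_eq h2, eq_add_of_sub_eq (hD _ w)]
      simp only [← tmulBilin_apply, map_add, map_smul, LinearMap.add_apply, LinearMap.smul_apply]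
      have hε' : (ε : ℂ) * ε = 1 := by exact_mod_cast hε
      rw [← sub_eq_zero]
      push_cast
      -- The degrees -p + q from the exponentials, r - 2εn/k + p - q - 1/k from `A` and ((n + ε)² -
      -- n²)/k from the lattice add up to r, because ε² = 1.
      match_scalars <;> first | ring1 | linear_combination (1 / (k : ℂ)) * hε'
    · exact (h12.union hs).subset (Function.support_add _ _)

/-- In normally ordered form the exponentials commute and `opeCoeff` is symmetric by hypothesis, so
the two products differ by a relabelling. No matching of charges enters. -/
theorem vertex_comm_apply {k : ℕ} (hk : k ≠ 0) {ε : ℤ} (hε : ε * ε = 1) {A : ℚ → Module.End ℂ W}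
    (hA : IsFieldSeries A) (hAA : ∀ (r t : ℚ) (w : W),
      opeCoeff (-2 / k) A A r t w = opeCoeff (-2 / k) A A t r w) (r t : ℚ) (v : TriTensor W) :
    vertex k ε hA r (vertex k ε hA t v) = vertex k ε hA t (vertex k ε hA r v) := by
  induction v using tensor_induction with
  | h0 => simp
  | hadd x y hx hy => simp only [map_add, hx, hy]
  | ht s w n =>
    have ha : (-2 / k : ℚ) = -2 * ε * ε / k := by
      rw [mul_assoc, show (ε : ℚ) * ε = 1 by exact_mod_cast hε, mul_one]
    rw [(vertex_vertex_tmul hk ε ε ha hA hA r t s w n).2,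
      (vertex_vertex_tmul hk ε ε ha hA hA t r s w n).2,
      ← finsum_comp_equiv (Equiv.prodComm (ℤ × ℤ) (ℤ × ℤ))]
    refine finsum_congr fun z => ?_
    have h1 : ∀ u, Fock.plusMode k ε z.1.1 (Fock.plusMode k ε z.2.1 u) =
        Fock.plusMode k ε z.2.1 (Fock.plusMode k ε z.1.1 u) := fun u =>
      congrArg (fun T => T u) (Fock.plusMode_commute k ε ε z.1.1 z.2.1).eq
    have h2 : ∀ u, Fock.minusMode k ε z.1.2 (Fock.minusMode k ε z.2.2 u) =
        Fock.minusMode k ε z.2.2 (Fock.minusMode k ε z.1.2 u) := fun u =>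
      congrArg (fun T => T u) (Fock.minusMode_commute k ε ε z.1.2 z.2.2).eq
    simp only [Equiv.prodComm_apply, Prod.swap]
    rw [h1, h2, hAA]

end TriTensor

/-! ### The commutator of X and Y -/

namespace ParafermionSpace

open TriTensor

variable {k : ℕ} {W : Type*} [AddCommGroup W] [Module ℂ W] (P : ParafermionSpace k W)

theorem X_lie_Y_apply_tmul (hk : k ≠ 0) (r t : ℤ) (s : Fock) {n : ℤ} {w : W} (hw : w ∈ P.charge n) :
    P.X r (P.Y t (tmul s w n)) - P.Y t (P.X r (tmul s w n)) =
      TriTensor.H k (r + t) (tmul s w n) +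
        (if r + t = 0 then -(k : ℂ) * r else 0) • tmul s w n := by
  have ha : (2 / k : ℚ) = -2 * (1 : ℤ) * (-1 : ℤ) / k := by push_cast; ring
  have ha' : (2 / k : ℚ) = -2 * (-1 : ℤ) * (1 : ℤ) / k := by push_cast; ring
  obtain ⟨f1, e1⟩ := vertex_vertex_tmul hk 1 (-1) ha P.A_field P.Astar_field r t s w n
  obtain ⟨f2, e2⟩ := vertex_vertex_tmul hk (-1) 1 ha' P.Astar_field P.A_field t r s w n
  have f2' := f2.image (Equiv.prodComm (ℤ × ℤ) (ℤ × ℤ)).symm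
  rw [show n + -1 + 1 = n by ring] at f1 e1
  rw [show n + 1 + -1 = n by ring] at f2 e2
  rw [← finsum_comp_equiv (Equiv.prodComm (ℤ × ℤ) (ℤ × ℤ))] at e2
  rw [X, Y, e1, e2, ← finsum_sub_distrib f1]
  swap
  · refine f2'.subset fun z hz => ⟨Equiv.prodComm _ _ z, ?_, by simp⟩
    rw [show n + 1 + -1 = n by ring]
    exact hz
  -- With this ρ one has -kρ = 2n - kr: the eigenvalue of α(0) on e^{nα} plus the central term.
  set ρ : ℂ := r - 2 * n / k with hρ
  have hk' : (k : ℂ) ≠ 0 := by exact_mod_cast hk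
  have hterm : ∀ z : (ℤ × ℤ) × (ℤ × ℤ),
      tmul (Fock.plusMode k 1 z.2.1 (Fock.plusMode k (-1) z.1.1 (Fock.minusMode k 1 z.2.2
          (Fock.minusMode k (-1) z.1.2 s))))
        (opeCoeff (2 / k) P.A P.Astar (r - 2 * (1 : ℤ) * n / k + z.2.1 - z.2.2)
          (t - 2 * (-1 : ℤ) * n / k + z.1.1 - z.1.2) w) n -
      tmul (Fock.plusMode k (-1) z.1.1 (Fock.plusMode k 1 z.2.1 (Fock.minusMode k (-1) z.1.2
          (Fock.minusMode k 1 z.2.2 s))))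
        (opeCoeff (2 / k) P.Astar P.A (t - 2 * (-1 : ℤ) * n / k + z.1.1 - z.1.2)
          (r - 2 * (1 : ℤ) * n / k + z.2.1 - z.2.2) w) n =
      (tmulBilin n).flip w ((if r + t + z.2.1 - z.2.2 + z.1.1 - z.1.2 = 0 then
        -(k : ℂ) * (ρ + z.2.1 - z.2.2) else 0) • Fock.plusMode k 1 z.2.1
          (Fock.plusMode k (-1) z.1.1 (Fock.minusMode k 1 z.2.2 (Fock.minusMode k (-1) z.1.2 s)))) := by
    rintro ⟨⟨p', q'⟩, ⟨p, q⟩⟩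
    simp only
    have h1 : ∀ u, Fock.plusMode k (-1) p' (Fock.plusMode k 1 p u) =
        Fock.plusMode k 1 p (Fock.plusMode k (-1) p' u) := fun u =>
      congrArg (fun T => T u) (Fock.plusMode_commute k (-1) 1 p' p).eq
    have h2 : ∀ u, Fock.minusMode k (-1) q' (Fock.minusMode k 1 q u) =
        Fock.minusMode k 1 q (Fock.minusMode k (-1) q' u) := fun u =>
      congrArg (fun T => T u) (Fock.minusMode_commute k (-1) 1 q' q).eq
    -- Matched charges are essential here: the lattice shift -2n/k places the index of `A` in the
    -- coset that `contraction_apply` requires for w of charge nα.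
    rw [h1, h2, ← tmul_sub_right, P.contraction_apply hw (r + p - q) (by push_cast; ring),
      tmul_smul_right, map_smul, LinearMap.flip_apply, tmulBilin_apply]
    congr 1
    have hc : ((r : ℚ) - 2 * (1 : ℤ) * n / k + p - q + (t - 2 * (-1 : ℤ) * n / k + p' - q') = 0) ↔
        r + t + p - q + p' - q' = 0 := by
      rw [← Int.cast_inj (α := ℚ)]
      push_cast
      constructor <;> intro h <;> linear_combination h
    rw [if_congr hc rfl rfl, hρ]
    push_cast
    congr 2
    ring
  refine (finsum_congr hterm).trans ?_
  rw [← map_finsum, Fock.finsum_normalOrdered hk, LinearMap.flip_apply, H_tmul, map_add,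
    LinearMap.add_apply, map_smul, LinearMap.smul_apply, tmulBilin_apply, tmulBilin_apply, add_assoc,
    ← add_smul]
  · congr 2
    split_ifs
    · rw [hρ]; field_simp; ring
    · rw [add_zero]
  · have := Fock.hasFiniteSupport_normalOrdered (k := k) (r + t)
      (fun x => -(k : ℂ) * (ρ + x.2.2.1 - x.2.2.2)) s
    refine (this.image Fock.antidiagonalEquiv).subset fun z hz =>
      ⟨Fock.antidiagonalEquiv.symm z, ?_, by simp⟩
    obtain ⟨⟨p', q'⟩, p, q⟩ := z
    rw [Function.mem_support] at hz ⊢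
    change (if r + t + (p' + p) - (q' + q) = 0 then (-(k : ℂ) * (ρ + p - q)) •
      Fock.plusMode k 1 p (Fock.plusMode k (-1) (p' + p - p) (Fock.minusMode k 1 q
        (Fock.minusMode k (-1) (q' + q - q) s))) else 0) ≠ 0
    rw [add_sub_cancel_right, add_sub_cancel_right]
    intro h
    refine hz ?_
    simp only
    by_cases hc : r + t + (p' + p) - (q' + q) = 0
    · rw [if_pos hc] at h
      rw [if_pos (by omega), h]
    · rw [if_neg (by omega), zero_smul]

end ParafermionSpace

/-! ### From relations between modes to a representation of the affine algebra -/

theorem Sl2.apply_one_one (a : Sl2) : a.1 1 1 = -a.1 0 0 := by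
  have h : Matrix.trace a.1 = 0 := a.2
  rw [Matrix.trace_fin_two] at h
  linear_combination h

theorem Sl2.eq_smul_add (a : Sl2) :
    a = a.1 0 0 • Sl2.H + a.1 0 1 • Sl2.X + a.1 1 0 • Sl2.Y := by
  refine Subtype.ext (Matrix.ext fun i j => ?_)
  fin_cases i <;> fin_cases j <;> simp [Sl2.H, Sl2.X, Sl2.Y, apply_one_one a]

/-- Operators in an associative algebra that satisfy the relations of the modes `H(m)`, `X(m)`, `Y(m)`
and of the degree derivation of the affine Lie algebra at level `κ`. -/
structure AffineModes (R : Type*) [Ring R] [Algebra ℂ R] (κ : ℂ) where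
  /-- The modes `H(m)`. -/
  H : ℤ → R
  /-- The modes `X(m)`. -/
  X : ℤ → R
  /-- The modes `Y(m)`. -/
  Y : ℤ → R
  /-- The degree operator. -/
  D : R
  H_H : ∀ m n, ⁅H m, H n⁆ = (if m + n = 0 then 2 * (m : ℂ) * κ else 0) • (1 : R)
  X_X : ∀ m n, ⁅X m, X n⁆ = 0
  Y_Y : ∀ m n, ⁅Y m, Y n⁆ = 0
  H_X : ∀ m n, ⁅H m, X n⁆ = (2 : ℂ) • X (m + n)
  H_Y : ∀ m n, ⁅H m, Y n⁆ = (-2 : ℂ) • Y (m + n)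
  X_Y : ∀ m n, ⁅X m, Y n⁆ = H (m + n) + (if m + n = 0 then κ * (m : ℂ) else 0) • (1 : R)
  D_H : ∀ m, ⁅D, H m⁆ = (m : ℂ) • H m
  D_X : ∀ m, ⁅D, X m⁆ = (m : ℂ) • X m
  D_Y : ∀ m, ⁅D, Y m⁆ = (m : ℂ) • Y m

namespace AffineModes

variable {R : Type*} [Ring R] [Algebra ℂ R] {κ : ℂ} (M : AffineModes R κ)

/-- The operator of `a ⊗ t^m`. -/
noncomputable def mode (m : ℤ) : Sl2 →ₗ[ℂ] R where
  toFun a := a.1 0 0 • M.H m + a.1 0 1 • M.X m + a.1 1 0 • M.Y m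
  map_add' a b := by
    have h : ∀ i j, (a + b).1 i j = a.1 i j + b.1 i j := fun _ _ => rfl
    simp only [h]; module
  map_smul' c a := by
    have h : ∀ i j, (c • a).1 i j = c * a.1 i j := fun _ _ => rfl
    simp only [h, RingHom.id_apply]; module

theorem mode_apply (m : ℤ) (a : Sl2) :
    M.mode m a = a.1 0 0 • M.H m + a.1 0 1 • M.X m + a.1 1 0 • M.Y m := rfl

theorem mode_lie_mode (m n : ℤ) (a b : Sl2) : ⁅M.mode m a, M.mode n b⁆ =
    M.mode (m + n) ⁅a, b⁆ +
      ((if m + n = 0 then (m : ℂ) * Sl2.trForm a b else 0) * κ) • (1 : R) := by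
  have ha := Sl2.apply_one_one a
  have hb := Sl2.apply_one_one b
  have h : ∀ i j, (⁅a, b⁆ : Sl2).1 i j = (a.1 * b.1 - b.1 * a.1) i j := fun i j => by
    rw [LieAlgebra.SpecialLinear.sl_bracket]
  have htr : Sl2.trForm a b = 2 * a.1 0 0 * b.1 0 0 + a.1 0 1 * b.1 1 0 + a.1 1 0 * b.1 0 1 := by
    rw [Sl2.trForm, LinearMap.mk₂_apply, Matrix.trace_fin_two, Matrix.mul_apply, Matrix.mul_apply,
      Fin.sum_univ_two, Fin.sum_univ_two, ha, hb]
    ring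
  have e1 : ⁅M.X m, M.H n⁆ = -((2 : ℂ) • M.X (m + n)) := by
    rw [← lie_skew, M.H_X, add_comm]
  have e2 : ⁅M.Y m, M.H n⁆ = -((-2 : ℂ) • M.Y (m + n)) := by
    rw [← lie_skew, M.H_Y, add_comm]
  have e3 : ⁅M.Y m, M.X n⁆ = -(M.H (m + n) +
      (if m + n = 0 then κ * (n : ℂ) else 0) • (1 : R)) := by
    rw [← lie_skew, M.X_Y, add_comm n]
  simp only [mode_apply, h, Matrix.sub_apply, Matrix.mul_apply, Fin.sum_univ_two, ha, hb, add_lie,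
    lie_add, smul_lie, lie_smul, M.X_X, M.Y_Y, M.H_H, M.H_X, M.H_Y, M.X_Y, e1, e2, e3, htr]
  split_ifs with hmn
  · obtain rfl : n = -m := by omega
    push_cast
    module
  · module

/-- The operators of the loop algebra. -/
noncomputable def loopMap : LoopSl2 →ₗ[ℂ] R :=
  TensorProduct.lift ((AddMonoidAlgebra.basis ℤ ℂ).constr ℂ M.mode :
    AddMonoidAlgebra ℂ ℤ →ₗ[ℂ] Sl2 →ₗ[ℂ] R)

theorem loopMap_mono (a : Sl2) (m : ℤ) : M.loopMap (LoopSl2.mono a m) = M.mode m a := by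
  have h := (AddMonoidAlgebra.basis ℤ ℂ).constr_basis ℂ M.mode m
  rw [AddMonoidAlgebra.basis_apply] at h
  have h' : M.loopMap (LoopSl2.mono a m) = ((AddMonoidAlgebra.basis ℤ ℂ).constr ℂ M.mode :
    AddMonoidAlgebra ℂ ℤ →ₗ[ℂ] Sl2 →ₗ[ℂ] R) (AddMonoidAlgebra.single m 1) a :=
    TensorProduct.lift.tmul _ _
  rw [h', h]

/-- The loop algebra acts only projectively; the defect is the cocycle times the level, which the
central element absorbs in `toLieHom`. -/
theorem loopMap_lie (f g : LoopSl2) : ⁅M.loopMap f, M.loopMap g⁆ =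
    M.loopMap ⁅f, g⁆ + (LoopSl2.cocycle f g * κ) • (1 : R) := by
  induction f using LoopSl2.mono_induction with
  | h0 => simp only [map_zero, zero_lie, LinearMap.zero_apply, zero_mul, zero_smul, add_zero]
  | hadd f f' hf hf' =>
    simp only [map_add, add_lie, LinearMap.add_apply, hf, hf', add_mul, add_smul]; abel
  | hm a m =>
    induction g using LoopSl2.mono_induction with
    | h0 => simp only [map_zero, lie_zero, zero_mul, zero_smul, add_zero]
    | hadd g g' hg hg' =>
      simp only [map_add, lie_add, hg, hg', add_mul, add_smul]; abel
    | hm b n =>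
      simp only [loopMap_mono, LoopSl2.lie_mono, LoopSl2.cocycle_mono]
      exact M.mode_lie_mode m n a b

theorem D_lie_loopMap (f : LoopSl2) : ⁅M.D, M.loopMap f⁆ = M.loopMap (LoopSl2.euler f) := by
  induction f using LoopSl2.mono_induction with
  | h0 => simp only [map_zero, lie_zero]
  | hadd f g hf hg => simp only [map_add, lie_add, hf, hg]
  | hm a m =>
    simp only [LoopSl2.euler_mono, map_smul, loopMap_mono, mode_apply, lie_add, lie_smul,
      D_X, D_Y, D_H]
    module

/-- The homomorphism from the affine Lie algebra of level `κ`. -/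
noncomputable def toLieHom : AffineSl2 →ₗ⁅ℂ⁆ R where
  toFun x := M.loopMap x.loop + (x.central * κ) • 1 + x.der • M.D
  map_add' x y := by
    simp only [AffineSl2.loop_add, AffineSl2.central_add, AffineSl2.der_add, map_add]; module
  map_smul' c x := by
    simp only [AffineSl2.loop_smul, AffineSl2.central_smul, AffineSl2.der_smul, map_smul,
      RingHom.id_apply]
    module
  map_lie' := by
    intro x y
    have h1 : ∀ T : R, ⁅(1 : R), T⁆ = 0 := fun T => by
      rw [LieRing.of_associative_ring_bracket, one_mul, mul_one, sub_self]
    have h2 : ∀ T : R, ⁅T, (1 : R)⁆ = 0 := fun T => by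
      rw [LieRing.of_associative_ring_bracket, one_mul, mul_one, sub_self]
    have h3 : ⁅M.loopMap x.loop, M.D⁆ = -M.loopMap (LoopSl2.euler x.loop) := by
      rw [← lie_skew, D_lie_loopMap]
    simp only [AffineSl2.lie_def, add_lie, lie_add, smul_lie, lie_smul, h1, h2, h3, lie_self,
      loopMap_lie, D_lie_loopMap, map_add, map_sub, map_smul]
    module

theorem toLieHom_apply (x : AffineSl2) :
    M.toLieHom x = M.loopMap x.loop + (x.central * κ) • 1 + x.der • M.D := rfl

theorem toLieHom_mode (a : Sl2) (m : ℤ) : M.toLieHom (AffineSl2.mode a m) = M.mode m a := by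
  rw [toLieHom_apply, AffineSl2.mode, loopMap_mono, zero_mul, zero_smul, zero_smul, add_zero,
    add_zero]

theorem toLieHom_X (m : ℤ) : M.toLieHom (AffineSl2.mode Sl2.X m) = M.X m := by
  simp [toLieHom_mode, mode_apply, Sl2.X]

theorem toLieHom_Y (m : ℤ) : M.toLieHom (AffineSl2.mode Sl2.Y m) = M.Y m := by
  simp [toLieHom_mode, mode_apply, Sl2.Y]

theorem toLieHom_H (m : ℤ) : M.toLieHom (AffineSl2.mode Sl2.H m) = M.H m := by
  simp [toLieHom_mode, mode_apply, Sl2.H]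

theorem toLieHom_c : M.toLieHom AffineSl2.c = κ • 1 := by
  simp [toLieHom_apply, AffineSl2.c]

theorem toLieHom_d : M.toLieHom AffineSl2.d = M.D := by
  simp [toLieHom_apply, AffineSl2.d]

end AffineModes

/-! ### Restriction to the charge-matched space -/

namespace ParafermionSpace

open TriTensor

variable {k : ℕ} {W : Type*} [AddCommGroup W] [Module ℂ W] (P : ParafermionSpace k W)

theorem tmul_mem_V (s : Fock) {n : ℤ} {w : W} (hw : w ∈ P.charge n) : tmul s w n ∈ P.V :=
  Submodule.subset_span ⟨s, n, w, hw, rfl⟩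

theorem V_induction {p : TriTensor W → Prop} (h0 : p 0) (hadd : ∀ x y, p x → p y → p (x + y))
    (hsmul : ∀ (c : ℂ) x, p x → p (c • x))
    (ht : ∀ (s : Fock) (n : ℤ), ∀ w ∈ P.charge n, p (tmul s w n)) {v : TriTensor W}
    (hv : v ∈ P.V) : p v := by
  induction hv using Submodule.span_induction with
  | mem x hx => obtain ⟨s, n, w, hw, rfl⟩ := hx; exact ht s n w hw
  | zero => exact h0
  | add x y _ _ hx hy => exact hadd x y hx hy
  | smul c x _ hx => exact hsmul c x hx

theorem map_mem_V {T : Module.End ℂ (TriTensor W)}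
    (hT : ∀ (s : Fock) (n : ℤ), ∀ w ∈ P.charge n, T (tmul s w n) ∈ P.V) :
    ∀ v ∈ P.V, T v ∈ P.V := fun _ hv =>
  P.V_induction (p := fun v => T v ∈ P.V) (by rw [map_zero]; exact P.V.zero_mem)
    (fun _ _ hx hy => by rw [map_add]; exact P.V.add_mem hx hy)
    (fun c _ hx => by rw [map_smul]; exact P.V.smul_mem c hx) hT hv

theorem vertex_mem_V {ε : ℤ} {A : ℚ → Module.End ℂ W} (hA : IsFieldSeries A)
    (hc : ∀ (n : ℤ) (r : ℚ), ∀ w ∈ P.charge n, A r w ∈ P.charge (n + ε)) (r : ℚ) :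
    ∀ v ∈ P.V, vertex k ε hA r v ∈ P.V :=
  P.map_mem_V fun s n w hw => by
    rw [vertex_tmul]
    exact finsum_induction (· ∈ P.V) P.V.zero_mem (fun _ _ => P.V.add_mem)
      fun x => P.tmul_mem_V _ (hc n _ w hw)

theorem X_mem_V (r : ℚ) : ∀ v ∈ P.V, P.X r v ∈ P.V :=
  P.vertex_mem_V P.A_field P.A_charge r

theorem Y_mem_V (r : ℚ) : ∀ v ∈ P.V, P.Y r v ∈ P.V :=
  P.vertex_mem_V P.Astar_field P.Astar_charge r

theorem H_mem_V (m : ℤ) : ∀ v ∈ P.V, TriTensor.H k m v ∈ P.V :=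
  P.map_mem_V fun s n w hw => by
    rw [H_tmul]
    exact P.V.add_mem (P.tmul_mem_V _ hw) (P.V.smul_mem _ (P.tmul_mem_V _ hw))

theorem totalDegree_mem_V : ∀ v ∈ P.V, P.totalDegree v ∈ P.V :=
  P.map_mem_V fun s n w hw => by
    change degreeOp k P.degree _ ∈ _
    rw [degreeOp_tmul]
    exact P.V.add_mem (P.V.add_mem (P.tmul_mem_V _ hw) (P.tmul_mem_V _ (P.degree_charge n w hw)))
      (P.V.smul_mem _ (P.tmul_mem_V _ hw))

/-- On matched charges the fractional exponent 2εn/k of the parafermion field cancels the exponent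
-2εn/k of the lattice factor, leaving integral powers of z. -/
theorem vertex_eq_zero {ε : ℤ} {A : ℚ → Module.End ℂ W} (hA : IsFieldSeries A)
    (he : ∀ (n : ℤ) (r : ℚ), ∀ w ∈ P.charge n, A r w ≠ 0 → ∃ i : ℤ, -r = 2 * ε * n / k + i)
    {r : ℚ} (hr : ∀ m : ℤ, r ≠ m) {v : TriTensor W} (hv : v ∈ P.V) : vertex k ε hA r v = 0 := by
  refine P.V_induction (p := fun v => vertex k ε hA r v = 0) (map_zero _)
    (fun x y hx hy => by rw [map_add, hx, hy, add_zero])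
    (fun c x hx => by rw [map_smul, hx, smul_zero]) (fun s n w hw => ?_) hv
  rw [vertex_tmul]
  refine (finsum_congr fun x => ?_).trans finsum_zero
  by_contra h
  obtain ⟨i, hi⟩ := he n _ w hw fun h0 => h (by rw [h0, tmul_zero_right])
  refine hr (x.2 - x.1 - i) ?_
  push_cast
  linear_combination -hi

theorem X_eq_zero {r : ℚ} (hr : ∀ m : ℤ, r ≠ m) {v : TriTensor W} (hv : v ∈ P.V) : P.X r v = 0 :=
  P.vertex_eq_zero P.A_field (fun n r w hw h => by
    obtain ⟨i, hi⟩ := P.A_exponent n r w hw h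
    exact ⟨i, by rw [hi]; push_cast; ring⟩) hr hv

theorem Y_eq_zero {r : ℚ} (hr : ∀ m : ℤ, r ≠ m) {v : TriTensor W} (hv : v ∈ P.V) : P.Y r v = 0 :=
  P.vertex_eq_zero P.Astar_field (fun n r w hw h => by
    obtain ⟨i, hi⟩ := P.Astar_exponent n r w hw h
    exact ⟨i, by rw [hi]; push_cast; ring⟩) hr hv

/-- The action of `X ⊗ t^m` on `V`. -/
noncomputable def modeX (m : ℤ) : Module.End ℂ P.V := (P.X m).restrict (P.X_mem_V m)

/-- The action of `Y ⊗ t^m` on `V`. -/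
noncomputable def modeY (m : ℤ) : Module.End ℂ P.V := (P.Y m).restrict (P.Y_mem_V m)

/-- The action of `H ⊗ t^m` on `V`. -/
noncomputable def modeH (m : ℤ) : Module.End ℂ P.V := (TriTensor.H k m).restrict (P.H_mem_V m)

/-- The action of the degree derivation on `V`. -/
noncomputable def degreeV : Module.End ℂ P.V := P.totalDegree.restrict P.totalDegree_mem_V

theorem modeX_lie_modeX (hk : k ≠ 0) (m n : ℤ) : ⁅P.modeX m, P.modeX n⁆ = 0 := by
  rw [LieRing.of_associative_ring_bracket, sub_eq_zero]
  exact LinearMap.ext fun v => Subtype.ext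
    (vertex_comm_apply hk (by norm_num) P.A_field P.A_A m n v)

theorem modeY_lie_modeY (hk : k ≠ 0) (m n : ℤ) : ⁅P.modeY m, P.modeY n⁆ = 0 := by
  rw [LieRing.of_associative_ring_bracket, sub_eq_zero]
  exact LinearMap.ext fun v => Subtype.ext
    (vertex_comm_apply hk (by norm_num) P.Astar_field P.Astar_Astar m n v)

theorem modeH_lie_modeH (m n : ℤ) : ⁅P.modeH m, P.modeH n⁆ =
    (if m + n = 0 then -2 * (m : ℂ) * k else 0) • (1 : Module.End ℂ P.V) := by
  rw [LieRing.of_associative_ring_bracket]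
  refine LinearMap.ext fun v => Subtype.ext ?_
  refine (H_lie_H_apply k m n (v : TriTensor W)).trans ?_
  rfl

theorem modeH_lie_modeX (hk : k ≠ 0) (m n : ℤ) :
    ⁅P.modeH m, P.modeX n⁆ = (2 : ℂ) • P.modeX (m + n) := by
  rw [LieRing.of_associative_ring_bracket]
  refine LinearMap.ext fun v => Subtype.ext ?_
  refine (H_lie_vertex_apply hk 1 P.A_field m n (v : TriTensor W)).trans ?_
  rw [Int.cast_one, mul_one, add_comm (n : ℚ), ← Int.cast_add]
  rfl

theorem modeH_lie_modeY (hk : k ≠ 0) (m n : ℤ) :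
    ⁅P.modeH m, P.modeY n⁆ = (-2 : ℂ) • P.modeY (m + n) := by
  rw [LieRing.of_associative_ring_bracket]
  refine LinearMap.ext fun v => Subtype.ext ?_
  refine (H_lie_vertex_apply hk (-1) P.Astar_field m n (v : TriTensor W)).trans ?_
  rw [Int.cast_neg, Int.cast_one, mul_neg, mul_one, add_comm (n : ℚ), ← Int.cast_add]
  rfl

theorem modeX_lie_modeY (hk : k ≠ 0) (m n : ℤ) : ⁅P.modeX m, P.modeY n⁆ =
    P.modeH (m + n) + (if m + n = 0 then -(k : ℂ) * m else 0) • (1 : Module.End ℂ P.V) := by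
  rw [LieRing.of_associative_ring_bracket]
  refine LinearMap.ext fun v => Subtype.ext ?_
  refine P.V_induction (p := fun v => P.X m (P.Y n v) - P.Y n (P.X m v) =
    TriTensor.H k (m + n) v + (if m + n = 0 then -(k : ℂ) * m else 0) • v) (by simp)
    (fun x y hx hy => ?_) (fun c x hx => ?_)
    (fun s l w hw => P.X_lie_Y_apply_tmul hk m n s hw) v.2
  · rw [smul_add, map_add (TriTensor.H k (m + n)), add_add_add_comm, ← hx, ← hy]
    simp only [map_add]
    abel
  · rw [smul_comm, map_smul (TriTensor.H k (m + n)), ← smul_add, ← hx]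
    simp only [map_smul, smul_sub]

theorem degreeV_lie_modeX (m : ℤ) : ⁅P.degreeV, P.modeX m⁆ = (m : ℂ) • P.modeX m := by
  rw [LieRing.of_associative_ring_bracket]
  refine LinearMap.ext fun v => Subtype.ext ?_
  refine (degreeOp_lie_vertex_apply (by norm_num) P.A_field P.degree_A m (v : TriTensor W)).trans ?_
  rw [Rat.cast_intCast]
  rfl

theorem degreeV_lie_modeY (m : ℤ) : ⁅P.degreeV, P.modeY m⁆ = (m : ℂ) • P.modeY m := by
  rw [LieRing.of_associative_ring_bracket]
  refine LinearMap.ext fun v => Subtype.ext ?_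
  refine (degreeOp_lie_vertex_apply (by norm_num) P.Astar_field P.degree_Astar m
    (v : TriTensor W)).trans ?_
  rw [Rat.cast_intCast]
  rfl

theorem degreeV_lie_modeH (m : ℤ) : ⁅P.degreeV, P.modeH m⁆ = (m : ℂ) • P.modeH m := by
  rw [LieRing.of_associative_ring_bracket]
  exact LinearMap.ext fun v => Subtype.ext (degreeOp_lie_H_apply k P.degree m v)

/-- The operators of the affine Lie algebra on `V`. -/
noncomputable def affineModes (hk : k ≠ 0) : AffineModes (Module.End ℂ P.V) (-(k : ℂ)) where
  H := P.modeH
  X := P.modeX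
  Y := P.modeY
  D := P.degreeV
  H_H m n := (P.modeH_lie_modeH m n).trans (congrArg (· • (1 : Module.End ℂ P.V))
    (if_congr Iff.rfl (by ring) rfl))
  X_X := P.modeX_lie_modeX hk
  Y_Y := P.modeY_lie_modeY hk
  H_X := P.modeH_lie_modeX hk
  H_Y := P.modeH_lie_modeY hk
  X_Y := P.modeX_lie_modeY hk
  D_H := P.degreeV_lie_modeH
  D_X := P.degreeV_lie_modeX
  D_Y := P.degreeV_lie_modeY

end ParafermionSpace

/-! ### Uniqueness and the theorem -/

/-- A linear map on the affine Lie algebra is determined by its values on the modes of the Chevalley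
basis, on `c` and on `d`. -/
theorem AffineSl2.linearMap_ext {M : Type*} [AddCommGroup M] [Module ℂ M] {φ ψ : AffineSl2 →ₗ[ℂ] M}
    (hX : ∀ m, φ (mode Sl2.X m) = ψ (mode Sl2.X m)) (hY : ∀ m, φ (mode Sl2.Y m) = ψ (mode Sl2.Y m))
    (hH : ∀ m, φ (mode Sl2.H m) = ψ (mode Sl2.H m)) (hc : φ c = ψ c) (hd : φ d = ψ d) : φ = ψ := by
  let ι : LoopSl2 →ₗ[ℂ] AffineSl2 :=
    { toFun := fun f => ⟨f, 0, 0⟩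
      map_add' := fun f g => by ext1 <;> simp
      map_smul' := fun c f => by ext1 <;> simp }
  have hmode : ∀ (a : Sl2) (m : ℤ), mode a m =
      a.1 0 0 • mode Sl2.H m + a.1 0 1 • mode Sl2.X m + a.1 1 0 • mode Sl2.Y m := by
    intro a m
    let μ : Sl2 →ₗ[ℂ] LoopSl2 := TensorProduct.mk ℂ (AddMonoidAlgebra ℂ ℤ) Sl2
      (AddMonoidAlgebra.single m (1 : ℂ))
    have h := congrArg (ι ∘ₗ μ) (Sl2.eq_smul_add a)
    simp only [map_add, map_smul] at h
    exact h
  have hι : ∀ f, φ (ι f) = ψ (ι f) := by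
    intro f
    induction f using LoopSl2.mono_induction with
    | h0 => simp only [map_zero]
    | hadd f g hf hg => simp only [map_add, hf, hg]
    | hm a m =>
      change φ (mode a m) = ψ (mode a m)
      rw [hmode]
      simp only [map_add, map_smul, hX, hY, hH]
  refine LinearMap.ext fun x => ?_
  have hx : x = ι x.loop + x.central • c + x.der • d := by
    ext1 <;> simp [ι, c, d]
  rw [hx]
  simp only [map_add, map_smul, hι, hc, hd]

theorem theorem3p2 (k : ℕ) (hk : 0 < k) {W : Type*} [AddCommGroup W] [Module ℂ W]
    (P : ParafermionSpace k W) :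
    (∀ r : ℚ, (∀ m : ℤ, r ≠ m) → ∀ v ∈ P.V, P.X r v = 0 ∧ P.Y r v = 0) ∧
    ∃! π : AffineSl2 →ₗ⁅ℂ⁆ Module.End ℂ P.V,
      (∀ (m : ℤ) (v : P.V), (π (AffineSl2.mode Sl2.X m) v : TriTensor W) = P.X m v) ∧
      (∀ (m : ℤ) (v : P.V), (π (AffineSl2.mode Sl2.Y m) v : TriTensor W) = P.Y m v) ∧
      (∀ (m : ℤ) (v : P.V), (π (AffineSl2.mode Sl2.H m) v : TriTensor W) = TriTensor.H k m (v : TriTensor W)) ∧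
      (∀ v : P.V, π AffineSl2.c v = (-(k : ℂ)) • v) ∧
      (∀ v : P.V, (π AffineSl2.d v : TriTensor W) = P.totalDegree v) := by
  let π₀ := (P.affineModes hk.ne').toLieHom
  have hX₀ : ∀ (m : ℤ) (v : P.V), (π₀ (AffineSl2.mode Sl2.X m) v : TriTensor W) = P.X m v :=
    fun m v => congrArg (fun T : Module.End ℂ P.V => (T v : TriTensor W))
      ((P.affineModes hk.ne').toLieHom_X m)
  have hY₀ : ∀ (m : ℤ) (v : P.V), (π₀ (AffineSl2.mode Sl2.Y m) v : TriTensor W) = P.Y m v :=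
    fun m v => congrArg (fun T : Module.End ℂ P.V => (T v : TriTensor W))
      ((P.affineModes hk.ne').toLieHom_Y m)
  have hH₀ : ∀ (m : ℤ) (v : P.V), (π₀ (AffineSl2.mode Sl2.H m) v : TriTensor W) =
      TriTensor.H k m (v : TriTensor W) :=
    fun m v => congrArg (fun T : Module.End ℂ P.V => (T v : TriTensor W))
      ((P.affineModes hk.ne').toLieHom_H m)
  have hc₀ : ∀ v : P.V, π₀ AffineSl2.c v = (-(k : ℂ)) • v :=
    fun v => congrArg (fun T : Module.End ℂ P.V => T v) (P.affineModes hk.ne').toLieHom_c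
  have hd₀ : ∀ v : P.V, (π₀ AffineSl2.d v : TriTensor W) = P.totalDegree v :=
    fun v => congrArg (fun T : Module.End ℂ P.V => (T v : TriTensor W))
      (P.affineModes hk.ne').toLieHom_d
  refine ⟨fun r hr v hv => ⟨P.X_eq_zero hr hv, P.Y_eq_zero hr hv⟩, π₀,
    ⟨hX₀, hY₀, hH₀, hc₀, hd₀⟩, ?_⟩
  rintro π ⟨hX, hY, hH, hc, hd⟩
  have h : (π : AffineSl2 →ₗ[ℂ] Module.End ℂ P.V) = (π₀ : AffineSl2 →ₗ[ℂ] Module.End ℂ P.V) :=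
    AffineSl2.linearMap_ext
      (fun m => LinearMap.ext fun v => Subtype.ext ((hX m v).trans (hX₀ m v).symm))
      (fun m => LinearMap.ext fun v => Subtype.ext ((hY m v).trans (hY₀ m v).symm))
      (fun m => LinearMap.ext fun v => Subtype.ext ((hH m v).trans (hH₀ m v).symm))
      (LinearMap.ext fun v => (hc v).trans (hc₀ v).symm)
      (LinearMap.ext fun v => Subtype.ext ((hd v).trans (hd₀ v).symm))
  exact LieHom.ext fun x => congrArg (fun φ : AffineSl2 →ₗ[ℂ] Module.End ℂ P.V => φ x) h
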